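/- Let $n\ge 1$, $s\in(0,1)$, and let $\Omega\subset\mathbb{R}^n$ be a bounded open set such that $P(\Omega)<\infty$ and $\mathcal H^{n-1}(\partial\Omega)<\infty$. Here $P(E,\Omega)=\sup\{\int_\Omega\chi_E\,\mathrm{div}\,g\,dx:\ g\in C^1_c(\Omega;\mathbb{R}^n),\ |g|\le 1\}$ and $P(\Omega)=P(\Omega,\mathbb{R}^n)$. Write $\mathcal C F=\mathbb{R}^n\setminus F$, let $c_{n,s}=\frac{2^s\Gamma(\frac{n+s}{2})}{\pi^{n/2}|\Gamma(-\frac s2)|}$, and let $\alpha,\beta:\mathcal C\Omega\to[0,\infty)$ be bounded Lipschitz functions with $\alpha+\beta\ge\sigma$ on $\mathcal C\Omega$ for some constant $\sigma>0$. For $\varepsilon>0$ and measurable $E\subset\Omega$, let $\phi_E^\varepsilon$ be the bounded weak solution of $$\begin{cases}\phi+\varepsilon^s(-\Delta)^{s/2}\phi=\chi_E&\text{in }\Omega,\\ \alpha\,\phi+\beta\,\widetilde{\mathcal N}(\phi)=0&\text{a.e. in }\mathcal C\Omega,\end{cases}\qquad \widetilde{\mathcal N}(\phi)(x)=\Big(\int_\Omega\frac{dy}{|x-y|^{n+s}}\Big)^{-1}\int_\Omega\frac{\phi(x)-\phi(y)}{|x-y|^{n+s}}\,dy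 .$$ That is, $\phi$ is a bounded measurable function on $\mathbb{R}^n$ with $\iint_{\mathbb{R}^{2n}\setminus(\mathcal C\Omega)^2}\frac{|\phi(x)-\phi(y)|^2}{|x-y|^{n+s}}\,dx\,dy<\infty$ which satisfies the exterior condition a.e. in $\mathcal C\Omega$ and $$\int_\Omega\phi v\,dx+\varepsilon^s\,\frac{c_{n,s}}2\iint_{\mathbb{R}^{2n}\setminus(\mathcal C\Omega)^2}\frac{(\phi(x)-\phi(y))(v(x)-v(y))}{|x-y|^{n+s}}\,dx\,dy=\int_\Omega\chi_E v\,dx$$ for all bounded measurable $v$ of finite energy (in the same sense) vanishing outside $\Omega$. For $t>0$ put $$\mathscr G^s_\varepsilon(E)=P(E,\Omega)-t\,\varepsilon^{-s}\int_\Omega\chi_E(1-\phi_E^\varepsilon)\,dx\in(-\infty,+\infty].$$ For measurable $F\subset\mathbb{R}^n$ let $\psi_F(x)=\int_F\frac{dy}{|x-y|^{n+s}}$, let $P_s^L(E,\Omega)=\frac12\int_\Omega\int_\Omega\frac{|\chi_E(x)-\chi_E(y)|}{|x-y|^{n+s}}\,dx\,dy$, and put $$\mathscr G^s_0(E)=P(E,\Omega)-t\,c_{n,s}\left[P_s^L(E,\Omega)+\int_{\mathcal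 C\Omega}\frac{\alpha}{\alpha+\beta}\,\psi_E\,dx+\int_{\mathcal C\Omega}\frac{\beta}{\alpha+\beta}\,\frac{\psi_{E\cap\Omega}\,\psi_{\mathcal CE\cap\Omega}}{\psi_\Omega}\,dx\right]$$ if $P(E,\Omega)<\infty$, and $\mathscr G^s_0(E)=+\infty$ if $P(E,\Omega)=\infty$. **Theorem.** For every $\varepsilon>0$ and every measurable $E\subset\Omega$ the solution $\phi_E^\varepsilon$ exists and is unique up to null sets in $\Omega$. For every $t>0$, the functionals $\mathscr G^s_\varepsilon$ $\Gamma$-converge to $\mathscr G^s_0$ as $\varepsilon\to0^+$, on the measurable subsets of $\Omega$ with the $L^1(\Omega)$ topology: for every measurable $E\subset\Omega$, 1. every family $E_\varepsilon\subset\Omega$ of measurable sets with $\chi_{E_\varepsilon}\to\chi_E$ in $L^1(\Omega)$ satisfies $\liminf_{\varepsilon\to0^+}\mathscr G^s_\varepsilon(E_\varepsilon)\ge\mathscr G^s_0(E)$; 2. there is a family $E_\varepsilon\subset\Omega$ of measurable sets with $\chi_{E_\varepsilon}\to\chi_E$ in $L^1(\Omega)$ and $\limsup_{\varepsilon\to0^+}\mathscr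 G^s_\varepsilon(E_\varepsilon)\le\mathscr G^s_0(E)$. -/

import Mathlib

open MeasureTheory Filter Topology Set
open scoped ENNReal NNReal

namespace RobinGamma

/-- Euclidean space `ℝⁿ`. -/
abbrev Eu (n : ℕ) : Type := EuclideanSpace ℝ (Fin n)

variable {n : ℕ}

/-- The characteristic function of a set. -/
noncomputable def chi (E : Set (Eu n)) : Eu n → ℝ := E.indicator (fun _ => 1)

/-! ### Perimeter -/

/-- Divergence of a vector field. -/
noncomputable def divergence (g : Eu n → Eu n) (x : Eu n) : ℝ :=
  ∑ i : Fin n, (fderiv ℝ g x (EuclideanSpace.single i 1)) i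

/-- The perimeter of `E` in the open set `Ω`: the supremum of `∫_Ω χ_E div g` over
`C¹` vector fields `g`, compactly supported in `Ω`, with `|g| ≤ 1`. -/
noncomputable def perimeter (E Ω : Set (Eu n)) : ℝ≥0∞ :=
  ⨆ (g : Eu n → Eu n) (_ : ContDiff ℝ 1 g) (_ : HasCompactSupport g) (_ : tsupport g ⊆ Ω)
    (_ : ∀ x, ‖g x‖ ≤ 1), ENNReal.ofReal (∫ x in Ω, chi E x * divergence g x)

/-! ### The fractional kernel and the fractional perimeter -/

/-- The normalizing constant `c_{n,s}` of the fractional Laplacian `(-Δ)^{s/2}` on `ℝⁿ`. -/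
noncomputable def cns (n : ℕ) (s : ℝ) : ℝ :=
  2 ^ s * Real.Gamma ((n + s) / 2) / (Real.pi ^ ((n : ℝ) / 2) * |Real.Gamma (-s / 2)|)

/-- The kernel `|x - y|^{-(n+s)}` (the value on the diagonal is irrelevant). -/
noncomputable def ker (s : ℝ) (x y : Eu n) : ℝ := 1 / ‖x - y‖ ^ ((n : ℝ) + s)

/-- The potential `ψ_F(x) = ∫_F |x - y|^{-(n+s)} dy`. -/
noncomputable def psi (s : ℝ) (F : Set (Eu n)) (x : Eu n) : ℝ≥0∞ :=
  ∫⁻ y in F, ENNReal.ofReal (ker s x y)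

/-- The local contribution of the `s`-perimeter,
`P_s^L(E,Ω) = (1/2) ∫_Ω ∫_Ω |χ_E(x) - χ_E(y)| |x - y|^{-(n+s)} dx dy`. -/
noncomputable def localPs (s : ℝ) (E Ω : Set (Eu n)) : ℝ≥0∞ :=
  (1 / 2) * ∫⁻ x in Ω, ∫⁻ y in Ω, ENNReal.ofReal (|chi E x - chi E y| * ker s x y)

/-! ### The nonlocal Robin problem -/

/-- The interaction region `ℝ²ⁿ \ (𝒞Ω)²`. -/
def interaction (Ω : Set (Eu n)) : Set (Eu n × Eu n) := (Ωᶜ ×ˢ Ωᶜ)ᶜ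

/-- Bounded measurable functions of finite energy,
`∬_{ℝ²ⁿ \ (𝒞Ω)²} |u(x) - u(y)|² |x - y|^{-(n+s)} dx dy < ∞`. -/
structure FiniteEnergy (s : ℝ) (Ω : Set (Eu n)) (u : Eu n → ℝ) : Prop where
  meas : AEStronglyMeasurable u volume
  bdd : ∃ M : ℝ, ∀ᵐ x, |u x| ≤ M
  energy : ∫⁻ p in interaction Ω, ENNReal.ofReal ((u p.1 - u p.2) ^ 2 * ker s p.1 p.2) < ⊤

/-- The bilinear form `(c_{n,s}/2) ∬_{ℝ²ⁿ \ (𝒞Ω)²} (u(x)-u(y)) (v(x)-v(y)) |x-y|^{-(n+s)} dx dy`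
of `(-Δ)^{s/2}`; for `v` vanishing outside `Ω` it is the weak form of `∫_Ω v (-Δ)^{s/2} u`. -/
noncomputable def fracForm (s : ℝ) (Ω : Set (Eu n)) (u v : Eu n → ℝ) : ℝ :=
  cns n s / 2 * ∫ p in interaction Ω, (u p.1 - u p.2) * (v p.1 - v p.2) * ker s p.1 p.2

/-- The nonlocal normal derivative `𝒩 φ (x) = c_{n,s} ∫_Ω (φ(x) - φ(y)) |x - y|^{-(n+s)} dy`. -/
noncomputable def nonlocalN (s : ℝ) (Ω : Set (Eu n)) (φ : Eu n → ℝ) (x : Eu n) : ℝ :=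
  cns n s * ∫ y in Ω, (φ x - φ y) * ker s x y

/-- The normalized nonlocal normal derivative `𝒩 φ (x) / (c_{n,s} ∫_Ω |x - y|^{-(n+s)} dy)`. -/
noncomputable def normalizedN (s : ℝ) (Ω : Set (Eu n)) (φ : Eu n → ℝ) (x : Eu n) : ℝ :=
  1 / (cns n s * ∫ y in Ω, ker s x y) * nonlocalN s Ω φ x

/-- `φ` is a bounded weak solution of
`φ + ε^s (-Δ)^{s/2} φ = χ_E` in `Ω`, with `α φ + β Ñ φ = 0` in the complement of `Ω`. -/
structure IsRobinSolution (s : ℝ) (Ω : Set (Eu n)) (α β : Eu n → ℝ) (ε : ℝ) (E : Set (Eu n))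
    (φ : Eu n → ℝ) : Prop where
  finiteEnergy : FiniteEnergy s Ω φ
  equation : ∀ v : Eu n → ℝ, FiniteEnergy s Ω v → (∀ x ∈ Ωᶜ, v x = 0) →
    (∫ x in Ω, φ x * v x) + ε ^ s * fracForm s Ω φ v = ∫ x in Ω, chi E x * v x
  exterior : ∀ᵐ x ∂volume.restrict Ωᶜ, α x * φ x + β x * normalizedN s Ω φ x = 0

open Classical in
/-- The potential `φ_E^ε`: the solution of the Robin problem (`0` if there were none). -/
noncomputable def potential (s : ℝ) (Ω : Set (Eu n)) (α β : Eu n → ℝ) (ε : ℝ) (E : Set (Eu n)) :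
    Eu n → ℝ :=
  if h : ∃ φ, IsRobinSolution s Ω α β ε E φ then h.choose else 0

/-! ### The functionals -/

/-- `𝒥^s_ε(E) = ε^{-s} ∫_Ω χ_E (1 - φ_E^ε) dx`. -/
noncomputable def Jeps (s : ℝ) (Ω : Set (Eu n)) (α β : Eu n → ℝ) (ε : ℝ) (E : Set (Eu n)) : ℝ :=
  ε ^ (-s) * ∫ x in Ω, chi E x * (1 - potential s Ω α β ε E x)

/-- `𝒢^s_ε(E) = P(E,Ω) - t 𝒥^s_ε(E)`, with values in `(-∞, +∞]`. -/
noncomputable def Geps (s t : ℝ) (Ω : Set (Eu n)) (α β : Eu n → ℝ) (ε : ℝ) (E : Set (Eu n)) :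
    EReal :=
  (perimeter E Ω : EReal) - ((t * Jeps s Ω α β ε E : ℝ) : EReal)

/-- The limit of `𝒥^s_ε`, divided by `c_{n,s}`. -/
noncomputable def bracket (s : ℝ) (Ω : Set (Eu n)) (α β : Eu n → ℝ) (E : Set (Eu n)) : ℝ≥0∞ :=
  localPs s E Ω
    + (∫⁻ x in Ωᶜ, ENNReal.ofReal (α x / (α x + β x)) * psi s E x)
    + ∫⁻ x in Ωᶜ, ENNReal.ofReal (β x / (α x + β x)) *
        (psi s (E ∩ Ω) x * psi s (Eᶜ ∩ Ω) x / psi s Ω x)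

open Classical in
/-- `𝒢^s_0(E) = P(E,Ω) - t c_{n,s} [...]`, understood as `+∞` when `P(E,Ω) = ∞` (the bracket
may then be infinite too). -/
noncomputable def Gzero (s t : ℝ) (Ω : Set (Eu n)) (α β : Eu n → ℝ) (E : Set (Eu n)) : EReal :=
  if perimeter E Ω = ⊤ then ⊤
  else (perimeter E Ω : EReal)
    - ((ENNReal.ofReal (t * cns n s) * bracket s Ω α β E : ℝ≥0∞) : EReal)

/-! ### Γ-convergence -/

/-- The measurable subsets of `Ω`. -/
def Admissible (Ω E : Set (Eu n)) : Prop := MeasurableSet E ∧ E ⊆ Ω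

/-- `χ_{E_ε} → χ_E` in `L¹(Ω)` as `ε → 0⁺`. -/
def ConvergesL1 (Ω : Set (Eu n)) (Es : ℝ → Set (Eu n)) (E : Set (Eu n)) : Prop :=
  Tendsto (fun ε => ∫⁻ x in Ω, ENNReal.ofReal |chi (Es ε) x - chi E x|) (𝓝[>] 0) (𝓝 0)

/-- Γ-convergence as `ε → 0⁺`, on measurable subsets of `Ω`, for the `L¹(Ω)` topology:
the liminf inequality and the existence of recovery families. -/
def GammaConverges (Ω : Set (Eu n)) (F : ℝ → Set (Eu n) → EReal) (F₀ : Set (Eu n) → EReal) :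
    Prop :=
  (∀ E, Admissible Ω E → ∀ Es : ℝ → Set (Eu n), (∀ ε, Admissible Ω (Es ε)) →
    ConvergesL1 Ω Es E → F₀ E ≤ liminf (fun ε => F ε (Es ε)) (𝓝[>] 0)) ∧
  (∀ E, Admissible Ω E → ∃ Es : ℝ → Set (Eu n), (∀ ε, Admissible Ω (Es ε)) ∧
    ConvergesL1 Ω Es E ∧ limsup (fun ε => F ε (Es ε)) (𝓝[>] 0) ≤ F₀ E)

end RobinGamma

namespace RobinGamma

variable {n : ℕ}

/-! Outside `Ω` the Robin condition can be solved for the unknown: `φ(x)` is `ρ(x) = β/(α+β)` times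
the average of `φ` over `Ω` with weight `ker s x`. Substituting this into the weak equation
eliminates the exterior. What remains is a nonnegative symmetric form `Q` on functions living on
`Ω`, with three parts: jumps inside `Ω`, killing with weight `(1-ρ) ker`, and jumps between two
points of `Ω` reflected at an exterior point. All three are integrals of squared differences against
one measure, `jumpMeasure`, so `Q` is `jumpEnergy (jumpMeasure s Ω ρ)`. With `l = ε^s c`, `c = cns n
s`, the restriction of `φ` to `Ω` is the resolvent of `Q` applied to `χ_E` (`fracForm_eq_jumpForm`,
`IsRobinSolution.isResolvent`, `exists_isRobinSolution`). The resolvent exists because a strictly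
convex functional has a minimizer, and testing with a difference gives uniqueness.

Consequently `Jeps` equals `c` times the Yosida approximation `l⁻¹ ∫ χ_E (χ_E - φ)` of `Q(χ_E)`. Two
general facts suffice: it is at most `Q(χ_E)` for every `l` (`IsResolvent.defect_le`), and for a
fixed set it recovers `Q(χ_E)` as `l → 0⁺` (`eventually_lt_defect`). Moreover `Q(χ_E)` is exactly
the bracket of the limit functional (`jumpEnergy_chi`). The second fact makes constant families
recovery families.

For the liminf inequality the first fact bounds `Jeps` at `E_ε` by `c Q(χ_{E_ε})`, uniformly in `ε`,
and Young's inequality compares this with `c Q(χ_E)` up to a multiple of `Q(χ_{E_ε} - χ_E)`. Since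
`s < 1`, splitting the kernel at a small radius bounds the last term by a small multiple of the
perimeters plus a large multiple of the `L¹` distance (`exists_jumpEnergy_chi_sub_le`). The small
multiple is absorbed by `P(E_ε, Ω)`, which is lower semicontinuous. The splitting needs perimeters
in the whole space; these exceed those in `Ω` by at most a constant because `∂Ω` has finite
`H^{n-1}` measure (`exists_perimeter_univ_le`). -/

lemma liminf_add_liminf_le (a b : ℕ → ℝ≥0∞) :
    liminf a atTop + liminf b atTop ≤ liminf (fun k => a k + b k) atTop := by
  simp only [liminf_eq_iSup_iInf_of_nat]
  rw [ENNReal.iSup_add_iSup_of_monotone]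
  · refine iSup_mono fun k => le_iInf₂ fun i hi => add_le_add ?_ ?_
    · exact iInf₂_le i hi
    · exact iInf₂_le i hi
  all_goals
    intro i j hij
    exact le_iInf₂ fun k hk => iInf₂_le k (hij.trans hk)

/-! ### Abstract jump forms: resolvents and their Yosida approximations. -/

section JumpForms

variable {X : Type*} [MeasurableSpace X]

/-- The quadratic form `∬ (u(y) - u(z))² dν(y, z)`. -/
noncomputable def jumpEnergy (ν : Measure (X × X)) (u : X → ℝ) : ℝ≥0∞ :=
  ∫⁻ p, ENNReal.ofReal ((u p.1 - u p.2) ^ 2) ∂ν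

/-- The bilinear form `∬ (u(y) - u(z)) (v(y) - v(z)) dν(y, z)`. -/
noncomputable def jumpForm (ν : Measure (X × X)) (u v : X → ℝ) : ℝ :=
  ∫ p, (u p.1 - u p.2) * (v p.1 - v p.2) ∂ν

/-- The two marginals of `ν` are absolutely continuous with respect to `m`. -/
structure AbsContMarginals (m : Measure X) (ν : Measure (X × X)) : Prop where
  fst : Measure.QuasiMeasurePreserving Prod.fst ν m
  snd : Measure.QuasiMeasurePreserving Prod.snd ν m

/-- Bounded measurable functions vanishing outside `Ω`, of finite energy. -/
structure FormDomain (m : Measure X) (ν : Measure (X × X)) (Ω : Set X) (u : X → ℝ) : Prop where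
  meas : AEStronglyMeasurable u m
  bdd : ∃ M : ℝ, ∀ᵐ x ∂m, |u x| ≤ M
  zero : ∀ x ∉ Ω, u x = 0
  energy : jumpEnergy ν u < ⊤

/-- `φ` solves `φ + l L φ = f` weakly, where `L` is the operator of the form `jumpForm ν`. -/
structure IsResolvent (m : Measure X) (ν : Measure (X × X)) (Ω : Set X) (l : ℝ) (f φ : X → ℝ) :
    Prop where
  domain : FormDomain m ν Ω φ
  equation : ∀ v, FormDomain m ν Ω v →
    ∫ x in Ω, φ x * v x ∂m + l * jumpForm ν φ v = ∫ x in Ω, f x * v x ∂m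

variable {m : Measure X} {ν : Measure (X × X)} {Ω : Set X} {l : ℝ} {f φ u v : X → ℝ}

lemma AbsContMarginals.difference (hν : AbsContMarginals m ν) (hu : AEStronglyMeasurable u m) :
    AEStronglyMeasurable (fun p : X × X => u p.1 - u p.2) ν :=
  (hu.comp_quasiMeasurePreserving hν.fst).sub (hu.comp_quasiMeasurePreserving hν.snd)

lemma memLp_difference (hν : AbsContMarginals m ν) (hu : AEStronglyMeasurable u m)
    (he : jumpEnergy ν u < ⊤) : MemLp (fun p : X × X => u p.1 - u p.2) 2 ν := by
  have h := hν.difference hu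
  refine (memLp_two_iff_integrable_sq h).2 ⟨h.pow 2, ?_⟩
  rw [hasFiniteIntegral_iff_ofReal (Eventually.of_forall fun p => sq_nonneg _)]
  exact he

lemma integrable_jumpForm (hν : AbsContMarginals m ν) (hu : FormDomain m ν Ω u)
    (hv : FormDomain m ν Ω v) :
    Integrable (fun p : X × X => (u p.1 - u p.2) * (v p.1 - v p.2)) ν :=
  (memLp_difference hν hu.meas hu.energy).integrable_mul (memLp_difference hν hv.meas hv.energy)

lemma jumpForm_self (hν : AbsContMarginals m ν) (hu : AEStronglyMeasurable u m) :
    jumpForm ν u u = (jumpEnergy ν u).toReal := by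
  have h := hν.difference hu
  rw [jumpForm, jumpEnergy, ← integral_eq_lintegral_of_nonneg_ae
    (Eventually.of_forall fun p => sq_nonneg _) (h.pow 2)]
  simp only [sq]

lemma jumpForm_comm (ν : Measure (X × X)) (u v : X → ℝ) : jumpForm ν u v = jumpForm ν v u := by
  simp only [jumpForm, mul_comm]

/-- If `u` and `v` have finite energy, so has a function whose differences are pointwise
controlled by theirs. -/
lemma jumpEnergy_lt_top_of_le (hν : AbsContMarginals m ν) {C : ℝ} {w : X → ℝ}
    (hu : AEStronglyMeasurable u m) (hue : jumpEnergy ν u < ⊤) (hve : jumpEnergy ν v < ⊤)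
    (h : ∀ y z, (w y - w z) ^ 2 ≤ C * ((u y - u z) ^ 2 + (v y - v z) ^ 2)) :
    jumpEnergy ν w < ⊤ := by
  have hm : AEMeasurable (fun p : X × X => ENNReal.ofReal ((u p.1 - u p.2) ^ 2)) ν :=
    ((hν.difference hu).pow 2).aemeasurable.ennreal_ofReal
  calc jumpEnergy ν w
      ≤ ∫⁻ p, ENNReal.ofReal C *
          (ENNReal.ofReal ((u p.1 - u p.2) ^ 2) + ENNReal.ofReal ((v p.1 - v p.2) ^ 2)) ∂ν := by
        refine lintegral_mono fun p => ?_
        rw [← ENNReal.ofReal_add (sq_nonneg _) (sq_nonneg _), ← ENNReal.ofReal_mul' (by positivity)]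
        exact ENNReal.ofReal_le_ofReal (h _ _)
    _ = ENNReal.ofReal C * (jumpEnergy ν u + jumpEnergy ν v) := by
        rw [lintegral_const_mul' _ _ ENNReal.ofReal_ne_top, lintegral_add_left' hm]
        rfl
    _ < ⊤ := ENNReal.mul_lt_top ENNReal.ofReal_lt_top (ENNReal.add_lt_top.2 ⟨hue, hve⟩)

lemma FormDomain.add_mul (hν : AbsContMarginals m ν) (hu : FormDomain m ν Ω u)
    (hv : FormDomain m ν Ω v) (c : ℝ) : FormDomain m ν Ω (fun x => u x + c * v x) := by
  obtain ⟨M, hM⟩ := hu.bdd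
  obtain ⟨M', hM'⟩ := hv.bdd
  refine ⟨hu.meas.add (hv.meas.const_mul c), ⟨M + |c| * M', ?_⟩, ?_, ?_⟩
  · filter_upwards [hM, hM'] with x h1 h2
    calc |u x + c * v x| ≤ |u x| + |c * v x| := abs_add_le _ _
      _ = |u x| + |c| * |v x| := by rw [abs_mul]
      _ ≤ M + |c| * M' := by gcongr
  · intro x hx
    rw [hu.zero x hx, hv.zero x hx]
    ring
  · refine jumpEnergy_lt_top_of_le (C := 2 * (1 + c ^ 2)) hν hu.meas hu.energy hv.energy ?_
    intro y z
    have h1 := sq_nonneg (u y - u z - c * (v y - v z))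
    have h2 := mul_nonneg (sq_nonneg c) (sq_nonneg (u y - u z))
    have h3 := sq_nonneg (v y - v z)
    nlinarith

lemma jumpForm_add_mul_left (hν : AbsContMarginals m ν) {w : X → ℝ} (hu : FormDomain m ν Ω u)
    (hv : FormDomain m ν Ω v) (hw : FormDomain m ν Ω w) (c : ℝ) :
    jumpForm ν (fun x => u x + c * v x) w = jumpForm ν u w + c * jumpForm ν v w := by
  rw [jumpForm, jumpForm, jumpForm, ← integral_const_mul,
    ← integral_add (integrable_jumpForm hν hu hw) ((integrable_jumpForm hν hv hw).const_mul c)]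
  exact integral_congr_ae (Eventually.of_forall fun p => by simp only; ring)

lemma jumpForm_add_mul_self (hν : AbsContMarginals m ν) (hu : FormDomain m ν Ω u)
    (hv : FormDomain m ν Ω v) (c : ℝ) :
    jumpForm ν (fun x => u x + c * v x) (fun x => u x + c * v x) =
      jumpForm ν u u + 2 * c * jumpForm ν u v + c ^ 2 * jumpForm ν v v := by
  rw [jumpForm_add_mul_left hν hu hv (hu.add_mul hν hv c), jumpForm_comm ν u, jumpForm_comm ν v,
    jumpForm_add_mul_left hν hu hv hu, jumpForm_add_mul_left hν hu hv hv, jumpForm_comm ν v u]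
  ring

lemma jumpForm_self_nonneg (ν : Measure (X × X)) (u : X → ℝ) : 0 ≤ jumpForm ν u u :=
  integral_nonneg fun _ => mul_self_nonneg _

lemma two_mul_jumpForm_le (hν : AbsContMarginals m ν) (hu : FormDomain m ν Ω u)
    (hv : FormDomain m ν Ω v) : 2 * jumpForm ν u v ≤ jumpForm ν u u + jumpForm ν v v := by
  have h := jumpForm_self_nonneg ν (fun x => u x + (-1) * v x)
  rw [jumpForm_add_mul_self hν hu hv] at h
  linarith

/-- Fatou's lemma for the energy. -/
lemma jumpEnergy_le_liminf (hν : AbsContMarginals m ν) {w : ℕ → X → ℝ}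
    (hw : ∀ k, AEStronglyMeasurable (w k) m)
    (hlim : ∀ᵐ x ∂m, Tendsto (fun k => w k x) atTop (𝓝 (u x))) :
    jumpEnergy ν u ≤ liminf (fun k => jumpEnergy ν (w k)) atTop := by
  refine le_trans (lintegral_mono_ae ?_) (lintegral_liminf_le' fun k =>
    ((hν.difference (hw k)).pow 2).aemeasurable.ennreal_ofReal)
  filter_upwards [hν.fst.ae hlim, hν.snd.ae hlim] with p h1 h2
  exact ((ENNReal.continuous_ofReal.tendsto _).comp ((h1.sub h2).pow 2)).liminf_eq.ge

lemma FormDomain.integrable_mul (hΩ : m Ω ≠ ⊤) (hu : AEStronglyMeasurable u m)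
    (hub : ∃ M : ℝ, ∀ᵐ x ∂m, |u x| ≤ M) (hv : FormDomain m ν Ω v) :
    Integrable (fun x => u x * v x) (m.restrict Ω) := by
  obtain ⟨M, hM⟩ := hub
  obtain ⟨M', hM'⟩ := hv.bdd
  have : IsFiniteMeasure (m.restrict Ω) := ⟨by simpa using hΩ.lt_top⟩
  refine Integrable.of_bound (hu.mul hv.meas).restrict (|M| * |M'|) (ae_restrict_of_ae ?_)
  filter_upwards [hM, hM'] with x h1 h2
  rw [norm_mul]
  exact mul_le_mul (h1.trans (le_abs_self _)) (h2.trans (le_abs_self _)) (abs_nonneg _)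
    (abs_nonneg _)

/-- The functional minimized by the resolvent. -/
noncomputable def penalized (m : Measure X) (ν : Measure (X × X)) (Ω : Set X) (l : ℝ) (f : X → ℝ)
    (u : X → ℝ) : ℝ≥0∞ :=
  ∫⁻ x in Ω, ENNReal.ofReal ((u x - f x) ^ 2) ∂m + ENNReal.ofReal l * jumpEnergy ν u

/-- Measurable functions with values in `[0,1]`, vanishing outside `Ω`. -/
structure UnitValued (m : Measure X) (Ω : Set X) (u : X → ℝ) : Prop where
  meas : AEStronglyMeasurable u m
  mem : ∀ x, u x ∈ Icc (0 : ℝ) 1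
  zero : ∀ x ∉ Ω, u x = 0

lemma UnitValued.abs_le (hu : UnitValued m Ω u) (x : X) : |u x| ≤ 1 := by
  rw [abs_of_nonneg (hu.mem x).1]
  exact (hu.mem x).2

lemma UnitValued.formDomain (hu : UnitValued m Ω u) (he : jumpEnergy ν u < ⊤) :
    FormDomain m ν Ω u :=
  ⟨hu.meas, ⟨1, Eventually.of_forall hu.abs_le⟩, hu.zero, he⟩

/-- The parallelogram identity for the `L²` term, and its consequence for the energy. The gain on
the left makes minimizing sequences Cauchy in `L²(Ω)`. -/
lemma penalized_midpoint (hν : AbsContMarginals m ν) (hf : AEStronglyMeasurable f m)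
    (hu : AEStronglyMeasurable u m) (hv : AEStronglyMeasurable v m) :
    penalized m ν Ω l f (fun x => (u x + v x) / 2) +
        ∫⁻ x in Ω, ENNReal.ofReal (((u x - v x) / 2) ^ 2) ∂m ≤
      (penalized m ν Ω l f u + penalized m ν Ω l f v) / 2 := by
  have key : ∀ {Y : Type _} [MeasurableSpace Y] (μ : Measure Y) (a b : Y → ℝ),
      AEStronglyMeasurable a μ → AEStronglyMeasurable b μ →
      ∫⁻ y, ENNReal.ofReal (((a y + b y) / 2) ^ 2) ∂μ +
        ∫⁻ y, ENNReal.ofReal (((a y - b y) / 2) ^ 2) ∂μ =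
      (∫⁻ y, ENNReal.ofReal (a y ^ 2) ∂μ + ∫⁻ y, ENNReal.ofReal (b y ^ 2) ∂μ) / 2 := by
    intro Y _ μ a b ha hb
    have h2 : (2 : ℝ≥0∞)⁻¹ ≠ ⊤ := by simp
    have ha' := ha.aemeasurable
    have hb' := hb.aemeasurable
    have m1 : AEMeasurable (fun y => ENNReal.ofReal (((a y + b y) / 2) ^ 2)) μ := by fun_prop
    have m2 : AEMeasurable (fun y => ENNReal.ofReal (a y ^ 2)) μ := by fun_prop
    rw [← lintegral_add_left' m1, ← lintegral_add_left' m2, div_eq_mul_inv,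
      ← lintegral_mul_const' _ _ h2]
    refine lintegral_congr fun y => ?_
    rw [← ENNReal.ofReal_add (by positivity) (by positivity),
      ← ENNReal.ofReal_add (by positivity) (by positivity), ← div_eq_mul_inv,
      show (2 : ℝ≥0∞) = ENNReal.ofReal 2 by simp, ← ENNReal.ofReal_div_of_pos two_pos]
    congr 1
    ring
  have h1 := key (m.restrict Ω) (fun x => u x - f x) (fun x => v x - f x) (hu.sub hf).restrict
    (hv.sub hf).restrict
  have h2 := key ν (fun p => u p.1 - u p.2) (fun p => v p.1 - v p.2) (hν.difference hu)
    (hν.difference hv)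
  have e1 : ∀ x, u x - f x - (v x - f x) = u x - v x := fun x => by ring
  have e2 : ∀ x, (u x - f x + (v x - f x)) / 2 = (u x + v x) / 2 - f x := fun x => by ring
  have e3 : ∀ p : X × X, (u p.1 - u p.2 + (v p.1 - v p.2)) / 2 =
      (u p.1 + v p.1) / 2 - (u p.2 + v p.2) / 2 := fun p => by ring
  simp only [e1, e2] at h1
  simp only [e3] at h2
  have h3 : jumpEnergy ν (fun x => (u x + v x) / 2) ≤ (jumpEnergy ν u + jumpEnergy ν v) / 2 := by
    rw [jumpEnergy, jumpEnergy, jumpEnergy, ← h2]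
    exact le_self_add
  calc _ = (∫⁻ x in Ω, ENNReal.ofReal (((u x + v x) / 2 - f x) ^ 2) ∂m +
        ∫⁻ x in Ω, ENNReal.ofReal (((u x - v x) / 2) ^ 2) ∂m) +
        ENNReal.ofReal l * jumpEnergy ν (fun x => (u x + v x) / 2) := by
        rw [penalized]; ring
    _ ≤ _ := by
        rw [h1]
        refine (add_le_add_right (mul_le_mul_right h3 _) _).trans (le_of_eq ?_)
        simp only [penalized, div_eq_mul_inv]
        ring

/-- Truncation to `[0,1]` is 1-Lipschitz and fixes the values of `f`. Hence a minimizer among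
`[0,1]`-valued functions also beats unrestricted competitors. -/
lemma penalized_clip_le (hf : ∀ x, f x ∈ Icc (0 : ℝ) 1) (u : X → ℝ) :
    penalized m ν Ω l f (fun x => max 0 (min 1 (u x))) ≤ penalized m ν Ω l f u := by
  have hc : ∀ a b : ℝ, (max 0 (min 1 a) - max 0 (min 1 b)) ^ 2 ≤ (a - b) ^ 2 := by
    intro a b
    rw [sq_le_sq]
    refine (abs_max_sub_max_le_max _ _ _ _).trans ?_
    rw [sub_self, abs_zero, max_eq_right (abs_nonneg _)]
    refine (abs_min_sub_min_le_max _ _ _ _).trans ?_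
    rw [sub_self, abs_zero, max_eq_right (abs_nonneg _)]
  refine add_le_add (lintegral_mono fun x => ENNReal.ofReal_le_ofReal ?_)
    (mul_le_mul_right (lintegral_mono fun p => ENNReal.ofReal_le_ofReal (hc _ _)) _)
  have h := hc (u x) (f x)
  rwa [min_eq_right (hf x).2, max_eq_right (hf x).1] at h

lemma unitValued_clip (hu : AEStronglyMeasurable u m) (h0 : ∀ x ∉ Ω, u x = 0) :
    UnitValued m Ω (fun x => max 0 (min 1 (u x))) := by
  refine ⟨?_, fun x => ⟨le_max_left _ _, max_le zero_le_one (min_le_left _ _)⟩, fun x hx => ?_⟩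
  · exact (by fun_prop : Continuous fun t : ℝ => max 0 (min 1 t)).comp_aestronglyMeasurable hu
  · simp [h0 x hx]

/-- The penalized functional has a minimizer among the functions with values in `[0,1]`. -/
lemma exists_minimizer (hν : AbsContMarginals m ν) (hΩm : MeasurableSet Ω) (hΩ : m Ω ≠ ⊤)
    (hf : UnitValued m Ω f) :
    ∃ φ, UnitValued m Ω φ ∧ penalized m ν Ω l f φ < ⊤ ∧
      ∀ u, UnitValued m Ω u → penalized m ν Ω l f φ ≤ penalized m ν Ω l f u := by
  have hfin : IsFiniteMeasure (m.restrict Ω) := ⟨by simpa using hΩ.lt_top⟩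
  set F := penalized m ν Ω l f with hF
  set I : ℝ≥0∞ := ⨅ u : {u : X → ℝ // UnitValued m Ω u}, F u with hI
  have hle : ∀ u, UnitValued m Ω u → I ≤ F u := fun u hu => iInf_le (fun u : {u : X → ℝ //
    UnitValued m Ω u} => F u) ⟨u, hu⟩
  have h0 : UnitValued m Ω (fun _ => 0) :=
    ⟨aestronglyMeasurable_const, fun _ => ⟨le_rfl, zero_le_one⟩, fun _ _ => rfl⟩
  have hItop : I < ⊤ := by
    refine (hle _ h0).trans_lt ?_
    have : F (fun _ => 0) ≤ ∫⁻ x in Ω, 1 ∂m := by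
      rw [hF, penalized]
      simp only [jumpEnergy, sub_self, ne_eq, OfNat.ofNat_ne_zero, not_false_eq_true, zero_pow,
        ENNReal.ofReal_zero, lintegral_zero, mul_zero, add_zero, zero_sub]
      refine lintegral_mono fun x => ?_
      rw [show (1 : ℝ≥0∞) = ENNReal.ofReal 1 by simp]
      refine ENNReal.ofReal_le_ofReal ?_
      have := hf.mem x
      nlinarith [this.1, this.2]
    refine this.trans_lt ?_
    simpa using hΩ.lt_top
  -- With this tolerance the midpoint inequality gives squared `L²` distances at most `16^(-N)/4`,
  -- so distances below the summable `4^(-N)`, which forces a.e. convergence of the whole sequence.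
  set d : ℕ → ℝ≥0∞ := fun k => ENNReal.ofReal ((1 / 16) ^ k / 16) with hd
  have hdpos : ∀ k, 0 < d k := fun k => ENNReal.ofReal_pos.2 (by positivity)
  have hex : ∀ k, ∃ u : {u : X → ℝ // UnitValued m Ω u}, F u < I + d k := fun k =>
    iInf_lt_iff.1 (ENNReal.lt_add_right hItop.ne (hdpos k).ne')
  choose w hw using hex
  have hcau : ∀ N j k : ℕ, N ≤ j → N ≤ k →
      eLpNorm' ((w j : X → ℝ) - (w k : X → ℝ)) 2 (m.restrict Ω) < ENNReal.ofReal ((1 / 4) ^ N) := by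
    intro N j k hj hk
    have hmid : UnitValued m Ω (fun x => ((w j : X → ℝ) x + (w k : X → ℝ) x) / 2) := by
      refine ⟨(((w j).2.meas.aemeasurable.add (w k).2.meas.aemeasurable).div_const 2).aestronglyMeasurable, fun x => ?_, fun x hx => ?_⟩
      · have h1 := (w j).2.mem x
        have h2 := (w k).2.mem x
        constructor <;> linarith [h1.1, h1.2, h2.1, h2.2]
      · rw [(w j).2.zero x hx, (w k).2.zero x hx]
        norm_num
    have hanti : ∀ i, N ≤ i → d i ≤ d N := fun i hi => ENNReal.ofReal_le_ofReal (by
      gcongr ?_ / 16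
      exact pow_le_pow_of_le_one (by norm_num) (by norm_num) hi)
    have h1 := penalized_midpoint (l := l) (Ω := Ω) hν hf.meas (w j).2.meas (w k).2.meas
    have h2 : I + ∫⁻ x in Ω, ENNReal.ofReal ((((w j : X → ℝ) x - (w k : X → ℝ) x) / 2) ^ 2) ∂m ≤
        I + d N := by
      refine (add_le_add_left (hle _ hmid) _).trans (h1.trans ?_)
      have h3 : F (w j) + F (w k) ≤ (I + d N) + (I + d N) :=
        add_le_add ((hw j).le.trans (by gcongr; exact hanti j hj))
          ((hw k).le.trans (by gcongr; exact hanti k hk))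
      refine (ENNReal.div_le_div_right h3 2).trans ?_
      rw [ENNReal.add_div, ENNReal.add_halves]
    have h3 := (ENNReal.add_le_add_iff_left hItop.ne).1 h2
    have h4 : ∫⁻ x in Ω, ‖((w j : X → ℝ) - (w k : X → ℝ)) x‖ₑ ^ (2 : ℝ) ∂m ≤
        ENNReal.ofReal ((1 / 16) ^ N / 4) := by
      calc _ = ∫⁻ x in Ω, 4 *
            ENNReal.ofReal ((((w j : X → ℝ) x - (w k : X → ℝ) x) / 2) ^ 2) ∂m := by
            refine lintegral_congr fun x => ?_
            rw [Pi.sub_apply, Real.enorm_eq_ofReal_abs,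
              ENNReal.ofReal_rpow_of_nonneg (abs_nonneg _) (by norm_num),
              show (4 : ℝ≥0∞) = ENNReal.ofReal 4 by simp, ← ENNReal.ofReal_mul (by norm_num)]
            congr 1
            rw [show (2 : ℝ) = ((2 : ℕ) : ℝ) by norm_num, Real.rpow_natCast, sq_abs]
            push_cast
            ring
        _ ≤ 4 * d N := by
            rw [lintegral_const_mul' _ _ (by simp)]
            gcongr
        _ = _ := by
            rw [hd, show (4 : ℝ≥0∞) = ENNReal.ofReal 4 by simp,
              ← ENNReal.ofReal_mul (by norm_num)]
            congr 1
            ring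
    rw [eLpNorm'_eq_lintegral_enorm]
    refine (ENNReal.rpow_le_rpow h4 (by norm_num)).trans_lt ?_
    rw [ENNReal.ofReal_rpow_of_nonneg (by positivity) (by norm_num), ← Real.sqrt_eq_rpow]
    refine ENNReal.ofReal_lt_ofReal_iff (by positivity) |>.2 ?_
    rw [Real.sqrt_lt' (by positivity), ← pow_mul, mul_comm N 2, pow_mul]
    norm_num
    rw [div_lt_iff₀ (by norm_num)]
    have : (0 : ℝ) < (1 / 16) ^ N := by positivity
    linarith
  have hsum : ∑' i : ℕ, ENNReal.ofReal ((1 / 4 : ℝ) ^ i) ≠ ⊤ := by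
    rw [← ENNReal.ofReal_tsum_of_nonneg (fun i => by positivity)
      (summable_geometric_of_lt_one (by norm_num) (by norm_num))]
    exact ENNReal.ofReal_ne_top
  obtain ⟨g, hgm, hg⟩ := exists_stronglyMeasurable_limit_of_tendsto_ae
    (fun k => (w k).2.meas.restrict) (Lp.ae_tendsto_of_cauchy_eLpNorm'
      (fun k => (w k).2.meas.restrict) one_le_two hsum hcau)
  -- The a.e. limit is altered on a null set so that the bounds and the vanishing outside `Ω` hold
  -- at every point.
  set φ : X → ℝ := fun x => max 0 (min 1 (Ω.indicator g x)) with hφ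
  have hφu : UnitValued m Ω φ :=
    unitValued_clip (hgm.indicator hΩm).aestronglyMeasurable fun x hx => indicator_of_notMem hx _
  have hlim : ∀ᵐ x ∂m, Tendsto (fun k => (w k : X → ℝ) x) atTop (𝓝 (φ x)) := by
    filter_upwards [(ae_restrict_iff' hΩm).1 hg] with x hx
    by_cases hxΩ : x ∈ Ω
    · have hlx := hx hxΩ
      have hmem : g x ∈ Icc (0 : ℝ) 1 :=
        isClosed_Icc.mem_of_tendsto hlx (Eventually.of_forall fun k => (w k).2.mem x)
      have : φ x = g x := by
        simp only [hφ, indicator_of_mem hxΩ, min_eq_right hmem.2, max_eq_right hmem.1]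
      rwa [this]
    · simp only [fun k => (w k).2.zero x hxΩ, hφu.zero x hxΩ]
      exact tendsto_const_nhds
  have hmin : F φ ≤ I := by
    have h1 : ∫⁻ x in Ω, ENNReal.ofReal ((φ x - f x) ^ 2) ∂m ≤
        liminf (fun k => ∫⁻ x in Ω, ENNReal.ofReal (((w k : X → ℝ) x - f x) ^ 2) ∂m) atTop := by
      refine le_trans (lintegral_mono_ae (ae_restrict_of_ae ?_)) (lintegral_liminf_le' fun k =>
        (((w k).2.meas.sub hf.meas).pow 2).restrict.aemeasurable.ennreal_ofReal)
      filter_upwards [hlim] with x hx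
      exact ((ENNReal.continuous_ofReal.tendsto _).comp
        ((hx.sub tendsto_const_nhds).pow 2)).liminf_eq.ge
    have h2 : ENNReal.ofReal l * jumpEnergy ν φ ≤
        liminf (fun k => ENNReal.ofReal l * jumpEnergy ν (w k)) atTop := by
      rw [ENNReal.liminf_const_mul_of_ne_top ENNReal.ofReal_ne_top]
      exact mul_le_mul_right (jumpEnergy_le_liminf hν (fun k => (w k).2.meas) hlim) _
    have h3 : F φ ≤ liminf (fun k => F (w k)) atTop :=
      (add_le_add h1 h2).trans (liminf_add_liminf_le _ _)
    have hd0 : Tendsto (fun k => I + d k) atTop (𝓝 (I + 0)) := by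
      refine tendsto_const_nhds.add ?_
      rw [show (0 : ℝ≥0∞) = ENNReal.ofReal (0 / 16) by simp]
      exact ENNReal.tendsto_ofReal
        ((tendsto_pow_atTop_nhds_zero_of_lt_one (by norm_num) (by norm_num)).div_const 16)
    refine h3.trans ((liminf_le_liminf (Eventually.of_forall fun k => (hw k).le)).trans ?_)
    rw [hd0.liminf_eq, add_zero]
  exact ⟨φ, hφu, hmin.trans_lt hItop, fun u hu => hmin.trans (hle u hu)⟩

lemma penalized_eq_ofReal (hν : AbsContMarginals m ν) (hΩ : m Ω ≠ ⊤) (hl : 0 ≤ l)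
    (hf : AEStronglyMeasurable f m) (hfb : ∃ M : ℝ, ∀ᵐ x ∂m, |f x| ≤ M)
    (hu : FormDomain m ν Ω u) :
    penalized m ν Ω l f u =
      ENNReal.ofReal (∫ x in Ω, (u x - f x) ^ 2 ∂m + l * jumpForm ν u u) := by
  have : IsFiniteMeasure (m.restrict Ω) := ⟨by simpa using hΩ.lt_top⟩
  obtain ⟨M, hM⟩ := hfb
  obtain ⟨M', hM'⟩ := hu.bdd
  have hint : Integrable (fun x => (u x - f x) ^ 2) (m.restrict Ω) := by
    refine Integrable.of_bound ((hu.meas.sub hf).pow 2).restrict ((M' + M) ^ 2)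
      (ae_restrict_of_ae ?_)
    filter_upwards [hM, hM'] with x h1 h2
    rw [norm_pow]
    gcongr
    exact (norm_sub_le _ _).trans (add_le_add h2 h1)
  rw [ENNReal.ofReal_add (integral_nonneg fun _ => sq_nonneg _)
    (mul_nonneg hl (jumpForm_self_nonneg _ _)), ENNReal.ofReal_mul hl, jumpForm_self hν hu.meas,
    ENNReal.ofReal_toReal hu.energy.ne,
    ofReal_integral_eq_lintegral_ofReal hint (Eventually.of_forall fun _ => sq_nonneg _)]
  rfl

/-- Existence of the resolvent, with values in `[0,1]`. -/
theorem exists_isResolvent (hν : AbsContMarginals m ν) (hΩm : MeasurableSet Ω) (hΩ : m Ω ≠ ⊤)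
    (hf : UnitValued m Ω f) (hl : 0 < l) : ∃ φ, UnitValued m Ω φ ∧ IsResolvent m ν Ω l f φ := by
  obtain ⟨φ, hφ, hφF, hmin⟩ := exists_minimizer (l := l) hν hΩm hΩ hf
  have hφe : jumpEnergy ν φ < ⊤ := by
    have h := (ENNReal.add_lt_top.1 hφF).2
    exact ENNReal.lt_top_of_mul_ne_top_right h.ne (ENNReal.ofReal_pos.2 hl).ne'
  have hφd := hφ.formDomain hφe
  have hfb : ∃ M : ℝ, ∀ᵐ x ∂m, |f x| ≤ M := ⟨1, Eventually.of_forall hf.abs_le⟩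
  refine ⟨φ, hφ, hφd, fun v hv => ?_⟩
  have i1 := FormDomain.integrable_mul hΩ hφ.meas hφd.bdd hv
  have i2 := FormDomain.integrable_mul hΩ hf.meas hfb hv
  have i3 := FormDomain.integrable_mul hΩ hv.meas hv.bdd hv
  have i4 : Integrable (fun x => (φ x - f x) ^ 2) (m.restrict Ω) := by
    have : IsFiniteMeasure (m.restrict Ω) := ⟨by simpa using hΩ.lt_top⟩
    refine Integrable.of_bound ((hφ.meas.sub hf.meas).pow 2).restrict 1
      (Eventually.of_forall fun x => ?_)
    have h1 := hφ.mem x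
    have h2 := hf.mem x
    rw [Real.norm_eq_abs, abs_of_nonneg (sq_nonneg _), sq_le_one_iff_abs_le_one, abs_le]
    constructor <;> linarith [h1.1, h1.2, h2.1, h2.2]
  set a := ∫ x in Ω, v x * v x ∂m + l * jumpForm ν v v with ha
  set b := ∫ x in Ω, φ x * v x ∂m + l * jumpForm ν φ v - ∫ x in Ω, f x * v x ∂m with hb
  -- First variation: `φ + r v` need not take values in `[0,1]`, but its truncation is an admissible
  -- competitor with no larger penalized value.
  have hquad : ∀ r : ℝ, 0 ≤ 2 * r * b + r ^ 2 * a := by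
    intro r
    have hw := hφd.add_mul hν hv r
    have h1 := (hmin _ (unitValued_clip hw.meas hw.zero)).trans (penalized_clip_le hf.mem _)
    rw [penalized_eq_ofReal hν hΩ hl.le hf.meas hfb hφd,
      penalized_eq_ofReal hν hΩ hl.le hf.meas hfb hw, ENNReal.ofReal_le_ofReal_iff
        (add_nonneg (integral_nonneg fun _ => sq_nonneg _)
          (mul_nonneg hl.le (jumpForm_self_nonneg _ _))), jumpForm_add_mul_self hν hφd hv] at h1
    have h2 : ∫ x in Ω, (φ x + r * v x - f x) ^ 2 ∂m = ∫ x in Ω, (φ x - f x) ^ 2 ∂m +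
        (2 * r * (∫ x in Ω, φ x * v x ∂m - ∫ x in Ω, f x * v x ∂m) +
          r ^ 2 * ∫ x in Ω, v x * v x ∂m) := by
      have i5 : Integrable (fun x => 2 * r * (φ x * v x - f x * v x)) (m.restrict Ω) :=
        (i1.sub i2).const_mul _
      have i6 : Integrable (fun x => r ^ 2 * (v x * v x)) (m.restrict Ω) := i3.const_mul _
      have i7 : Integrable (fun x => 2 * r * (φ x * v x - f x * v x) + r ^ 2 * (v x * v x))
        (m.restrict Ω) := i5.add i6
      rw [← integral_sub i1 i2, ← integral_const_mul, ← integral_const_mul, ← integral_add i5 i6,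
        ← integral_add i4 i7]
      exact integral_congr_ae (Eventually.of_forall fun x => by simp only; ring)
    rw [h2] at h1
    rw [ha, hb]
    linarith
  have ha0 : 0 ≤ a := add_nonneg (integral_nonneg fun _ => mul_self_nonneg _)
    (mul_nonneg hl.le (jumpForm_self_nonneg _ _))
  have hb0 : b = 0 := by
    -- The optimal `r` would be `-b/a`; using `a + 1` avoids the case `a = 0` and still makes the
    -- quadratic negative unless `b = 0`.
    have h := hquad (-b / (a + 1))
    have h2 : 2 * (-b / (a + 1)) * b + (-b / (a + 1)) ^ 2 * a =
        -(b ^ 2 * (a + 2)) / (a + 1) ^ 2 := by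
      field_simp
      ring
    rw [h2, div_nonneg_iff] at h
    have h3 : 0 < (a + 1) ^ 2 := by positivity
    have h4 : b ^ 2 * (a + 2) ≤ 0 := by
      rcases h with h | h
      · linarith [h.1]
      · linarith [h.2]
    have h5 : b ^ 2 ≤ 0 := by nlinarith [sq_nonneg b, mul_nonneg (sq_nonneg b) ha0]
    exact pow_eq_zero_iff two_ne_zero |>.1 (le_antisymm h5 (sq_nonneg b))
  linarith

/-- Testing both equations with the difference `w` gives `∫ w² + l Q(w) = 0`, where both terms are
nonnegative. -/
lemma IsResolvent.ae_eq (hν : AbsContMarginals m ν) (hΩ : m Ω ≠ ⊤) (hl : 0 ≤ l) {φ' : X → ℝ}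
    (h : IsResolvent m ν Ω l f φ) (h' : IsResolvent m ν Ω l f φ') :
    ∀ᵐ x ∂m.restrict Ω, φ x = φ' x := by
  have hw := h.domain.add_mul hν h'.domain (-1)
  set w := fun x => φ x + -1 * φ' x with hwdef
  have e1 := h.equation w hw
  have e2 := h'.equation w hw
  have e3 := jumpForm_add_mul_left hν h.domain h'.domain hw (-1)
  have i1 := FormDomain.integrable_mul hΩ h.domain.meas h.domain.bdd hw
  have i2 := FormDomain.integrable_mul hΩ h'.domain.meas h'.domain.bdd hw
  have i3 := FormDomain.integrable_mul hΩ hw.meas hw.bdd hw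
  have e4 : ∫ x in Ω, w x * w x ∂m = ∫ x in Ω, φ x * w x ∂m - ∫ x in Ω, φ' x * w x ∂m := by
    rw [← integral_sub i1 i2]
    exact integral_congr_ae (Eventually.of_forall fun x => by simp only [hwdef]; ring)
  have e5 : ∫ x in Ω, w x * w x ∂m = 0 := by
    refine le_antisymm ?_ (integral_nonneg fun _ => mul_self_nonneg _)
    have := mul_nonneg hl (jumpForm_self_nonneg ν w)
    rw [show jumpForm ν w w = jumpForm ν φ w + -1 * jumpForm ν φ' w from e3] at this
    linarith
  rw [integral_eq_zero_iff_of_nonneg (fun _ => mul_self_nonneg _) i3] at e5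
  filter_upwards [e5] with x hx
  have : w x = 0 := mul_self_eq_zero.1 hx
  simp only [hwdef] at this
  linarith

/-- The equation tested with `φ` itself. It bounds both the `L²` distance from `f` to `φ` and the
energy of `φ` by the defect, without assuming that `f` has finite energy. -/
lemma IsResolvent.defect_eq (hΩ : m Ω ≠ ⊤) (hf : UnitValued m Ω f)
    (h : IsResolvent m ν Ω l f φ) :
    ∫ x in Ω, f x * (f x - φ x) ∂m = ∫ x in Ω, (f x - φ x) ^ 2 ∂m + l * jumpForm ν φ φ := by
  have hfb : ∃ M : ℝ, ∀ᵐ x ∂m, |f x| ≤ M := ⟨1, Eventually.of_forall hf.abs_le⟩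
  -- The zero jump measure serves only to reuse the integrability lemma, since the `ν`-energy of `f`
  -- may be infinite here.
  have h0 : FormDomain m 0 Ω f := ⟨hf.meas, hfb, hf.zero, by simp [jumpEnergy]⟩
  have e := h.equation φ h.domain
  have i1 := FormDomain.integrable_mul hΩ h.domain.meas h.domain.bdd h.domain
  have i2 := FormDomain.integrable_mul hΩ hf.meas hfb h.domain
  have i3 := FormDomain.integrable_mul hΩ hf.meas hfb h0
  have e1 : ∫ x in Ω, f x * (f x - φ x) ∂m =
      ∫ x in Ω, f x * f x ∂m - ∫ x in Ω, f x * φ x ∂m := by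
    rw [← integral_sub i3 i2]
    exact integral_congr_ae (Eventually.of_forall fun x => by simp only; ring)
  have e2 : ∫ x in Ω, (f x - φ x) ^ 2 ∂m = ∫ x in Ω, f x * f x ∂m -
      2 * ∫ x in Ω, f x * φ x ∂m + ∫ x in Ω, φ x * φ x ∂m := by
    have i4 : Integrable (fun x => f x * f x - 2 * (f x * φ x)) (m.restrict Ω) :=
      i3.sub (i2.const_mul _)
    rw [← integral_const_mul, ← integral_sub i3 (i2.const_mul _), ← integral_add i4 i1]
    exact integral_congr_ae (Eventually.of_forall fun x => by simp only; ring)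
  rw [e1, e2]
  linarith

/-- Testing with `f` shows that the defect is `l Q(φ, f)`, so twice the defect is at most `l Q(φ) +
l Q(f)`. By `defect_eq` the first term is at most the defect and can be absorbed. -/
lemma IsResolvent.defect_le (hν : AbsContMarginals m ν) (hΩ : m Ω ≠ ⊤) (hl : 0 ≤ l)
    (hf : UnitValued m Ω f) (hfe : jumpEnergy ν f < ⊤) (h : IsResolvent m ν Ω l f φ) :
    ∫ x in Ω, f x * (f x - φ x) ∂m ≤ l * (jumpEnergy ν f).toReal := by
  have hfd := hf.formDomain hfe
  have e := h.equation f hfd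
  have e1 := h.defect_eq hΩ hf
  have i2 := FormDomain.integrable_mul hΩ h.domain.meas h.domain.bdd hfd
  have i3 := FormDomain.integrable_mul hΩ hf.meas hfd.bdd hfd
  have e2 : ∫ x in Ω, f x * (f x - φ x) ∂m =
      ∫ x in Ω, f x * f x ∂m - ∫ x in Ω, φ x * f x ∂m := by
    rw [← integral_sub i3 i2]
    exact integral_congr_ae (Eventually.of_forall fun x => by simp only; ring)
  have e3 := mul_le_mul_of_nonneg_left (two_mul_jumpForm_le hν h.domain hfd) hl
  have e4 : 0 ≤ ∫ x in Ω, (f x - φ x) ^ 2 ∂m := integral_nonneg fun _ => sq_nonneg _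
  rw [← jumpForm_self hν hf.meas]
  linarith

/-- The Yosida approximations `l⁻¹ ⟨f, f - φ_l⟩` recover the energy of `f` as `l → 0⁺`. -/
theorem eventually_lt_defect (hν : AbsContMarginals m ν) (hΩm : MeasurableSet Ω) (hΩ : m Ω ≠ ⊤)
    (hf : UnitValued m Ω f) (hfe : jumpEnergy ν f < ⊤) {d : ℝ} (hd : d < (jumpEnergy ν f).toReal) :
    ∀ᶠ l in 𝓝[>] (0 : ℝ), ∀ φ, IsResolvent m ν Ω l f φ →
      d < l⁻¹ * ∫ x in Ω, f x * (f x - φ x) ∂m := by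
  have hfin : IsFiniteMeasure (m.restrict Ω) := ⟨by simpa using hΩ.lt_top⟩
  -- If the claim fails, some `l_k → 0⁺` have resolvents of energy at most `d`. They converge to `f`
  -- in `L²(Ω)`, since the defect is at most `l_k Q(f)`, so Fatou along an a.e. convergent
  -- subsequence gives `Q(f) ≤ d`.
  by_contra hcon
  rw [not_eventually] at hcon
  obtain ⟨ls, hls, hP⟩ := exists_seq_forall_of_frequently
    (hcon.and_eventually self_mem_nhdsWithin)
  have hpos : ∀ k, 0 < ls k := fun k => (hP k).2
  have hex : ∀ k, ∃ φ, IsResolvent m ν Ω (ls k) f φ ∧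
      (ls k)⁻¹ * ∫ x in Ω, f x * (f x - φ x) ∂m ≤ d := fun k => by
    have := (hP k).1
    push Not at this
    exact this
  choose w hw hwd using hex
  have hQ : ∀ k, jumpForm ν (w k) (w k) ≤ d := by
    intro k
    refine le_trans ?_ (hwd k)
    rw [(hw k).defect_eq hΩ hf, mul_add, ← mul_assoc, inv_mul_cancel₀ (hpos k).ne', one_mul]
    exact le_add_of_nonneg_left (mul_nonneg (inv_nonneg.2 (hpos k).le)
      (integral_nonneg fun _ => sq_nonneg _))
  have hL2 : ∀ k, ∫ x in Ω, (f x - w k x) ^ 2 ∂m ≤ ls k * (jumpEnergy ν f).toReal := by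
    intro k
    refine le_trans ?_ ((hw k).defect_le hν hΩ (hpos k).le hf hfe)
    rw [(hw k).defect_eq hΩ hf]
    exact le_add_of_nonneg_right (mul_nonneg (hpos k).le (jumpForm_self_nonneg _ _))
  have hint : ∀ k, Integrable (fun x => (f x - w k x) ^ 2) (m.restrict Ω) := by
    intro k
    have hd := (hf.formDomain hfe).add_mul hν (hw k).domain (-1)
    refine (FormDomain.integrable_mul hΩ hd.meas hd.bdd hd).congr (Eventually.of_forall fun x => ?_)
    simp only
    ring
  have hmeas : TendstoInMeasure (m.restrict Ω) (fun k x => (f x - w k x) ^ 2) atTop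
      (fun _ => 0) := by
    refine tendstoInMeasure_of_tendsto_eLpNorm one_ne_zero (fun k => (hint k).1)
      aestronglyMeasurable_const ?_
    have h1 : ∀ k, eLpNorm ((fun x => (f x - w k x) ^ 2) - fun _ => 0) 1 (m.restrict Ω) ≤
        ENNReal.ofReal (ls k * (jumpEnergy ν f).toReal) := by
      intro k
      rw [eLpNorm_one_eq_lintegral_enorm]
      refine le_trans (le_of_eq ?_) (ENNReal.ofReal_le_ofReal (hL2 k))
      rw [ofReal_integral_eq_lintegral_ofReal (hint k) (Eventually.of_forall fun _ => sq_nonneg _)]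
      refine lintegral_congr fun x => ?_
      simp only [Pi.sub_apply, sub_zero]
      rw [Real.enorm_eq_ofReal (sq_nonneg _)]
    refine tendsto_of_tendsto_of_tendsto_of_le_of_le tendsto_const_nhds ?_ (fun _ => zero_le) h1
    rw [show (0 : ℝ≥0∞) = ENNReal.ofReal (0 * (jumpEnergy ν f).toReal) by simp]
    exact ENNReal.tendsto_ofReal ((hls.mono_right nhdsWithin_le_nhds).mul_const _)
  obtain ⟨ns, -, hns⟩ := hmeas.exists_seq_tendsto_ae
  have hlim : ∀ᵐ x ∂m, Tendsto (fun k => w (ns k) x) atTop (𝓝 (f x)) := by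
    filter_upwards [(ae_restrict_iff' hΩm).1 hns] with x hx
    by_cases hxΩ : x ∈ Ω
    · have h1 := (Real.continuous_sqrt.tendsto 0).comp (hx hxΩ)
      simp only [Function.comp_def, Real.sqrt_sq_eq_abs, Real.sqrt_zero] at h1
      have h2 := (tendsto_zero_iff_abs_tendsto_zero _).2 h1
      simpa using (tendsto_const_nhds (x := f x)).sub h2
    · simp only [fun k => (hw k).domain.zero x hxΩ, hf.zero x hxΩ]
      exact tendsto_const_nhds
  have h1 := jumpEnergy_le_liminf hν (fun k => (hw (ns k)).domain.meas) hlim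
  have h2 : jumpEnergy ν f ≤ ENNReal.ofReal d := by
    refine h1.trans (liminf_le_of_frequently_le' (Eventually.frequently
      (Eventually.of_forall fun k => ?_)))
    rw [← ENNReal.ofReal_toReal (hw (ns k)).domain.energy.ne,
      ← jumpForm_self hν (hw (ns k)).domain.meas]
    exact ENNReal.ofReal_le_ofReal (hQ _)
  have hd0 : 0 ≤ d := (jumpForm_self_nonneg ν (w 0)).trans (hQ 0)
  exact absurd hd (not_lt.2 (ENNReal.toReal_le_of_le_ofReal hd0 h2))

end JumpForms

/-! ### Perimeter: lower semicontinuity and the `L¹` modulus of continuity. -/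

section Perimeter

lemma chi_mem (E : Set (Eu n)) (x : Eu n) : chi E x ∈ Icc (0 : ℝ) 1 := by
  by_cases hx : x ∈ E <;> simp [chi, hx]

lemma abs_chi_le (E : Set (Eu n)) (x : Eu n) : |chi E x| ≤ 1 :=
  abs_le.2 ⟨by linarith [(chi_mem E x).1], (chi_mem E x).2⟩

lemma measurable_chi {E : Set (Eu n)} (hE : MeasurableSet E) : Measurable (chi E) :=
  measurable_const.indicator hE

lemma integrable_chi {E : Set (Eu n)} (hE : MeasurableSet E) (hv : volume E ≠ ⊤) :
    Integrable (chi E) :=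
  (integrable_indicator_iff hE).2 (integrableOn_const hv)

lemma continuous_divergence {g : Eu n → Eu n} (hg : ContDiff ℝ 1 g) :
    Continuous (divergence g) := by
  have h := hg.continuous_fderiv one_ne_zero
  unfold divergence
  fun_prop

lemma hasCompactSupport_divergence {g : Eu n → Eu n} (hg : HasCompactSupport g) :
    HasCompactSupport (divergence g) := by
  refine (hg.fderiv (𝕜 := ℝ)).mono fun x hx => ?_
  contrapose! hx
  simp only [Function.mem_support, not_not] at hx
  simp [divergence, hx]

lemma exists_divergence_bound {g : Eu n → Eu n} (hg : ContDiff ℝ 1 g) (hc : HasCompactSupport g) :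
    ∃ M : ℝ, ∀ x, ‖divergence g x‖ ≤ M :=
  (continuous_divergence hg).bounded_above_of_compact_support (hasCompactSupport_divergence hc)

lemma integrable_divergence {g : Eu n → Eu n} (hg : ContDiff ℝ 1 g) (hc : HasCompactSupport g) :
    Integrable (divergence g) :=
  (continuous_divergence hg).integrable_of_hasCompactSupport (hasCompactSupport_divergence hc)

lemma integrable_chi_mul_divergence {E : Set (Eu n)} (hE : MeasurableSet E) {g : Eu n → Eu n}
    (hg : ContDiff ℝ 1 g) (hc : HasCompactSupport g) :
    Integrable (fun x => chi E x * divergence g x) :=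
  (integrable_divergence hg hc).bdd_mul (measurable_chi hE).aestronglyMeasurable
    (Eventually.of_forall fun x => abs_chi_le E x)

lemma divergence_congr {g h : Eu n → Eu n} {x : Eu n} (hgh : g =ᶠ[𝓝 x] h) :
    divergence g x = divergence h x := by
  simp only [divergence, hgh.fderiv_eq]

lemma divergence_smul {η : Eu n → ℝ} {g : Eu n → Eu n} {x : Eu n}
    (hη : DifferentiableAt ℝ η x) (hg : DifferentiableAt ℝ g x) :
    divergence (fun y => η y • g y) x = η x * divergence g x + fderiv ℝ η x (g x) := by
  have h : HasFDerivAt (fun y => η y • g y) _ x := hη.hasFDerivAt.smul hg.hasFDerivAt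
  rw [divergence, h.fderiv, divergence, Finset.mul_sum]
  have hx : g x = ∑ i, g x i • EuclideanSpace.single i (1 : ℝ) := by
    ext j
    simp [Finset.sum_apply, Pi.single_apply]
  conv_rhs => rw [hx, map_sum]
  rw [← Finset.sum_add_distrib]
  refine Finset.sum_congr rfl fun i _ => ?_
  simp [mul_comm]

lemma divergence_const_smul {g : Eu n → Eu n} {x : Eu n} (hg : DifferentiableAt ℝ g x) (c : ℝ) :
    divergence (fun y => c • g y) x = c * divergence g x := by
  rw [divergence_smul (differentiableAt_const c) hg]
  simp

lemma le_perimeter {E Ω : Set (Eu n)} {g : Eu n → Eu n} (h1 : ContDiff ℝ 1 g)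
    (h2 : HasCompactSupport g) (h3 : tsupport g ⊆ Ω) (h4 : ∀ x, ‖g x‖ ≤ 1) :
    ENNReal.ofReal (∫ x in Ω, chi E x * divergence g x) ≤ perimeter E Ω :=
  le_iSup_of_le g (le_iSup_of_le h1 (le_iSup_of_le h2 (le_iSup_of_le h3
    (le_iSup_of_le h4 le_rfl))))

/-- Lower semicontinuity of the perimeter. -/
lemma eventually_lt_perimeter {ι : Type*} {l : Filter ι} {Es : ι → Set (Eu n)} {E Ω : Set (Eu n)}
    (hEs : ∀ i, MeasurableSet (Es i)) (hE : MeasurableSet E)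
    (hlim : Tendsto (fun i => ∫⁻ x in Ω, ENNReal.ofReal |chi (Es i) x - chi E x|) l (𝓝 0))
    {b : ℝ≥0∞} (hb : b < perimeter E Ω) : ∀ᶠ i in l, b < perimeter (Es i) Ω := by
  simp only [perimeter, lt_iSup_iff] at hb
  obtain ⟨g, h1, h2, h3, h4, hb⟩ := hb
  obtain ⟨M, hM⟩ := exists_divergence_bound h1 h2
  have hM0 : 0 ≤ M := (norm_nonneg _).trans (hM 0)
  -- One fixed field already exceeds `b`, and its divergence is bounded, so the tested integral
  -- passes to the `L¹` limit.
  have key : Tendsto (fun i => ∫ x in Ω, chi (Es i) x * divergence g x) l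
      (𝓝 (∫ x in Ω, chi E x * divergence g x)) := by
    rw [tendsto_iff_edist_tendsto_0]
    have hb2 : Tendsto (fun i => ENNReal.ofReal M *
        ∫⁻ x in Ω, ENNReal.ofReal |chi (Es i) x - chi E x|) l (𝓝 0) := by
      simpa using ENNReal.Tendsto.const_mul hlim (Or.inr ENNReal.ofReal_ne_top)
    refine tendsto_of_tendsto_of_tendsto_of_le_of_le tendsto_const_nhds hb2 (fun _ => zero_le)
      fun i => ?_
    simp only
    rw [edist_eq_enorm_sub, ← integral_sub (integrable_chi_mul_divergence (hEs i) h1 h2).restrict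
      (integrable_chi_mul_divergence hE h1 h2).restrict, ← lintegral_const_mul' _ _
      ENNReal.ofReal_ne_top]
    refine (enorm_integral_le_lintegral_enorm _).trans (lintegral_mono fun x => ?_)
    simp only
    rw [← sub_mul, enorm_mul, mul_comm, Real.enorm_eq_ofReal_abs, Real.enorm_eq_ofReal_abs]
    exact mul_le_mul_left (ENNReal.ofReal_le_ofReal (hM x)) _
  have h5 := (ENNReal.tendsto_ofReal key).eventually (lt_mem_nhds hb)
  filter_upwards [h5] with i hi
  exact hi.trans_le (le_perimeter h1 h2 h3 h4)

/-- Rescaling the field by `±C⁻¹` makes it admissible for the perimeter; the two signs give the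
absolute value. -/
lemma abs_integral_chi_mul_divergence_le {E Ω : Set (Eu n)} (hP : perimeter E Ω ≠ ⊤)
    {g : Eu n → Eu n} (h1 : ContDiff ℝ 1 g) (h2 : HasCompactSupport g) (h3 : tsupport g ⊆ Ω)
    {C : ℝ} (hC : 0 < C) (h4 : ∀ x, ‖g x‖ ≤ C) :
    |∫ x in Ω, chi E x * divergence g x| ≤ C * (perimeter E Ω).toReal := by
  have key : ∀ c : ℝ, |c| = C⁻¹ → c * ∫ x in Ω, chi E x * divergence g x ≤
      (perimeter E Ω).toReal := by
    intro c hc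
    have h := le_perimeter (E := E) (Ω := Ω) (g := fun x => c • g x) (h1.const_smul c)
      (h2.mono fun x hx => by
        contrapose! hx
        simp only [Function.mem_support, not_not] at hx ⊢
        simp [hx])
      ((closure_mono fun x hx => by
        contrapose! hx
        simp only [Function.mem_support, not_not] at hx ⊢
        simp [hx]).trans h3)
      (fun x => by
        rw [norm_smul, Real.norm_eq_abs, hc, inv_mul_le_iff₀ hC, mul_one]
        exact h4 x)
    have h5 : ∫ x in Ω, chi E x * divergence (fun x => c • g x) x =
        c * ∫ x in Ω, chi E x * divergence g x := by
      rw [← integral_const_mul]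
      refine integral_congr_ae (Eventually.of_forall fun x => ?_)
      simp only
      rw [divergence_const_smul ((h1.differentiable one_ne_zero) x)]
      ring
    rw [h5] at h
    exact (ENNReal.ofReal_le_iff_le_toReal hP).1 h
  have k1 := key C⁻¹ (abs_of_pos (inv_pos.2 hC))
  have k2 := key (-C⁻¹) (by rw [abs_neg, abs_of_pos (inv_pos.2 hC)])
  rw [inv_mul_le_iff₀ hC] at k1
  rw [neg_mul, neg_le_iff_add_nonneg, ← neg_le_iff_add_nonneg'] at k2
  rw [abs_le]
  refine ⟨?_, k1⟩
  have := mul_le_mul_of_nonneg_left k2 hC.le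
  rw [mul_inv_cancel_left₀ hC.ne'] at this
  linarith

/-- Variation along a translation, tested against a smooth function. -/
lemma abs_integral_chi_mul_translate_sub_le {E : Set (Eu n)} (hE : MeasurableSet E)
    (hv : volume E ≠ ⊤) (hP : perimeter E univ ≠ ⊤) {ζ : Eu n → ℝ} (hζ : ContDiff ℝ 1 ζ)
    (hζc : HasCompactSupport ζ) (hζ1 : ∀ x, |ζ x| ≤ 1) {h : Eu n} (hh : h ≠ 0) :
    |(∫ x, chi E x * ζ (x - h)) - ∫ x, chi E x * ζ x| ≤ ‖h‖ * (perimeter E univ).toReal := by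
  have hh0 : 0 < ‖h‖ := norm_pos_iff.2 hh
  obtain ⟨M, hM⟩ := (hζ.continuous_fderiv one_ne_zero).bounded_above_of_compact_support
    (hζc.fderiv (𝕜 := ℝ))
  have hd : ∀ x, HasFDerivAt ζ (fderiv ℝ ζ x) x := fun x =>
    ((hζ.differentiable one_ne_zero) x).hasFDerivAt
  -- Moving the translate along `t • h`, the derivative in `t` is the integral of `χ_E` times the
  -- divergence of `ζ(· - t h)(-h)`, a field bounded by `‖h‖`. The mean value inequality on `[0,1]`
  -- then concludes.
  have hderiv : ∀ t : ℝ, HasDerivAt (fun t : ℝ => ∫ x, chi E x * ζ (x - t • h))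
      (∫ x, chi E x * (fderiv ℝ ζ (x - t • h) (-h))) t := by
    intro t
    have hmeas : ∀ t : ℝ, AEStronglyMeasurable (fun x => chi E x * ζ (x - t • h)) volume :=
      fun t => (measurable_chi hE).aestronglyMeasurable.mul
        (hζ.continuous.comp (by fun_prop)).aestronglyMeasurable
    refine (hasDerivAt_integral_of_dominated_loc_of_deriv_le
      (F' := fun t x => chi E x * (fderiv ℝ ζ (x - t • h) (-h)))
      (bound := fun x => chi E x * (M * ‖h‖)) (Metric.ball_mem_nhds t one_pos)
      (Eventually.of_forall hmeas) ?_ ?_ ?_ ((integrable_chi hE hv).mul_const _) ?_).2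
    · refine (integrable_chi hE hv).mono (hmeas t) (Eventually.of_forall fun x => ?_)
      rw [norm_mul]
      exact mul_le_of_le_one_right (norm_nonneg _) (hζ1 _)
    · refine (measurable_chi hE).aestronglyMeasurable.mul (Continuous.aestronglyMeasurable ?_)
      exact ((hζ.continuous_fderiv one_ne_zero).comp (by fun_prop)).clm_apply continuous_const
    · refine Eventually.of_forall fun x s _ => ?_
      rw [norm_mul, Real.norm_eq_abs (chi E x), abs_of_nonneg (chi_mem E x).1]
      refine mul_le_mul_of_nonneg_left ?_ (chi_mem E x).1
      refine (ContinuousLinearMap.le_opNorm _ _).trans ?_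
      rw [norm_neg]
      exact mul_le_mul_of_nonneg_right (hM _) (norm_nonneg _)
    · refine Eventually.of_forall fun x s _ => ?_
      have h1 : HasDerivAt (fun s : ℝ => x - s • h) (-h) s := by
        simpa using ((hasDerivAt_id s).smul_const h).const_sub x
      exact ((hd (x - s • h)).comp_hasDerivAt s h1).const_mul (chi E x)
  have hbound : ∀ t : ℝ, ‖∫ x, chi E x * (fderiv ℝ ζ (x - t • h) (-h))‖ ≤
      ‖h‖ * (perimeter E univ).toReal := by
    intro t
    set g : Eu n → Eu n := fun x => ζ (x - t • h) • (-h) with hg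
    have hs : ContDiff ℝ 1 (fun x => ζ (x - t • h)) := hζ.comp (by fun_prop)
    have hg1 : ContDiff ℝ 1 g := hs.smul contDiff_const
    have hsc : HasCompactSupport (fun x => ζ (x - t • h)) := by
      have := hζc.comp_homeomorph (Homeomorph.subRight (t • h))
      exact this
    have hg2 : HasCompactSupport g := hsc.smul_right
    have hg4 : ∀ x, ‖g x‖ ≤ ‖h‖ := fun x => by
      rw [hg, norm_smul, norm_neg]
      exact mul_le_of_le_one_left (norm_nonneg _) (hζ1 _)
    have := abs_integral_chi_mul_divergence_le hP hg1 hg2 (subset_univ _) hh0 hg4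
    rw [Measure.restrict_univ] at this
    convert this using 2
    rw [Real.norm_eq_abs]
    congr 1
    refine integral_congr_ae (Eventually.of_forall fun x => ?_)
    simp only
    rw [hg, divergence_smul ((hs.differentiable one_ne_zero) x) (differentiableAt_const _)]
    have : fderiv ℝ (fun x => ζ (x - t • h)) x = fderiv ℝ ζ (x - t • h) := by
      rw [fderiv_comp_sub]
    rw [this]
    simp [divergence]
  have := norm_image_sub_le_of_norm_deriv_le_segment_01'
    (f := fun t : ℝ => ∫ x, chi E x * ζ (x - t • h)) (fun t _ => (hderiv t).hasDerivWithinAt)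
    (fun t _ => hbound t)
  simpa using this

/-- The `L¹` modulus of continuity of a set of finite perimeter. -/
theorem lintegral_abs_chi_translate_sub_le {E : Set (Eu n)} (hE : MeasurableSet E)
    (hb : Bornology.IsBounded E) (hP : perimeter E univ ≠ ⊤) (h : Eu n) :
    ∫⁻ x, ENNReal.ofReal |chi E (x + h) - chi E x| ≤ ENNReal.ofReal ‖h‖ * perimeter E univ := by
  rcases eq_or_ne h 0 with rfl | hh
  · simp
  have hv : volume E ≠ ⊤ := hb.measure_lt_top.ne
  set w : Eu n → ℝ := fun x => chi E (x + h) - chi E x with hw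
  have hchi := integrable_chi hE hv
  have hwint : Integrable w := (hchi.comp_add_right h).sub hchi
  have hwc : HasCompactSupport w := by
    obtain ⟨R, hR⟩ := hb.subset_closedBall 0
    refine HasCompactSupport.intro (isCompact_closedBall (0 : Eu n) (R + ‖h‖)) fun x hx => ?_
    rw [mem_closedBall_zero_iff, not_le] at hx
    have h1 : x ∉ E := fun hxE => by
      have := mem_closedBall_zero_iff.1 (hR hxE)
      linarith [norm_nonneg h]
    have h2 : x + h ∉ E := fun hxE => by
      have h3 := mem_closedBall_zero_iff.1 (hR hxE)
      have h4 := norm_sub_norm_le x (-h)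
      rw [norm_neg, sub_neg_eq_add] at h4
      linarith
    simp [hw, chi, h1, h2]
  have hw1 : ∀ x, |w x| ≤ 1 := fun x => by
    have h1 := chi_mem E x
    have h2 := chi_mem E (x + h)
    rw [abs_le]
    constructor <;> simp only [hw] <;> linarith [h1.1, h1.2, h2.1, h2.2]
  -- Since `w` takes values in `{-1, 0, 1}` it is its own sign, so its `L¹` norm is the integral
  -- against the test function `w`; mollifications of `w` are admissible smooth replacements.
  have hwsq : ∀ x, |w x| = w x * w x := fun x => by
    by_cases h1 : x ∈ E <;> by_cases h2 : x + h ∈ E <;> simp [hw, chi, h1, h2]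
  let b : ℕ → ContDiffBump (0 : Eu n) := fun k =>
    ⟨1 / (2 * ((k : ℝ) + 1)), 1 / ((k : ℝ) + 1), by positivity, by
      rw [div_lt_div_iff₀ (by positivity) (by positivity)]
      have : (0 : ℝ) ≤ k := Nat.cast_nonneg k
      linarith⟩
  have hb0 : Tendsto (fun k => (b k).rOut) atTop (𝓝 0) := tendsto_one_div_add_atTop_nhds_zero_nat
  have hbK : ∀ᶠ k in atTop, (b k).rOut ≤ 2 * (b k).rIn := Eventually.of_forall fun k => by
    simp only [b]
    apply le_of_eq
    field_simp
  have hlim := ContDiffBump.ae_convolution_tendsto_right_of_locallyIntegrable (μ := volume) hb0 hbK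
    hwint.locallyIntegrable
  set z : ℕ → Eu n → ℝ := fun k =>
    convolution ((b k).normed volume) w (ContinuousLinearMap.lsmul ℝ ℝ) volume with hz
  have hz1 : ∀ k, ContDiff ℝ 1 (z k) := fun k =>
    (b k).hasCompactSupport_normed.contDiff_convolution_left _ (b k).contDiff_normed
      hwint.locallyIntegrable
  have hz2 : ∀ k, HasCompactSupport (z k) := fun k =>
    (b k).hasCompactSupport_normed.convolution _ hwc
  have hz3 : ∀ k x, |z k x| ≤ 1 := fun k x => by
    have h1 : |z k x| ≤ ∫ t, (b k).normed volume t := by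
      rw [hz, ← Real.norm_eq_abs]
      refine norm_integral_le_of_norm_le (b k).integrable_normed (Eventually.of_forall fun t => ?_)
      rw [ContinuousLinearMap.lsmul_apply, norm_smul, Real.norm_eq_abs,
        abs_of_nonneg ((b k).nonneg_normed t)]
      exact mul_le_of_le_one_right ((b k).nonneg_normed t) (hw1 _)
    rwa [(b k).integral_normed] at h1
  have hle : ∀ k, ∫ x, w x * z k x ≤ ‖h‖ * (perimeter E univ).toReal := fun k => by
    refine le_trans (le_of_eq ?_) ((le_abs_self _).trans (abs_integral_chi_mul_translate_sub_le hE
      hv hP (hz1 k) (hz2 k) (hz3 k) hh))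
    have i1 : Integrable (fun x => chi E x * z k x) :=
      hchi.mul_bdd (hz1 k).continuous.aestronglyMeasurable (Eventually.of_forall (hz3 k))
    have i2 : Integrable (fun x => chi E (x + h) * z k x) :=
      (hchi.comp_add_right h).mul_bdd (hz1 k).continuous.aestronglyMeasurable
        (Eventually.of_forall (hz3 k))
    have e : ∫ x, chi E x * z k (x - h) = ∫ x, chi E (x + h) * z k x := by
      rw [← integral_add_right_eq_self (fun x => chi E x * z k (x - h)) h]
      simp
    rw [e, ← integral_sub i2 i1]
    exact integral_congr_ae (Eventually.of_forall fun x => by simp only [hw]; ring)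
  have hconv : Tendsto (fun k => ∫ x, w x * z k x) atTop (𝓝 (∫ x, w x * w x)) := by
    refine tendsto_integral_of_dominated_convergence (fun x => |w x|)
      (fun k => hwint.1.mul (hz1 k).continuous.aestronglyMeasurable) hwint.abs ?_ ?_
    · exact fun k => Eventually.of_forall fun x => by
        rw [norm_mul]
        exact mul_le_of_le_one_right (abs_nonneg _) (hz3 k x)
    · filter_upwards [hlim] with x hx
      exact hx.const_mul _
  have hfin := le_of_tendsto' hconv hle
  have e1 : ∫⁻ x, ENNReal.ofReal |w x| = ENNReal.ofReal (∫ x, w x * w x) := by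
    rw [← ofReal_integral_eq_lintegral_ofReal hwint.abs (Eventually.of_forall fun _ =>
      abs_nonneg _)]
    simp only [hwsq]
  rw [e1]
  refine (ENNReal.ofReal_le_ofReal hfin).trans ?_
  rw [ENNReal.ofReal_mul (norm_nonneg _), ENNReal.ofReal_toReal hP]

end Perimeter

/-! ### From perimeter in `Ω` to perimeter in the whole space, by cutting off near `∂Ω`. -/

section Boundary

/-- Bump functions of balls, with the natural bound on their total variation. -/
lemma exists_bump : ∃ C : ℝ≥0∞, C ≠ ⊤ ∧ ∀ (c : Eu n) (r : ℝ), 0 < r →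
    ∃ b : Eu n → ℝ, ContDiff ℝ 1 b ∧ (∀ x, b x ∈ Icc (0 : ℝ) 1) ∧
      (∀ x ∈ Metric.ball c r, b x = 1) ∧ (∀ x, b x ≠ 0 → dist x c < 2 * r) ∧
      ∫⁻ x, ENNReal.ofReal ‖fderiv ℝ b x‖ ≤ C * ENNReal.ofReal (r ^ ((n : ℝ) - 1)) := by
  let b0 : ContDiffBump (0 : Eu n) := ⟨1, 2, one_pos, one_lt_two⟩
  have hb0 : ContDiff ℝ 1 b0 := b0.contDiff
  obtain ⟨M, hM⟩ := (hb0.continuous_fderiv one_ne_zero).bounded_above_of_compact_support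
    (b0.hasCompactSupport.fderiv (𝕜 := ℝ))
  have hM0 : 0 ≤ M := (norm_nonneg _).trans (hM 0)
  refine ⟨ENNReal.ofReal (M * 2 ^ n) * volume (Metric.closedBall (0 : Eu n) 1),
    ENNReal.mul_ne_top ENNReal.ofReal_ne_top measure_closedBall_lt_top.ne, fun c r hr => ?_⟩
  have hdist : ∀ x, ‖r⁻¹ • (x - c)‖ = dist x c / r := fun x => by
    rw [norm_smul, norm_inv, Real.norm_eq_abs, abs_of_pos hr, dist_eq_norm]
    ring
  have hsmooth : ContDiff ℝ 1 (fun x => b0 (r⁻¹ • (x - c))) := hb0.comp (by fun_prop)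
  have hsupp : ∀ x, b0 (r⁻¹ • (x - c)) ≠ 0 → dist x c < 2 * r := fun x hx => by
    have h : r⁻¹ • (x - c) ∈ Function.support b0 := hx
    rw [b0.support_eq, Metric.mem_ball, dist_zero_right, hdist, div_lt_iff₀ hr] at h
    exact h
  refine ⟨fun x => b0 (r⁻¹ • (x - c)), hsmooth, fun x => ⟨b0.nonneg, b0.le_one⟩, fun x hx => ?_,
    hsupp, ?_⟩
  · refine b0.one_of_mem_closedBall ?_
    rw [mem_closedBall_zero_iff, hdist, div_le_iff₀ hr]
    have := Metric.mem_ball.1 hx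
    simpa [b0] using this.le
  -- The rescaled gradient is at most `M / r` and lives on a ball of volume of order `r^n`, whence
  -- the power `r^(n-1)`.
  have hbound : ∀ x, ENNReal.ofReal ‖fderiv ℝ (fun x => b0 (r⁻¹ • (x - c))) x‖ ≤
      (Metric.closedBall c (2 * r)).indicator (fun _ => ENNReal.ofReal (M / r)) x := by
    intro x
    by_cases hx : x ∈ Metric.closedBall c (2 * r)
    · rw [indicator_of_mem hx]
      refine ENNReal.ofReal_le_ofReal ?_
      have h1 : HasFDerivAt (fun x : Eu n => r⁻¹ • (x - c))
          (r⁻¹ • ContinuousLinearMap.id ℝ (Eu n)) x :=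
        ((hasFDerivAt_id x).sub_const c).const_smul r⁻¹
      have h2 := ((hb0.differentiable one_ne_zero) (r⁻¹ • (x - c))).hasFDerivAt.comp x h1
      have h3 : fderiv ℝ (fun x => b0 (r⁻¹ • (x - c))) x = _ := h2.fderiv
      rw [h3, ContinuousLinearMap.comp_smul, ContinuousLinearMap.comp_id, norm_smul, norm_inv,
        Real.norm_eq_abs, abs_of_pos hr, inv_mul_eq_div]
      gcongr
      exact hM _
    · rw [indicator_of_notMem hx]
      have : (fun x => b0 (r⁻¹ • (x - c))) =ᶠ[𝓝 x] fun _ => 0 := by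
        filter_upwards [Metric.isClosed_closedBall.isOpen_compl.mem_nhds hx] with y hy
        by_contra hne
        exact hy (Metric.mem_closedBall.2 (hsupp y hne).le)
      rw [this.fderiv_eq]
      simp
  have hvol : volume (Metric.closedBall c (2 * r)) =
      ENNReal.ofReal ((2 * r) ^ n) * volume (Metric.closedBall (0 : Eu n) 1) := by
    rw [Measure.addHaar_closedBall' _ _ (by positivity)]
    simp
  refine (lintegral_mono hbound).trans (le_of_eq ?_)
  rw [lintegral_indicator_const measurableSet_closedBall, hvol, ← mul_assoc,
    ← ENNReal.ofReal_mul (by positivity), mul_right_comm, ← ENNReal.ofReal_mul (by positivity)]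
  congr 2
  rw [Real.rpow_sub hr, Real.rpow_natCast, Real.rpow_one, mul_pow]
  field_simp

/-- A product of complementary bumps. -/
lemma exists_product_cutoff {ι : Type*} (F : Finset ι) (b : ι → Eu n → ℝ)
    (hb : ∀ i, ContDiff ℝ 1 (b i)) (hb1 : ∀ i x, b i x ∈ Icc (0 : ℝ) 1) :
    ∃ η : Eu n → ℝ, ContDiff ℝ 1 η ∧ (∀ x, η x ∈ Icc (0 : ℝ) 1) ∧
      (∀ x, ∀ i ∈ F, b i x = 1 → η x = 0) ∧ (∀ x, (∀ i ∈ F, b i x = 0) → η x = 1) ∧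
      ∫⁻ x, ENNReal.ofReal ‖fderiv ℝ η x‖ ≤ ∑ i ∈ F, ∫⁻ x, ENNReal.ofReal ‖fderiv ℝ (b i) x‖ := by
  classical
  have hmem : ∀ (G : Finset ι) x, ∏ i ∈ G, (1 - b i x) ∈ Icc (0 : ℝ) 1 := fun G x =>
    ⟨Finset.prod_nonneg fun i _ => by linarith [(hb1 i x).2],
      Finset.prod_le_one (fun i _ => by linarith [(hb1 i x).2])
        fun i _ => by linarith [(hb1 i x).1]⟩
  refine ⟨fun x => ∏ i ∈ F, (1 - b i x), contDiff_prod fun i _ => contDiff_const.sub (hb i),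
    hmem F, fun x i hi h => Finset.prod_eq_zero hi (by rw [h, sub_self]),
    fun x h => Finset.prod_eq_one fun i hi => by rw [h i hi, sub_zero], ?_⟩
  rw [← lintegral_finsetSum]
  · refine lintegral_mono fun x => ?_
    -- In the product rule each gradient is multiplied by factors in `[0,1]`, so total variations
    -- simply add.
    have h1 : ∀ i ∈ F, HasFDerivAt (fun x => 1 - b i x) (-fderiv ℝ (b i) x) x := fun i _ =>
      (((hb i).differentiable one_ne_zero) x).hasFDerivAt.const_sub 1
    have h2 : HasFDerivAt (fun x => ∏ i ∈ F, (1 - b i x)) _ x := HasFDerivAt.finsetProd h1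
    rw [h2.fderiv]
    rw [← ENNReal.ofReal_sum_of_nonneg fun i _ => norm_nonneg _]
    refine ENNReal.ofReal_le_ofReal ((norm_sum_le _ _).trans (Finset.sum_le_sum fun i _ => ?_))
    rw [norm_smul, norm_neg, Real.norm_eq_abs, abs_of_nonneg (hmem _ x).1]
    exact mul_le_of_le_one_left (norm_nonneg _) (hmem _ x).2
  · exact fun i _ => ((hb i).continuous_fderiv one_ne_zero).norm.measurable.ennreal_ofReal

/-- Coverings of a compact set by balls with radii controlled by the Hausdorff measure. -/
lemma exists_ball_cover (hn : 1 ≤ n) {K : Set (Eu n)} (hK : IsCompact K) {δ : ℝ} (hδ : 0 < δ)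
    (hH : Measure.hausdorffMeasure ((n : ℝ) - 1) K < ⊤) :
    ∃ (F : Finset ℕ) (c : ℕ → Eu n) (r : ℕ → ℝ), (∀ i ∈ F, c i ∈ K) ∧ (∀ i, 0 < r i) ∧
      (∀ i, r i ≤ δ) ∧ K ⊆ ⋃ i ∈ F, Metric.ball (c i) (r i) ∧
      ∑ i ∈ F, ENNReal.ofReal (r i ^ ((n : ℝ) - 1)) ≤
        Measure.hausdorffMeasure ((n : ℝ) - 1) K + 2 := by
  classical
  have hd : (0 : ℝ) ≤ (n : ℝ) - 1 := by
    have : (1 : ℝ) ≤ n := by exact_mod_cast hn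
    linarith
  set d : ℝ := (n : ℝ) - 1 with hdd
  set H := Measure.hausdorffMeasure d K with hHd
  have h1 : (⨅ (t : ℕ → Set (Eu n)) (_ : K ⊆ ⋃ n, t n)
      (_ : ∀ n, Metric.ediam (t n) ≤ ENNReal.ofReal (δ / 2)),
      ∑' n, ⨆ _ : (t n).Nonempty, Metric.ediam (t n) ^ d) < H + 1 := by
    refine lt_of_le_of_lt ?_ (ENNReal.lt_add_right hH.ne one_ne_zero)
    rw [hHd, Measure.hausdorffMeasure_apply]
    exact le_iSup₂_of_le (ENNReal.ofReal (δ / 2)) (ENNReal.ofReal_pos.2 (by positivity)) le_rfl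
  simp only [iInf_lt_iff] at h1
  obtain ⟨t, hKt, htδ, hsum⟩ := h1
  -- Slack for enlarging the radii. It costs a total of at most 1, and near-optimality of the cover
  -- costs another 1: hence the `+ 2`.
  obtain ⟨e, he, hesum⟩ := ENNReal.exists_pos_sum_of_countable (ε := 1) one_ne_zero ℕ
  have hdiam : ∀ i, Metric.ediam (t i) ≠ ⊤ := fun i =>
    ((htδ i).trans_lt ENNReal.ofReal_lt_top).ne
  -- A radius strictly above the diameter makes an open ball centred at a point of `t i ∩ K` contain
  -- all of `t i`, so compactness applies; continuity of `r ↦ r ^ d` keeps the cost under control.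
  have hrad : ∀ i, ∃ r : ℝ, (Metric.ediam (t i)).toReal < r ∧ r ≤ δ ∧
      r ^ d < (Metric.ediam (t i)).toReal ^ d + e i := by
    intro i
    set D := (Metric.ediam (t i)).toReal with hD
    have hDδ : D ≤ δ / 2 := ENNReal.toReal_le_of_le_ofReal (by positivity) (htδ i)
    have hcont : ContinuousAt (fun r : ℝ => r ^ d) D := Real.continuousAt_rpow_const _ _ (Or.inr hd)
    have hev : ∀ᶠ r in 𝓝[>] D, r ^ d < D ^ d + e i :=
      (hcont.mono_left nhdsWithin_le_nhds).eventually
        (gt_mem_nhds (lt_add_of_pos_right _ (by exact_mod_cast he i)))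
    have hev2 : ∀ᶠ r in 𝓝[>] D, r ∈ Ioc D δ := Ioc_mem_nhdsGT (by linarith)
    obtain ⟨r, hr1, hr2⟩ := (hev.and hev2).exists
    exact ⟨r, hr2.1, hr2.2, hr1⟩
  choose r hr1 hr2 hr3 using hrad
  have hr0 : ∀ i, 0 < r i := fun i => ENNReal.toReal_nonneg.trans_lt (hr1 i)
  set N : Set ℕ := {i | (t i ∩ K).Nonempty} with hN
  have hc : ∀ i, ∃ c : Eu n, i ∈ N → c ∈ t i ∩ K := fun i => by
    by_cases h : i ∈ N
    · obtain ⟨c, hc⟩ := h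
      exact ⟨c, fun _ => hc⟩
    · exact ⟨0, fun h' => absurd h' h⟩
  choose c hc using hc
  have hcover : K ⊆ ⋃ i : N, Metric.ball (c i) (r i) := by
    intro x hx
    obtain ⟨i, hi⟩ := mem_iUnion.1 (hKt hx)
    have hiN : i ∈ N := ⟨x, hi, hx⟩
    refine mem_iUnion.2 ⟨⟨i, hiN⟩, ?_⟩
    rw [Metric.mem_ball, dist_edist]
    refine lt_of_le_of_lt ?_ (hr1 i)
    exact ENNReal.toReal_mono (hdiam i) (Metric.edist_le_ediam_of_mem hi (hc i hiN).1)
  obtain ⟨F0, hF0⟩ := hK.elim_finite_subcover _ (fun i => Metric.isOpen_ball) hcover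
  refine ⟨F0.map (Function.Embedding.subtype _), c, r, fun i hi => ?_, hr0, hr2, ?_, ?_⟩
  · obtain ⟨j, -, rfl⟩ := Finset.mem_map.1 hi
    exact (hc _ j.2).2
  · intro x hx
    obtain ⟨j, hj, hxj⟩ := mem_iUnion₂.1 (hF0 hx)
    exact mem_iUnion₂.2 ⟨j, Finset.mem_map_of_mem _ hj, hxj⟩
  · have hterm : ∀ i ∈ F0.map (Function.Embedding.subtype _), ENNReal.ofReal (r i ^ d) ≤
        (⨆ _ : (t i).Nonempty, Metric.ediam (t i) ^ d) + e i := by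
      intro i hi
      obtain ⟨j, -, rfl⟩ := Finset.mem_map.1 hi
      have hne : (t j).Nonempty := ⟨_, (hc _ j.2).1⟩
      refine (ENNReal.ofReal_le_ofReal (hr3 j).le).trans ?_
      rw [ENNReal.ofReal_add (by positivity) (by positivity), ENNReal.ofReal_coe_nnreal,
        ← ENNReal.ofReal_rpow_of_nonneg ENNReal.toReal_nonneg hd, ENNReal.ofReal_toReal (hdiam _)]
      exact add_le_add_left (le_iSup (fun _ : (t j).Nonempty => Metric.ediam (t j) ^ d) hne) _
    refine (Finset.sum_le_sum hterm).trans ?_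
    rw [Finset.sum_add_distrib]
    refine (add_le_add ((ENNReal.sum_le_tsum _).trans hsum.le)
      ((ENNReal.sum_le_tsum _).trans hesum.le)).trans (le_of_eq ?_)
    rw [add_assoc, one_add_one_eq_two]

/-- Cutoff functions vanishing near a compact set `K`, with uniformly bounded total variation. -/
lemma exists_cutoff (hn : 1 ≤ n) {K : Set (Eu n)} (hK : IsCompact K)
    (hH : Measure.hausdorffMeasure ((n : ℝ) - 1) K < ⊤) :
    ∃ C : ℝ≥0∞, C ≠ ⊤ ∧ ∀ δ : ℝ, 0 < δ → ∃ η : Eu n → ℝ, ContDiff ℝ 1 η ∧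
      (∀ x, η x ∈ Icc (0 : ℝ) 1) ∧ (∃ U : Set (Eu n), IsOpen U ∧ K ⊆ U ∧ ∀ x ∈ U, η x = 0) ∧
      (∀ x, (∀ y ∈ K, δ ≤ dist x y) → η x = 1) ∧ ∫⁻ x, ENNReal.ofReal ‖fderiv ℝ η x‖ ≤ C := by
  obtain ⟨C, hC, hbump⟩ := exists_bump (n := n)
  refine ⟨C * (Measure.hausdorffMeasure ((n : ℝ) - 1) K + 2),
    ENNReal.mul_ne_top hC (by simp [hH.ne]), fun δ hδ => ?_⟩
  -- Radii at most `δ/2`: a bump lives within distance `2 r ≤ δ` of its centre, which lies in `K`.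
  obtain ⟨F, c, r, hcK, hr0, hrδ, hcov, hsum⟩ := exists_ball_cover hn hK (half_pos hδ) hH
  choose b hb1 hb2 hb3 hb4 hb5 using fun i => hbump (c i) (r i) (hr0 i)
  obtain ⟨η, h1, h2, h3, h4, h5⟩ := exists_product_cutoff F b hb1 hb2
  refine ⟨η, h1, h2, ⟨⋃ i ∈ F, Metric.ball (c i) (r i), isOpen_biUnion fun _ _ =>
    Metric.isOpen_ball, hcov, fun x hx => ?_⟩, fun x hx => h4 x fun i hi => ?_, h5.trans ?_⟩
  · obtain ⟨i, hi, hxi⟩ := mem_iUnion₂.1 hx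
    exact h3 x i hi (hb3 i x hxi)
  · by_contra hne
    have k1 := hb4 i x hne
    have k2 := hx _ (hcK i hi)
    have k3 := hrδ i
    linarith
  · refine (Finset.sum_le_sum fun i _ => hb5 i).trans ?_
    rw [← Finset.mul_sum]
    exact mul_le_mul_right hsum _

/-- A set inside `Ω` has finite perimeter in the whole space if it has finite perimeter in `Ω`,
as long as the boundary of `Ω` has finite Hausdorff measure. -/
theorem exists_perimeter_univ_le (hn : 1 ≤ n) {Ω : Set (Eu n)} (hΩo : IsOpen Ω)
    (hΩb : Bornology.IsBounded Ω)
    (hH : Measure.hausdorffMeasure ((n : ℝ) - 1) (frontier Ω) < ⊤) :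
    ∃ C : ℝ≥0∞, C ≠ ⊤ ∧ ∀ E : Set (Eu n), MeasurableSet E → E ⊆ Ω →
      perimeter E univ ≤ perimeter E Ω + C := by
  have hK : IsCompact (frontier Ω) :=
    (hΩb.isCompact_closure).of_isClosed_subset isClosed_frontier frontier_subset_closure
  obtain ⟨C, hC, hcut⟩ := exists_cutoff hn hK hH
  refine ⟨C, hC, fun E hE hEΩ => ?_⟩
  rcases eq_or_ne (perimeter E Ω) ⊤ with hP | hP
  · simp [hP]
  refine iSup_le fun g => iSup_le fun g1 => iSup_le fun g2 => iSup_le fun _ => iSup_le fun g4 => ?_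
  rw [Measure.restrict_univ, ← ENNReal.ofReal_toReal hP, ← ENNReal.ofReal_toReal hC,
    ← ENNReal.ofReal_add ENNReal.toReal_nonneg ENNReal.toReal_nonneg]
  refine ENNReal.ofReal_le_ofReal ?_
  have hgint := integrable_chi_mul_divergence hE g1 g2
  choose η e1 e2 e3 e4 e5 using fun k : ℕ => hcut (1 / ((k : ℝ) + 1)) (by positivity)
  have hle : ∀ k, ∫ x, chi E x * (η k x * divergence g x) ≤
      (perimeter E Ω).toReal + C.toReal := by
    intro k
    obtain ⟨U, hU, hKU, hU0⟩ := e3 k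
    set G : Eu n → Eu n := fun x => η k x • g x with hG
    have hG1 : ContDiff ℝ 1 G := (e1 k).smul g1
    have hGn : ∀ x, ‖G x‖ ≤ 1 := fun x => by
      rw [hG, norm_smul, Real.norm_eq_abs, abs_of_nonneg (e2 k x).1]
      exact mul_le_one₀ (e2 k x).2 (norm_nonneg _) (g4 x)
    set h : Eu n → Eu n := Ω.indicator G with hh
    have hin : ∀ x ∈ Ω, h =ᶠ[𝓝 x] G := fun x hx => by
      filter_upwards [hΩo.mem_nhds hx] with y hy using indicator_of_mem hy _
    -- A point outside `Ω` is either on the frontier, near which the cutoff vanishes, or exterior to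
    -- the closure. So truncating `η g` to `Ω` keeps it `C¹` with support in `Ω`.
    have hout : ∀ x ∉ Ω, h =ᶠ[𝓝 x] fun _ => 0 := fun x hx => by
      have hopen : IsOpen (U ∪ (closure Ω)ᶜ) := hU.union isClosed_closure.isOpen_compl
      have hxm : x ∈ U ∪ (closure Ω)ᶜ := by
        by_cases hxc : x ∈ closure Ω
        · exact Or.inl (hKU (by rw [hΩo.frontier_eq]; exact ⟨hxc, hx⟩))
        · exact Or.inr hxc
      filter_upwards [hopen.mem_nhds hxm] with y hy
      by_cases hyΩ : y ∈ Ω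
      · rw [hh, indicator_of_mem hyΩ, hG]
        rcases hy with hy | hy
        · simp [hU0 y hy]
        · exact absurd (subset_closure hyΩ) hy
      · exact indicator_of_notMem hyΩ _
    have hh1 : ContDiff ℝ 1 h := contDiff_iff_contDiffAt.2 fun x => by
      by_cases hx : x ∈ Ω
      · exact hG1.contDiffAt.congr_of_eventuallyEq (hin x hx)
      · exact contDiffAt_const.congr_of_eventuallyEq (hout x hx)
    have hh2 : HasCompactSupport h := g2.mono fun x hx => by
      contrapose! hx
      simp only [Function.mem_support, not_not] at hx ⊢
      by_cases hxΩ : x ∈ Ω <;> simp [hh, hG, hx, hxΩ]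
    have hh3 : tsupport h ⊆ Ω := fun x hx => by
      by_contra hxΩ
      exact (notMem_tsupport_iff_eventuallyEq.2 (hout x hxΩ)) hx
    have hh4 : ∀ x, ‖h x‖ ≤ 1 := fun x =>
      (norm_indicator_le_norm_self _ _).trans (hGn x)
    have k1 := abs_integral_chi_mul_divergence_le hP hh1 hh2 hh3 one_pos hh4
    rw [one_mul] at k1
    have i1 := integrable_chi_mul_divergence hE hh1 hh2
    have hfc : Continuous fun x => fderiv ℝ (η k) x (g x) :=
      ((e1 k).continuous_fderiv one_ne_zero).clm_apply g1.continuous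
    have i2 : Integrable (fun x => chi E x * fderiv ℝ (η k) x (g x)) := by
      refine Integrable.bdd_mul (c := 1) ?_ (measurable_chi hE).aestronglyMeasurable
        (Eventually.of_forall fun x => abs_chi_le E x)
      refine hfc.integrable_of_hasCompactSupport (g2.mono fun x hx => ?_)
      contrapose! hx
      simp only [Function.mem_support, not_not] at hx ⊢
      simp [hx]
    -- The cutoff costs only the term containing `∇η`, bounded by the total variation of `η`, hence
    -- by `C` independently of `k`.
    have hsplit : ∀ x, chi E x * (η k x * divergence g x) =
        chi E x * divergence h x - chi E x * fderiv ℝ (η k) x (g x) := fun x => by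
      by_cases hx : x ∈ E
      · rw [divergence_congr (hin x (hEΩ hx)), hG, divergence_smul
          (((e1 k).differentiable one_ne_zero) x) ((g1.differentiable one_ne_zero) x)]
        ring
      · simp [chi, hx]
    have k2 : ∫ x, chi E x * divergence h x = ∫ x in Ω, chi E x * divergence h x := by
      refine (setIntegral_eq_integral_of_forall_compl_eq_zero fun x hx => ?_).symm
      have : x ∉ E := fun hxE => hx (hEΩ hxE)
      simp [chi, this]
    have k3 : |∫ x, chi E x * fderiv ℝ (η k) x (g x)| ≤ C.toReal := by
      rw [← Real.norm_eq_abs]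
      refine (norm_integral_le_lintegral_norm _).trans (ENNReal.toReal_mono hC ?_)
      refine (lintegral_mono fun x => ?_).trans (e5 k)
      refine ENNReal.ofReal_le_ofReal ?_
      rw [norm_mul]
      refine (mul_le_of_le_one_left (norm_nonneg _) (abs_chi_le E x)).trans ?_
      exact (ContinuousLinearMap.le_opNorm _ _).trans
        (mul_le_of_le_one_right (norm_nonneg _) (g4 x))
    calc ∫ x, chi E x * (η k x * divergence g x)
        = (∫ x in Ω, chi E x * divergence h x) - ∫ x, chi E x * fderiv ℝ (η k) x (g x) := by
          rw [← k2, ← integral_sub i1 i2]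
          exact integral_congr_ae (Eventually.of_forall hsplit)
      _ ≤ _ := by
          have := (abs_le.1 k3).1
          have := (abs_le.1 k1).2
          linarith
  -- Each point of `E` lies at positive distance from `∂Ω` because `Ω` is open, so the cutoffs are
  -- eventually 1 there.
  refine le_of_tendsto' (tendsto_integral_of_dominated_convergence
    (fun x => ‖chi E x * divergence g x‖) (fun k => ?_) hgint.norm
    (fun k => Eventually.of_forall fun x => ?_) (Eventually.of_forall fun x => ?_)) hle
  · exact (measurable_chi hE).aestronglyMeasurable.mul
      ((e1 k).continuous.mul (continuous_divergence g1)).aestronglyMeasurable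
  · rw [norm_mul, norm_mul, norm_mul, Real.norm_eq_abs (η k x), abs_of_nonneg (e2 k x).1]
    gcongr
    exact mul_le_of_le_one_left (norm_nonneg _) (e2 k x).2
  · by_cases hx : x ∈ E
    · refine tendsto_const_nhds.congr' ?_
      obtain ⟨ε, hε, hball⟩ := Metric.isOpen_iff.1 hΩo x (hEΩ hx)
      filter_upwards [tendsto_one_div_add_atTop_nhds_zero_nat.eventually (gt_mem_nhds hε)]
        with k hk
      rw [e4 k x fun y hy => ?_, one_mul]
      by_contra hlt
      rw [hΩo.frontier_eq] at hy
      refine hy.2 (hball ?_)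
      rw [Metric.mem_ball, dist_comm]
      linarith
    · simp [chi, hx]

end Boundary

/-! ### The fractional kernel: integrability and interpolation between `L¹` and perimeter. -/

section Kernel

variable {s : ℝ}

lemma ker_nonneg (s : ℝ) (x y : Eu n) : 0 ≤ ker s x y := by
  unfold ker
  positivity

lemma ker_comm (s : ℝ) (x y : Eu n) : ker s x y = ker s y x := by
  rw [ker, ker, norm_sub_rev]

lemma ker_add_left (s : ℝ) (x h : Eu n) : ker s x (x + h) = ker s 0 h := by
  simp [ker]

lemma measurable_ker (s : ℝ) : Measurable (fun p : Eu n × Eu n => ker s p.1 p.2) := by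
  unfold ker
  fun_prop

lemma measurable_ker_right (s : ℝ) (x : Eu n) : Measurable (ker s x) := by
  unfold ker
  fun_prop

/-- The kernel is integrable away from the diagonal. -/
lemma lintegral_ker_compl_ball_lt_top (hs : 0 < s) {r : ℝ} (hr : 0 < r) :
    ∫⁻ h in (Metric.ball (0 : Eu n) r)ᶜ, ENNReal.ofReal (ker s 0 h) < ⊤ := by
  have hp : (0 : ℝ) ≤ (n : ℝ) + s := by positivity
  have hint : Integrable (fun h : Eu n => (1 + ‖h‖) ^ (-((n : ℝ) + s))) :=
    integrable_one_add_norm (by simp [hs])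
  -- For `‖h‖ ≥ r` one has `1 + ‖h‖ ≤ ((1 + r) / r) ‖h‖`, which gives this constant.
  have hfin := (hint.const_mul (((1 + r) / r) ^ ((n : ℝ) + s))).lintegral_lt_top
  refine lt_of_le_of_lt (le_trans ?_ (setLIntegral_le_lintegral
    (Metric.ball (0 : Eu n) r)ᶜ _)) hfin
  refine setLIntegral_mono' Metric.isOpen_ball.measurableSet.compl fun h hh =>
    ENNReal.ofReal_le_ofReal ?_
  have hrh : r ≤ ‖h‖ := by simpa using hh
  have hh0 : 0 < ‖h‖ := hr.trans_le hrh
  rw [ker, zero_sub, norm_neg, Real.rpow_neg (by positivity), ← div_eq_mul_inv,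
    ← Real.div_rpow (by positivity) (by positivity), one_div, ← Real.inv_rpow (by positivity)]
  refine Real.rpow_le_rpow (by positivity) ?_ hp
  rw [inv_eq_one_div, div_div, div_le_div_iff₀ hh0 (by positivity)]
  nlinarith

/-- The first moment of the kernel near the diagonal is finite, and small on small balls. -/
lemma exists_lintegral_ker_mul_norm_ball_le (hn : 1 ≤ n) (hs : s < 1) {δ : ℝ≥0∞} (hδ : δ ≠ 0) :
    ∃ r : ℝ, 0 < r ∧
      ∫⁻ h in Metric.ball (0 : Eu n) r, ENNReal.ofReal (ker s 0 h) * ENNReal.ofReal ‖h‖ ≤ δ := by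
  have hd : Module.finrank ℝ (Eu n) = n := by simp
  have hint : IntegrableOn (fun h : Eu n => ker s 0 h * ‖h‖) (Metric.ball 0 1) := by
    -- The singularity has order `n + s - 1`, below `n` exactly because `s < 1`. Smallness on small
    -- balls then follows from absolute continuity of the integral.
    refine integrableOn_ball_of_norm_le_rpow (C := 1) (α := (n : ℝ) + s - 1) (by rw [hd]; exact hn)
      (by rw [hd]; linarith) (Eventually.of_forall fun h => ?_)
      ((measurable_ker_right s 0).mul measurable_norm).aestronglyMeasurable
    rw [norm_mul, norm_norm, Real.norm_eq_abs, abs_of_nonneg (ker_nonneg _ _ _), ker, zero_sub,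
      norm_neg, one_mul]
    rcases eq_or_ne h 0 with rfl | hh
    · simp [Real.rpow_nonneg]
    · have hh0 : 0 < ‖h‖ := norm_pos_iff.2 hh
      rw [neg_sub, Real.rpow_sub hh0, Real.rpow_one]
      exact le_of_eq (by ring)
  have hfin : ∫⁻ h in Metric.ball (0 : Eu n) 1,
      ENNReal.ofReal (ker s 0 h) * ENNReal.ofReal ‖h‖ ≠ ⊤ := by
    have := hint.lintegral_lt_top.ne
    simpa only [ENNReal.ofReal_mul (ker_nonneg _ _ _)] using this
  obtain ⟨ε, hε, hsmall⟩ := exists_pos_setLIntegral_lt_of_measure_lt hfin hδ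
  have hvol : Tendsto (fun r : ℝ => volume (Metric.ball (0 : Eu n) r)) (𝓝[>] 0) (𝓝 0) := by
    have h1 : Tendsto (fun r : ℝ => ENNReal.ofReal (r ^ n) * volume (Metric.ball (0 : Eu n) 1))
        (𝓝[>] 0) (𝓝 (ENNReal.ofReal (0 ^ n) * volume (Metric.ball (0 : Eu n) 1))) := by
      refine ENNReal.Tendsto.mul_const (ENNReal.tendsto_ofReal ?_)
        (Or.inr measure_ball_lt_top.ne)
      exact ((continuous_pow n).tendsto 0).mono_left nhdsWithin_le_nhds
    rw [zero_pow (by omega), ENNReal.ofReal_zero, zero_mul] at h1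
    refine h1.congr' ?_
    filter_upwards [self_mem_nhdsWithin] with r hr
    rw [Measure.addHaar_ball_of_pos _ _ hr, hd]
  obtain ⟨r, hr1, hr2, hr3⟩ := ((hvol.eventually (gt_mem_nhds hε)).and
    (Ioc_mem_nhdsGT one_pos : Ioc (0 : ℝ) 1 ∈ 𝓝[>] 0)).exists
  refine ⟨r, hr2, ?_⟩
  have h2 := hsmall (Metric.ball (0 : Eu n) r) ((Measure.restrict_apply_le _ _).trans_lt hr1)
  rw [Measure.restrict_restrict Metric.isOpen_ball.measurableSet,
    inter_eq_left.2 (Metric.ball_subset_ball hr3)] at h2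
  exact h2.le

/-- Interpolation between `L¹` and the perimeter, for differences of characteristic functions. -/
theorem lintegral_lintegral_abs_sub_ker_le (s r : ℝ) {E F : Set (Eu n)}
    (hE : MeasurableSet E) (hEb : Bornology.IsBounded E) (hEP : perimeter E univ ≠ ⊤)
    (hF : MeasurableSet F) (hFb : Bornology.IsBounded F) (hFP : perimeter F univ ≠ ⊤) :
    ∫⁻ x, ∫⁻ y, ENNReal.ofReal (|(chi E x - chi F x) - (chi E y - chi F y)| * ker s x y) ≤
      (∫⁻ h in Metric.ball (0 : Eu n) r, ENNReal.ofReal (ker s 0 h) * ENNReal.ofReal ‖h‖) *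
          (perimeter E univ + perimeter F univ) +
        (∫⁻ h in (Metric.ball (0 : Eu n) r)ᶜ, ENNReal.ofReal (ker s 0 h)) *
          (2 * ∫⁻ x, ENNReal.ofReal |chi E x - chi F x|) := by
  have hmE := measurable_chi hE
  have hmF := measurable_chi hF
  set w : Eu n → ℝ := fun x => chi E x - chi F x with hw
  have hwm : Measurable w := hmE.sub hmF
  have hkm := measurable_ker_right (n := n) s 0
  have e1 : ∀ x, ∫⁻ y, ENNReal.ofReal (|w x - w y| * ker s x y) =
      ∫⁻ h, ENNReal.ofReal (ker s 0 h) * ENNReal.ofReal |w (x + h) - w x| := by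
    intro x
    rw [← lintegral_add_left_eq_self _ x]
    refine lintegral_congr fun h => ?_
    rw [ker_add_left, mul_comm, ENNReal.ofReal_mul (ker_nonneg _ _ _), abs_sub_comm]
  -- In the variable `h = y - x` the inner integral is an `L¹` norm of a translation difference: of
  -- order `‖h‖` times the perimeters, used for small `h`, and at most twice the `L¹` norm of `w`,
  -- used for large `h`.
  have e2 : ∫⁻ x, ∫⁻ y, ENNReal.ofReal (|w x - w y| * ker s x y) =
      ∫⁻ h, ENNReal.ofReal (ker s 0 h) * ∫⁻ x, ENNReal.ofReal |w (x + h) - w x| := by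
    simp only [e1]
    rw [lintegral_lintegral_swap]
    · refine lintegral_congr fun h => ?_
      rw [lintegral_const_mul' _ _ ENNReal.ofReal_ne_top]
    · refine Measurable.aemeasurable ?_
      simp only [Function.uncurry_def]
      fun_prop
  have hnear : ∀ h : Eu n, ∫⁻ x, ENNReal.ofReal |w (x + h) - w x| ≤
      ENNReal.ofReal ‖h‖ * (perimeter E univ + perimeter F univ) := by
    intro h
    rw [mul_add]
    refine le_trans ?_ (add_le_add (lintegral_abs_chi_translate_sub_le hE hEb hEP h)
      (lintegral_abs_chi_translate_sub_le hF hFb hFP h))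
    rw [← lintegral_add_left (by fun_prop)]
    refine lintegral_mono fun x => ?_
    rw [← ENNReal.ofReal_add (abs_nonneg _) (abs_nonneg _)]
    refine ENNReal.ofReal_le_ofReal ?_
    have := abs_sub (chi E (x + h) - chi E x) (chi F (x + h) - chi F x)
    refine le_trans (le_of_eq ?_) this
    simp only [hw]
    congr 1
    ring
  have hfar : ∀ h : Eu n, ∫⁻ x, ENNReal.ofReal |w (x + h) - w x| ≤
      2 * ∫⁻ x, ENNReal.ofReal |w x| := by
    intro h
    have e3 : ∫⁻ x, ENNReal.ofReal |w (x + h)| = ∫⁻ x, ENNReal.ofReal |w x| :=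
      lintegral_add_right_eq_self (fun x => ENNReal.ofReal |w x|) h
    rw [two_mul]
    nth_rewrite 1 [← e3]
    rw [← lintegral_add_left (by fun_prop)]
    refine lintegral_mono fun x => ?_
    rw [← ENNReal.ofReal_add (abs_nonneg _) (abs_nonneg _)]
    exact ENNReal.ofReal_le_ofReal (abs_sub _ _)
  rw [e2, ← lintegral_add_compl _ (Metric.isOpen_ball (x := (0 : Eu n)) (ε := r)).measurableSet]
  refine add_le_add ?_ ?_
  · rw [← lintegral_mul_const _ (by fun_prop)]
    refine lintegral_mono fun h => ?_
    rw [mul_assoc]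
    exact mul_le_mul_right (hnear h) _
  · rw [← lintegral_mul_const _ (by fun_prop)]
    exact lintegral_mono fun h => mul_le_mul_right (hfar h) _

lemma perimeter_empty (Ω : Set (Eu n)) : perimeter (∅ : Set (Eu n)) Ω = 0 := by
  simp [perimeter, chi]

end Kernel

/-! ### The Robin form as a jump form on `Ω`. -/

section RobinForm

variable {s : ℝ} {Ω : Set (Eu n)} {ρ : Eu n → ℝ}

lemma lintegral_withDensity_ofReal {X : Type*} [MeasurableSpace X] (μ : Measure X) {d : X → ℝ}
    (hd : Measurable d) (g : X → ℝ≥0∞) :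
    ∫⁻ x, g x ∂μ.withDensity (fun x => ENNReal.ofReal (d x)) =
      ∫⁻ x, ENNReal.ofReal (d x) * g x ∂μ :=
  lintegral_withDensity_eq_lintegral_mul_non_measurable _ hd.ennreal_ofReal
    (Eventually.of_forall fun _ => ENNReal.ofReal_lt_top) g

lemma integral_withDensity_ofReal {X : Type*} [MeasurableSpace X] (μ : Measure X) {d : X → ℝ}
    (hd : Measurable d) (hd0 : ∀ x, 0 ≤ d x) (g : X → ℝ) :
    ∫ x, g x ∂μ.withDensity (fun x => ENNReal.ofReal (d x)) = ∫ x, d x * g x ∂μ := by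
  rw [integral_withDensity_eq_integral_toReal_smul hd.ennreal_ofReal
    (Eventually.of_forall fun _ => ENNReal.ofReal_lt_top)]
  refine integral_congr_ae (Eventually.of_forall fun x => ?_)
  simp [ENNReal.toReal_ofReal (hd0 x)]

lemma integrable_withDensity_ofReal {X : Type*} [MeasurableSpace X] {μ : Measure X} {d : X → ℝ}
    (hd : Measurable d) (hd0 : ∀ x, 0 ≤ d x) {g : X → ℝ}
    (h : Integrable g (μ.withDensity (fun x => ENNReal.ofReal (d x)))) :
    Integrable (fun x => d x * g x) μ := by
  rw [integrable_withDensity_iff_integrable_smul' hd.ennreal_ofReal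
    (Eventually.of_forall fun _ => ENNReal.ofReal_lt_top)] at h
  refine h.congr (Eventually.of_forall fun x => ?_)
  simp [ENNReal.toReal_ofReal (hd0 x)]

/-- The total mass `∫_Ω |x - y|^{-(n+s)} dy`, as a real number. -/
noncomputable def kerMass (s : ℝ) (Ω : Set (Eu n)) (x : Eu n) : ℝ := ∫ y in Ω, ker s x y

lemma kerMass_nonneg (s : ℝ) (Ω : Set (Eu n)) (x : Eu n) : 0 ≤ kerMass s Ω x :=
  integral_nonneg fun _ => ker_nonneg _ _ _

lemma measurable_kerMass (s : ℝ) (Ω : Set (Eu n)) : Measurable (kerMass s Ω) :=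
  ((measurable_ker s).stronglyMeasurable.integral_prod_right'
    (ν := volume.restrict Ω)).measurable

lemma measurable_psi (s : ℝ) (F : Set (Eu n)) : Measurable (psi s F) :=
  (measurable_ker s).ennreal_ofReal.lintegral_prod_right' (ν := volume.restrict F)

lemma integrableOn_ker {x : Eu n} (hx : psi s Ω x < ⊤) : IntegrableOn (ker s x) Ω :=
  (lintegral_ofReal_ne_top_iff_integrable (measurable_ker_right s x).aestronglyMeasurable
    (Eventually.of_forall fun _ => ker_nonneg _ _ _)).1 hx.ne

lemma ofReal_kerMass {x : Eu n} (hx : psi s Ω x < ⊤) :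
    ENNReal.ofReal (kerMass s Ω x) = psi s Ω x :=
  ofReal_integral_eq_lintegral_ofReal (integrableOn_ker hx)
    (Eventually.of_forall fun _ => ker_nonneg _ _ _)

/-- Where the potential diverges, the real integral takes the default value 0, and so does its
inverse; the reflected jumps are thereby switched off there. -/
lemma kerMass_eq_zero_of_psi_eq_top {x : Eu n} (hx : psi s Ω x = ⊤) : kerMass s Ω x = 0 :=
  integral_undef fun h => by
    have := (lintegral_ofReal_ne_top_iff_integrable
      (measurable_ker_right s x).aestronglyMeasurable
      (Eventually.of_forall fun _ => ker_nonneg _ _ _)).2 h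
    exact this hx

lemma ofReal_inv_kerMass_mul_psi_le (s : ℝ) (Ω : Set (Eu n)) (x : Eu n) :
    ENNReal.ofReal (kerMass s Ω x)⁻¹ * psi s Ω x ≤ 1 := by
  rcases eq_or_ne (psi s Ω x) ⊤ with h | h
  · simp [kerMass_eq_zero_of_psi_eq_top h]
  · rw [← ofReal_kerMass h.lt_top, ← ENNReal.ofReal_mul (inv_nonneg.2 (kerMass_nonneg _ _ _))]
    exact ENNReal.ofReal_le_one.2 (inv_mul_le_one)

/-- The jump part of the form inside `Ω`. -/
noncomputable def innerMeasure (s : ℝ) (Ω : Set (Eu n)) : Measure (Eu n × Eu n) :=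
  ((volume.restrict Ω).prod (volume.restrict Ω)).withDensity
    fun p => ENNReal.ofReal (ker s p.1 p.2 / 2)

/-- The killing part of the form, as jumps to the complement of `Ω`. -/
noncomputable def killingMeasure (s : ℝ) (Ω : Set (Eu n)) (ρ : Eu n → ℝ) :
    Measure (Eu n × Eu n) :=
  ((volume.restrict Ωᶜ).prod (volume.restrict Ω)).withDensity
    fun p => ENNReal.ofReal ((1 - ρ p.1) * ker s p.1 p.2)

/-- Triples consisting of an exterior point and two points of `Ω`, weighted by the kernel. -/
noncomputable def tripleMeasure (s : ℝ) (Ω : Set (Eu n)) (ρ : Eu n → ℝ) :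
    Measure (Eu n × Eu n × Eu n) :=
  ((volume.restrict Ωᶜ).prod ((volume.restrict Ω).prod (volume.restrict Ω))).withDensity
    fun q => ENNReal.ofReal (ρ q.1 / 2 * (kerMass s Ω q.1)⁻¹ * (ker s q.1 q.2.1 * ker s q.1 q.2.2))

/-- The jump measure of the Robin form: jumps inside `Ω`, killing, and reflected jumps. -/
noncomputable def jumpMeasure (s : ℝ) (Ω : Set (Eu n)) (ρ : Eu n → ℝ) : Measure (Eu n × Eu n) :=
  innerMeasure s Ω + (killingMeasure s Ω ρ + (tripleMeasure s Ω ρ).map Prod.snd)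

lemma measurable_tripleDensity (hρ : Measurable ρ) : Measurable
    fun q : Eu n × Eu n × Eu n =>
      ρ q.1 / 2 * (kerMass s Ω q.1)⁻¹ * (ker s q.1 q.2.1 * ker s q.1 q.2.2) := by
  have h0 : Measurable fun q : Eu n × Eu n × Eu n => ρ q.1 := hρ.comp measurable_fst
  have h1 : Measurable fun q : Eu n × Eu n × Eu n => kerMass s Ω q.1 :=
    (measurable_kerMass s Ω).comp measurable_fst
  have h2 : Measurable fun q : Eu n × Eu n × Eu n => ker s q.1 q.2.1 := by
    unfold ker
    fun_prop
  have h3 : Measurable fun q : Eu n × Eu n × Eu n => ker s q.1 q.2.2 := by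
    unfold ker
    fun_prop
  exact ((h0.div_const 2).mul h1.inv).mul (h2.mul h3)

/-- Each of the three parts has a density against a product of Lebesgue measures, or is the
projection of such a measure. Hence a.e. statements on `Ω` transfer to jumps. -/
lemma absContMarginals_jumpMeasure (s : ℝ) (Ω : Set (Eu n)) (ρ : Eu n → ℝ) :
    AbsContMarginals volume (jumpMeasure s Ω ρ) := by
  have hres : ∀ A : Set (Eu n), (volume.restrict A : Measure (Eu n)) ≪ volume := fun A =>
    Measure.restrict_le_self.absolutelyContinuous
  have hprod1 : ∀ (A B : Set (Eu n)) (d : Eu n × Eu n → ℝ≥0∞),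
      Measure.map Prod.fst (((volume.restrict A).prod (volume.restrict B)).withDensity d) ≪
        volume := fun A B d =>
    (Measure.quasiMeasurePreserving_fst.mono (withDensity_absolutelyContinuous _ _)
      (hres A)).absolutelyContinuous
  have hprod2 : ∀ (A B : Set (Eu n)) (d : Eu n × Eu n → ℝ≥0∞),
      Measure.map Prod.snd (((volume.restrict A).prod (volume.restrict B)).withDensity d) ≪
        volume := fun A B d =>
    (Measure.quasiMeasurePreserving_snd.mono (withDensity_absolutelyContinuous _ _)
      (hres B)).absolutelyContinuous
  have htri : Measure.QuasiMeasurePreserving Prod.snd (tripleMeasure s Ω ρ)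
      ((volume.restrict Ω).prod (volume.restrict Ω)) :=
    Measure.quasiMeasurePreserving_snd.mono_left (withDensity_absolutelyContinuous _ _)
  constructor
  · refine ⟨measurable_fst, ?_⟩
    rw [jumpMeasure, Measure.map_add _ _ measurable_fst, Measure.map_add _ _ measurable_fst]
    refine (hprod1 _ _ _).add_left ((hprod1 _ _ _).add_left ?_)
    rw [Measure.map_map measurable_fst measurable_snd]
    exact ((Measure.quasiMeasurePreserving_fst.comp htri).mono_right
      (hres Ω)).absolutelyContinuous
  · refine ⟨measurable_snd, ?_⟩
    rw [jumpMeasure, Measure.map_add _ _ measurable_snd, Measure.map_add _ _ measurable_snd]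
    refine (hprod2 _ _ _).add_left ((hprod2 _ _ _).add_left ?_)
    rw [Measure.map_map measurable_snd measurable_snd]
    exact ((Measure.quasiMeasurePreserving_snd.comp htri).mono_right
      (hres Ω)).absolutelyContinuous

/-- The energy, written out. -/
lemma jumpEnergy_jumpMeasure (hρ : Measurable ρ) {u : Eu n → ℝ}
    (hu : AEStronglyMeasurable u volume) :
    jumpEnergy (jumpMeasure s Ω ρ) u =
      ∫⁻ p, ENNReal.ofReal (ker s p.1 p.2 / 2) * ENNReal.ofReal ((u p.1 - u p.2) ^ 2)
          ∂(volume.restrict Ω).prod (volume.restrict Ω) +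
      (∫⁻ p, ENNReal.ofReal ((1 - ρ p.1) * ker s p.1 p.2) * ENNReal.ofReal ((u p.1 - u p.2) ^ 2)
          ∂(volume.restrict Ωᶜ).prod (volume.restrict Ω) +
        ∫⁻ x in Ωᶜ, ∫⁻ p, ENNReal.ofReal
            (ρ x / 2 * (kerMass s Ω x)⁻¹ * (ker s x p.1 * ker s x p.2)) *
            ENNReal.ofReal ((u p.1 - u p.2) ^ 2)
          ∂(volume.restrict Ω).prod (volume.restrict Ω)) := by
  have hmk := measurable_ker (n := n) s
  have hD : AEMeasurable (fun p : Eu n × Eu n => ENNReal.ofReal ((u p.1 - u p.2) ^ 2))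
      (jumpMeasure s Ω ρ) :=
    (((absContMarginals_jumpMeasure s Ω ρ).difference hu).pow 2).aemeasurable.ennreal_ofReal
  have hD3 : AEMeasurable (fun p : Eu n × Eu n => ENNReal.ofReal ((u p.1 - u p.2) ^ 2))
      ((tripleMeasure s Ω ρ).map Prod.snd) :=
    hD.mono_measure ((Measure.le_add_left le_rfl).trans (Measure.le_add_left le_rfl))
  rw [jumpEnergy, jumpMeasure, lintegral_add_measure, lintegral_add_measure, innerMeasure,
    killingMeasure, lintegral_withDensity_ofReal _ (hmk.div_const 2),
    lintegral_withDensity_ofReal _ (by fun_prop), lintegral_map' hD3 measurable_snd.aemeasurable,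
    tripleMeasure, lintegral_withDensity_ofReal _ (measurable_tripleDensity hρ)]
  congr 2
  refine lintegral_prod _ ((measurable_tripleDensity hρ).ennreal_ofReal.aemeasurable.mul ?_)
  have hp : AEStronglyMeasurable (fun p : Eu n × Eu n => u p.1 - u p.2)
      ((volume.restrict Ω).prod (volume.restrict Ω)) :=
    hu.restrict.comp_fst.sub hu.restrict.comp_snd
  exact ((hp.pow 2).aemeasurable.ennreal_ofReal).comp_snd

lemma lintegral_interaction_le {e : Eu n × Eu n → ℝ≥0∞} {A B : Set (Eu n)}
    (hAB : A ×ˢ B ⊆ interaction Ω) :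
    ∫⁻ p, e p ∂(volume.restrict A).prod (volume.restrict B) ≤ ∫⁻ p in interaction Ω, e p := by
  rw [Measure.prod_restrict]
  exact lintegral_mono_set hAB

lemma inner_subset_interaction : Ω ×ˢ Ω ⊆ interaction Ω := fun _ hp h => h.1 hp.1

lemma cross_subset_interaction : Ωᶜ ×ˢ Ω ⊆ interaction Ω := fun _ hp h => h.2 hp.2

lemma cross_subset_interaction' : Ω ×ˢ Ωᶜ ⊆ interaction Ω := fun _ hp h => h.1 hp.1

/-- For functions vanishing outside `Ω`, the Robin form is controlled by the energy. -/
lemma jumpEnergy_le_energy (hΩm : MeasurableSet Ω) (hρ : Measurable ρ)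
    (hρ1 : ∀ x, ρ x ∈ Icc (0 : ℝ) 1) {u : Eu n → ℝ} (hu : AEStronglyMeasurable u volume)
    (hu0 : ∀ x ∉ Ω, u x = 0) :
    jumpEnergy (jumpMeasure s Ω ρ) u ≤
      4 * ∫⁻ p in interaction Ω, ENNReal.ofReal ((u p.1 - u p.2) ^ 2 * ker s p.1 p.2) := by
  have hmk := measurable_ker (n := n) s
  set En := ∫⁻ p in interaction Ω, ENNReal.ofReal ((u p.1 - u p.2) ^ 2 * ker s p.1 p.2) with hEn
  have h1 : ∫⁻ p, ENNReal.ofReal (ker s p.1 p.2 / 2) * ENNReal.ofReal ((u p.1 - u p.2) ^ 2)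
      ∂(volume.restrict Ω).prod (volume.restrict Ω) ≤ En := by
    refine le_trans (lintegral_mono fun p => ?_) (lintegral_interaction_le inner_subset_interaction)
    have := ker_nonneg s p.1 p.2
    rw [← ENNReal.ofReal_mul (by positivity)]
    refine ENNReal.ofReal_le_ofReal ?_
    nlinarith [mul_nonneg (sq_nonneg (u p.1 - u p.2)) this]
  have h2 : ∫⁻ p, ENNReal.ofReal ((1 - ρ p.1) * ker s p.1 p.2) *
      ENNReal.ofReal ((u p.1 - u p.2) ^ 2)
      ∂(volume.restrict Ωᶜ).prod (volume.restrict Ω) ≤ En := by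
    refine le_trans (lintegral_mono fun p => ?_) (lintegral_interaction_le cross_subset_interaction)
    have := ker_nonneg s p.1 p.2
    have h1 := hρ1 p.1
    rw [← ENNReal.ofReal_mul' (by positivity)]
    refine ENNReal.ofReal_le_ofReal ?_
    nlinarith [mul_nonneg (mul_nonneg (sq_nonneg (u p.1 - u p.2)) this) h1.1]
  -- Since `u` vanishes at exterior points, the cross energy is this weighted `L²` integral of `u`.
  have hcross : ∫⁻ x in Ωᶜ, ∫⁻ y in Ω, ENNReal.ofReal (ker s x y * u y ^ 2) ≤ En := by
    have hm : AEMeasurable (fun p : Eu n × Eu n => ENNReal.ofReal (ker s p.1 p.2 * u p.2 ^ 2))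
        ((volume.restrict Ωᶜ).prod (volume.restrict Ω)) := by
      have : AEMeasurable (fun p : Eu n × Eu n => u p.2)
        ((volume.restrict Ωᶜ).prod (volume.restrict Ω)) := hu.restrict.comp_snd.aemeasurable
      exact (hmk.aemeasurable.mul (this.pow_const 2)).ennreal_ofReal
    rw [← lintegral_prod (fun p : Eu n × Eu n => ENNReal.ofReal (ker s p.1 p.2 * u p.2 ^ 2)) hm,
      Measure.prod_restrict]
    refine le_trans (le_of_eq ?_) (lintegral_mono_set (cross_subset_interaction (Ω := Ω)))
    refine setLIntegral_congr_fun (hΩm.compl.prod hΩm) fun p hp => ?_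
    simp only [hu0 p.1 hp.1]
    congr 1
    ring
  have h3 : ∫⁻ x in Ωᶜ, ∫⁻ p, ENNReal.ofReal
      (ρ x / 2 * (kerMass s Ω x)⁻¹ * (ker s x p.1 * ker s x p.2)) *
      ENNReal.ofReal ((u p.1 - u p.2) ^ 2)
      ∂(volume.restrict Ω).prod (volume.restrict Ω) ≤ 2 * En := by
    refine le_trans ?_ (mul_le_mul_right hcross 2)
    rw [← lintegral_const_mul' _ _ (by simp)]
    refine lintegral_mono fun x => ?_
    have hkx := measurable_ker_right s x
    set μ := (volume.restrict Ω : Measure (Eu n)) with hμ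
    have hum : AEMeasurable u μ := hu.restrict.aemeasurable
    set f : Eu n → ℝ≥0∞ := fun y => ENNReal.ofReal (ker s x y * u y ^ 2) with hf
    set k : Eu n → ℝ≥0∞ := fun y => ENNReal.ofReal (ker s x y) with hk
    have hfm : AEMeasurable f μ := by fun_prop
    have hkm : AEMeasurable k μ := by fun_prop
    -- The inequality `(a - b)² ≤ 2 a² + 2 b²` decouples the two points; one of them then integrates
    -- out against the normalization `(kerMass)⁻¹`.
    have hpt : ∀ p : Eu n × Eu n, ENNReal.ofReal
        (ρ x / 2 * (kerMass s Ω x)⁻¹ * (ker s x p.1 * ker s x p.2)) *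
        ENNReal.ofReal ((u p.1 - u p.2) ^ 2) ≤
        ENNReal.ofReal (kerMass s Ω x)⁻¹ * (f p.1 * k p.2 + k p.1 * f p.2) := by
      intro p
      have k1 := ker_nonneg s x p.1
      have k2 := ker_nonneg s x p.2
      have k3 := inv_nonneg.2 (kerMass_nonneg s Ω x)
      have k4 := hρ1 x
      simp only [hf, hk]
      rw [← ENNReal.ofReal_mul' (by positivity), ← ENNReal.ofReal_mul (by positivity),
        ← ENNReal.ofReal_mul (by positivity), ← ENNReal.ofReal_add (by positivity) (by positivity),
        ← ENNReal.ofReal_mul (by positivity)]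
      refine ENNReal.ofReal_le_ofReal ?_
      have k5 : ρ x / 2 * (u p.1 - u p.2) ^ 2 ≤ u p.1 ^ 2 + u p.2 ^ 2 := by
        have := sq_nonneg (u p.1 + u p.2)
        have := mul_le_mul_of_nonneg_right k4.2 (sq_nonneg (u p.1 - u p.2))
        nlinarith
      calc _ = (kerMass s Ω x)⁻¹ * (ker s x p.1 * ker s x p.2) *
            (ρ x / 2 * (u p.1 - u p.2) ^ 2) := by ring
        _ ≤ (kerMass s Ω x)⁻¹ * (ker s x p.1 * ker s x p.2) * (u p.1 ^ 2 + u p.2 ^ 2) := by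
            gcongr
        _ = _ := by ring
    refine (lintegral_mono hpt).trans ?_
    have hfk : AEMeasurable (fun p : Eu n × Eu n => f p.1 * k p.2) (μ.prod μ) :=
      hfm.comp_fst.mul hkm.comp_snd
    rw [lintegral_const_mul' _ _ ENNReal.ofReal_ne_top, lintegral_add_left' hfk, lintegral_prod_mul hfm hkm,
      lintegral_prod_mul hkm hfm]
    have hle := ofReal_inv_kerMass_mul_psi_le s Ω x
    change ENNReal.ofReal (kerMass s Ω x)⁻¹ * ∫⁻ y, k y ∂μ ≤ 1 at hle
    calc _ = 2 * ((ENNReal.ofReal (kerMass s Ω x)⁻¹ * ∫⁻ y, k y ∂μ) * ∫⁻ y, f y ∂μ) := by ring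
      _ ≤ 2 * (1 * ∫⁻ y, f y ∂μ) := by gcongr
      _ = _ := by rw [one_mul]
  rw [jumpEnergy_jumpMeasure hρ hu]
  calc _ ≤ En + (En + 2 * En) := add_le_add h1 (add_le_add h2 h3)
    _ = 4 * En := by ring

/-- The Robin form controls the energy inside `Ω`. -/
lemma inner_energy_le_jumpEnergy (hρ : Measurable ρ) {u : Eu n → ℝ}
    (hu : AEStronglyMeasurable u volume) :
    ∫⁻ p in Ω ×ˢ Ω, ENNReal.ofReal ((u p.1 - u p.2) ^ 2 * ker s p.1 p.2) ≤
      2 * jumpEnergy (jumpMeasure s Ω ρ) u := by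
  rw [jumpEnergy_jumpMeasure hρ hu]
  refine le_trans (le_of_eq ?_) (mul_le_mul_right le_self_add 2)
  rw [← lintegral_const_mul' _ _ (by simp), Measure.prod_restrict]
  refine lintegral_congr fun p => ?_
  have := ker_nonneg s p.1 p.2
  rw [← ENNReal.ofReal_mul (by positivity), show (2 : ℝ≥0∞) = ENNReal.ofReal 2 by simp,
    ← ENNReal.ofReal_mul (by positivity)]
  congr 1
  ring

/-- The bracket in the limit functional is the Robin form of the characteristic function. -/
theorem jumpEnergy_chi (hΩm : MeasurableSet Ω) (hρ : Measurable ρ)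
    (hfin : ∫⁻ x in Ωᶜ, psi s Ω x < ⊤) {α β : Eu n → ℝ}
    (hρa : ∀ x ∈ Ωᶜ, 1 - ρ x = α x / (α x + β x)) (hρb : ∀ x ∈ Ωᶜ, ρ x = β x / (α x + β x))
    (hρ1 : ∀ x, ρ x ∈ Icc (0 : ℝ) 1)
    {E : Set (Eu n)} (hE : MeasurableSet E) (hEΩ : E ⊆ Ω) :
    jumpEnergy (jumpMeasure s Ω ρ) (chi E) = bracket s Ω α β E := by
  have hmk := measurable_ker (n := n) s
  have hmE := measurable_chi hE
  have hmF := measurable_chi (hE.compl.inter hΩm)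
  have hpsi : ∀ (F : Set (Eu n)), MeasurableSet F → F ⊆ Ω → ∀ x,
      ∫⁻ y in Ω, ENNReal.ofReal (ker s x y) * ENNReal.ofReal (chi F y) = psi s F x := by
    intro F hF hFΩ x
    have : ∀ y, ENNReal.ofReal (ker s x y) * ENNReal.ofReal (chi F y) =
        F.indicator (fun y => ENNReal.ofReal (ker s x y)) y := fun y => by
      by_cases hy : y ∈ F <;> simp [chi, hy]
    simp only [this]
    rw [lintegral_indicator hF, Measure.restrict_restrict hF, inter_eq_left.2 hFΩ, psi]
  rw [jumpEnergy_jumpMeasure hρ hmE.aestronglyMeasurable, bracket, add_assoc]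
  congr 1
  · rw [localPs, lintegral_prod _ (by fun_prop), ← lintegral_const_mul' _ _ (by simp)]
    refine lintegral_congr fun x => ?_
    rw [← lintegral_const_mul' _ _ (by simp)]
    refine lintegral_congr fun y => ?_
    have := ker_nonneg s x y
    simp only
    rw [← ENNReal.ofReal_mul (by positivity), show (1 / 2 : ℝ≥0∞) = ENNReal.ofReal (1 / 2) by
      rw [ENNReal.ofReal_div_of_pos two_pos]; simp, ← ENNReal.ofReal_mul (by positivity)]
    congr 1
    by_cases hx : x ∈ E <;> by_cases hy : y ∈ E <;> simp [chi, hx, hy] <;> ring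
  congr 1
  · rw [lintegral_prod _ (by fun_prop)]
    refine setLIntegral_congr_fun hΩm.compl fun x hx => ?_
    have hxE : x ∉ E := fun h => hx (hEΩ h)
    simp only
    rw [← hpsi E hE hEΩ x, ← hρa x hx, ← lintegral_const_mul' _ _ ENNReal.ofReal_ne_top]
    refine lintegral_congr fun y => ?_
    rw [ENNReal.ofReal_mul (by linarith [(hρ1 x).2]), mul_assoc]
    congr 3
    by_cases hy : y ∈ E <;> simp [chi, hxE, hy]
  · refine lintegral_congr_ae ?_
    have hae := ae_lt_top (measurable_psi s Ω) hfin.ne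
    filter_upwards [hae, self_mem_ae_restrict hΩm.compl] with x hx hxΩ
    have hkx := measurable_ker_right s x
    rw [inter_eq_left.2 hEΩ, ← hρb x hxΩ]
    -- The squared difference is 1 precisely when one point lies in `E` and the other in `Ω \ E`.
    -- The two orders contribute equally, which cancels the factor `1/2` in the density.
    have hpt : ∀ p ∈ Ω ×ˢ Ω, ENNReal.ofReal
        (ρ x / 2 * (kerMass s Ω x)⁻¹ * (ker s x p.1 * ker s x p.2)) *
        ENNReal.ofReal ((chi E p.1 - chi E p.2) ^ 2) =
        ENNReal.ofReal (ρ x / 2 * (kerMass s Ω x)⁻¹) *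
          ((ENNReal.ofReal (ker s x p.1) * ENNReal.ofReal (chi E p.1)) *
              (ENNReal.ofReal (ker s x p.2) * ENNReal.ofReal (chi (Eᶜ ∩ Ω) p.2)) +
            (ENNReal.ofReal (ker s x p.1) * ENNReal.ofReal (chi (Eᶜ ∩ Ω) p.1)) *
              (ENNReal.ofReal (ker s x p.2) * ENNReal.ofReal (chi E p.2))) := by
      intro p hp
      have h1 : 0 ≤ ρ x / 2 * (kerMass s Ω x)⁻¹ :=
        mul_nonneg (by linarith [(hρ1 x).1]) (inv_nonneg.2 (kerMass_nonneg _ _ _))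
      rw [ENNReal.ofReal_mul h1, ENNReal.ofReal_mul (ker_nonneg _ _ _), mul_assoc]
      congr 1
      have hp1 : p.1 ∈ Ω := hp.1
      have hp2 : p.2 ∈ Ω := hp.2
      by_cases ha : p.1 ∈ E <;> by_cases hb : p.2 ∈ E <;> simp [chi, ha, hb, hp1, hp2]
    have hmeas1 : AEMeasurable (fun y => ENNReal.ofReal (ker s x y) * ENNReal.ofReal (chi E y))
      (volume.restrict Ω) := by fun_prop
    have hmeas2 : AEMeasurable
      (fun y => ENNReal.ofReal (ker s x y) * ENNReal.ofReal (chi (Eᶜ ∩ Ω) y))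
      (volume.restrict Ω) := by fun_prop
    have hmeas3 : AEMeasurable (fun p : Eu n × Eu n =>
        (ENNReal.ofReal (ker s x p.1) * ENNReal.ofReal (chi E p.1)) *
          (ENNReal.ofReal (ker s x p.2) * ENNReal.ofReal (chi (Eᶜ ∩ Ω) p.2)))
        ((volume.restrict Ω).prod (volume.restrict Ω)) := hmeas1.comp_fst.mul hmeas2.comp_snd
    rw [Measure.prod_restrict, setLIntegral_congr_fun (hΩm.prod hΩm) hpt,
      ← Measure.prod_restrict, lintegral_const_mul' _ _ ENNReal.ofReal_ne_top,
      lintegral_add_left' hmeas3, lintegral_prod_mul hmeas1 hmeas2,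
      lintegral_prod_mul hmeas2 hmeas1, hpsi E hE hEΩ x,
      hpsi _ (hE.compl.inter hΩm) inter_subset_right x]
    have hle : psi s E x ≤ psi s Ω x := lintegral_mono_set hEΩ
    rcases eq_or_ne (psi s Ω x) 0 with h0 | h0
    · have : psi s E x = 0 := le_antisymm (hle.trans h0.le) zero_le
      simp [this]
    · have hpos : 0 < kerMass s Ω x := by
        rw [← ofReal_kerMass hx] at h0
        exact ENNReal.ofReal_pos.1 (pos_iff_ne_zero.2 h0)
      have h4 : ENNReal.ofReal (ρ x / 2 * (kerMass s Ω x)⁻¹) =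
          ENNReal.ofReal (ρ x) * ENNReal.ofReal (1 / 2) * (psi s Ω x)⁻¹ := by
        rw [← ofReal_kerMass hx, ← ENNReal.ofReal_inv_of_pos hpos,
          ← ENNReal.ofReal_mul (hρ1 x).1, ← ENNReal.ofReal_mul (by linarith [(hρ1 x).1])]
        congr 1
        ring
      have h5 : ENNReal.ofReal (1 / 2) * 2 = 1 := by
        rw [show (2 : ℝ≥0∞) = ENNReal.ofReal 2 by simp, ← ENNReal.ofReal_mul (by norm_num)]
        norm_num
      rw [h4, mul_comm (psi s (Eᶜ ∩ Ω) x) (psi s E x), ← two_mul]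
      calc _ = (ENNReal.ofReal (1 / 2) * 2) * (ENNReal.ofReal (ρ x) *
            (psi s E x * psi s (Eᶜ ∩ Ω) x * (psi s Ω x)⁻¹)) := by ring
        _ = _ := by rw [h5, one_mul, div_eq_mul_inv]

end RobinForm

/-! ### Equivalence of the Robin problem with the resolvent equation on `Ω`. -/

section RobinSolutions

variable {s : ℝ} {Ω : Set (Eu n)} {ρ : Eu n → ℝ}

/-- The point `-s/2` lies strictly between two poles of `Γ`, namely `-1` and `0`. -/
lemma cns_pos (hn : 1 ≤ n) (hs : s ∈ Ioo (0 : ℝ) 1) : 0 < cns n s := by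
  have hn' : (1 : ℝ) ≤ n := by exact_mod_cast hn
  have h1 : 0 < Real.Gamma (((n : ℝ) + s) / 2) := Real.Gamma_pos_of_pos (by linarith [hs.1])
  have h2 : Real.Gamma (-s / 2) ≠ 0 := by
    refine Real.Gamma_ne_zero fun m h => ?_
    have h3 : (m : ℝ) = s / 2 := by linarith
    have h4 : (0 : ℝ) < m := by rw [h3]; linarith [hs.1]
    have h5 : (1 : ℝ) ≤ m := by exact_mod_cast (Nat.cast_pos.1 h4)
    linarith [hs.2]
  have h3 := abs_pos.2 h2
  have := Real.pi_pos
  unfold cns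
  positivity

/-- The symmetrized double integral of a bilinear expression against a product weight. -/
lemma integral_prod_weight_sub_mul_sub {X : Type*} [MeasurableSpace X] {μ : Measure X}
    [SFinite μ] {k u v : X → ℝ} (hk : Integrable k μ) (hu : AEStronglyMeasurable u μ)
    (hv : AEStronglyMeasurable v μ) (hub : ∃ M, ∀ᵐ x ∂μ, |u x| ≤ M)
    (hvb : ∃ M, ∀ᵐ x ∂μ, |v x| ≤ M) :
    ∫ p, (k p.1 * k p.2) * ((u p.1 - u p.2) * (v p.1 - v p.2)) ∂μ.prod μ =
      2 * ((∫ x, k x ∂μ) * (∫ x, k x * (u x * v x) ∂μ) -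
        (∫ x, k x * u x ∂μ) * (∫ x, k x * v x ∂μ)) := by
  obtain ⟨M, hM⟩ := hub
  obtain ⟨M', hM'⟩ := hvb
  have i1 : Integrable (fun x => k x * u x) μ := hk.mul_bdd hu hM
  have i2 : Integrable (fun x => k x * v x) μ := hk.mul_bdd hv hM'
  have i3 : Integrable (fun x => k x * (u x * v x)) μ :=
    (i1.mul_bdd hv hM').congr (Eventually.of_forall fun x => mul_assoc _ _ _)
  have j1 : Integrable (fun p : X × X => k p.1 * (u p.1 * v p.1) * k p.2) (μ.prod μ) :=
    i3.mul_prod hk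
  have j2 : Integrable (fun p : X × X => k p.1 * u p.1 * (k p.2 * v p.2)) (μ.prod μ) :=
    i1.mul_prod i2
  have j3 : Integrable (fun p : X × X => k p.1 * v p.1 * (k p.2 * u p.2)) (μ.prod μ) :=
    i2.mul_prod i1
  have j4 : Integrable (fun p : X × X => k p.1 * (k p.2 * (u p.2 * v p.2))) (μ.prod μ) :=
    hk.mul_prod i3
  have e : ∀ p : X × X, (k p.1 * k p.2) * ((u p.1 - u p.2) * (v p.1 - v p.2)) =
      (k p.1 * (u p.1 * v p.1) * k p.2 - k p.1 * u p.1 * (k p.2 * v p.2)) -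
        (k p.1 * v p.1 * (k p.2 * u p.2) - k p.1 * (k p.2 * (u p.2 * v p.2))) := fun p => by ring
  have j12 : Integrable (fun p : X × X => k p.1 * (u p.1 * v p.1) * k p.2 -
    k p.1 * u p.1 * (k p.2 * v p.2)) (μ.prod μ) := j1.sub j2
  have j34 : Integrable (fun p : X × X => k p.1 * v p.1 * (k p.2 * u p.2) -
    k p.1 * (k p.2 * (u p.2 * v p.2))) (μ.prod μ) := j3.sub j4
  simp only [e]
  rw [integral_sub j12 j34, integral_sub j1 j2, integral_sub j3 j4,
    integral_prod_mul (fun x => k x * (u x * v x)) k,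
    integral_prod_mul (fun x => k x * u x) (fun x => k x * v x),
    integral_prod_mul (fun x => k x * v x) (fun x => k x * u x),
    integral_prod_mul k (fun x => k x * (u x * v x))]
  ring

/-- Handles the degenerate points at which dividing by `kerMass` is not meaningful: every weighted
integral vanishes there as well. -/
lemma integral_ker_mul_eq_zero {x : Eu n} (hx : psi s Ω x < ⊤) (h0 : kerMass s Ω x = 0)
    (w : Eu n → ℝ) : ∫ y in Ω, ker s x y * w y = 0 := by
  have h1 := (integral_eq_zero_iff_of_nonneg (fun y => ker_nonneg s x y)
    (integrableOn_ker hx)).1 h0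
  refine integral_eq_zero_of_ae ?_
  filter_upwards [h1] with y hy
  simp only [Pi.zero_apply] at hy ⊢
  rw [hy, zero_mul]

/-- The bilinear Robin form, written out. -/
lemma jumpForm_jumpMeasure (hΩm : MeasurableSet Ω) (hρ : Measurable ρ)
    (hρ1 : ∀ x, ρ x ∈ Icc (0 : ℝ) 1) (hfin : ∫⁻ x in Ωᶜ, psi s Ω x < ⊤) {u v : Eu n → ℝ}
    (hu : FormDomain volume (jumpMeasure s Ω ρ) Ω u)
    (hv : FormDomain volume (jumpMeasure s Ω ρ) Ω v) :
    jumpForm (jumpMeasure s Ω ρ) u v =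
      (∫ p, ker s p.1 p.2 / 2 * ((u p.1 - u p.2) * (v p.1 - v p.2))
          ∂(volume.restrict Ω).prod (volume.restrict Ω)) +
      ∫ x in Ωᶜ, ((∫ y in Ω, ker s x y * (u y * v y)) -
        ρ x * (kerMass s Ω x)⁻¹ *
          ((∫ y in Ω, ker s x y * u y) * ∫ y in Ω, ker s x y * v y)) := by
  have hmk := measurable_ker (n := n) s
  have hν := absContMarginals_jumpMeasure s Ω ρ
  have hint := integrable_jumpForm hν hu hv
  set f : Eu n × Eu n → ℝ := fun p => (u p.1 - u p.2) * (v p.1 - v p.2) with hf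
  have hd2 : Measurable fun p : Eu n × Eu n => (1 - ρ p.1) * ker s p.1 p.2 :=
    (measurable_const.sub (hρ.comp measurable_fst)).mul hmk
  have hd2' : ∀ p : Eu n × Eu n, 0 ≤ (1 - ρ p.1) * ker s p.1 p.2 := fun p =>
    mul_nonneg (by linarith [(hρ1 p.1).2]) (ker_nonneg _ _ _)
  have hd3' : ∀ q : Eu n × Eu n × Eu n,
      0 ≤ ρ q.1 / 2 * (kerMass s Ω q.1)⁻¹ * (ker s q.1 q.2.1 * ker s q.1 q.2.2) := fun q =>
    mul_nonneg (mul_nonneg (by linarith [(hρ1 q.1).1]) (inv_nonneg.2 (kerMass_nonneg _ _ _)))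
      (mul_nonneg (ker_nonneg _ _ _) (ker_nonneg _ _ _))
  rw [jumpMeasure, integrable_add_measure, integrable_add_measure] at hint
  obtain ⟨i1, i2, i3⟩ := hint
  have i3' := (integrable_map_measure i3.1 measurable_snd.aemeasurable).1 i3
  have i2'' := integrable_withDensity_ofReal hd2 hd2' i2
  have i3'' : Integrable (fun q : Eu n × Eu n × Eu n => ρ q.1 / 2 * (kerMass s Ω q.1)⁻¹ *
      (ker s q.1 q.2.1 * ker s q.1 q.2.2) * f q.2)
      ((volume.restrict Ωᶜ).prod ((volume.restrict Ω).prod (volume.restrict Ω))) :=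
    integrable_withDensity_ofReal (measurable_tripleDensity hρ) hd3' i3'
  rw [jumpForm, jumpMeasure, integral_add_measure i1 (i2.add_measure i3),
    integral_add_measure i2 i3, innerMeasure,
    integral_withDensity_ofReal _ (hmk.div_const 2)
      (fun p => div_nonneg (ker_nonneg _ _ _) two_pos.le), killingMeasure,
    integral_withDensity_ofReal _ hd2 hd2', integral_map measurable_snd.aemeasurable i3.1,
    tripleMeasure, integral_withDensity_ofReal _ (measurable_tripleDensity hρ) hd3',
    integral_prod _ i2'', integral_prod _ i3'',
    ← integral_add i2''.integral_prod_left i3''.integral_prod_left]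
  congr 1
  refine integral_congr_ae ?_
  have hae := ae_lt_top (measurable_psi s Ω) hfin.ne
  filter_upwards [hae, self_mem_ae_restrict hΩm.compl] with x hx hxΩ
  obtain ⟨M, hM⟩ := hu.bdd
  obtain ⟨M', hM'⟩ := hv.bdd
  have hdouble := integral_prod_weight_sub_mul_sub (integrableOn_ker hx) hu.meas.restrict
    hv.meas.restrict ⟨M, ae_restrict_of_ae hM⟩ ⟨M', ae_restrict_of_ae hM'⟩
  have e1 : ∫ y in Ω, (1 - ρ x) * ker s x y * f (x, y) =
      (1 - ρ x) * ∫ y in Ω, ker s x y * (u y * v y) := by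
    rw [← integral_const_mul]
    refine integral_congr_ae (Eventually.of_forall fun y => ?_)
    simp only [hf, hu.zero x hxΩ, hv.zero x hxΩ]
    ring
  have e2 : ∫ p, ρ x / 2 * (kerMass s Ω x)⁻¹ * (ker s x p.1 * ker s x p.2) * f p
      ∂(volume.restrict Ω).prod (volume.restrict Ω) = ρ x / 2 * (kerMass s Ω x)⁻¹ *
        (2 * (kerMass s Ω x * (∫ y in Ω, ker s x y * (u y * v y)) -
          (∫ y in Ω, ker s x y * u y) * ∫ y in Ω, ker s x y * v y)) := by
    rw [kerMass] at *
    rw [← hdouble, ← integral_const_mul]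
    refine integral_congr_ae (Eventually.of_forall fun p => ?_)
    simp only [hf]
    ring
  rw [e1, e2]
  -- The killing weight `1 - ρ` and the diagonal part `ρ` of the reflected jumps add up to 1,
  -- leaving the full kernel minus a rank-one correction.
  rcases eq_or_ne (kerMass s Ω x) 0 with h0 | h0
  · simp [integral_ker_mul_eq_zero hx h0]
  · field_simp
    ring

lemma lintegral_interaction_le_add {e : Eu n × Eu n → ℝ≥0∞} :
    ∫⁻ p in interaction Ω, e p ≤ (∫⁻ p in Ω ×ˢ Ω, e p) +
      ((∫⁻ p in Ωᶜ ×ˢ Ω, e p) + ∫⁻ p in Ω ×ˢ Ωᶜ, e p) := by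
  have h : interaction Ω ⊆ Ω ×ˢ Ω ∪ (Ωᶜ ×ˢ Ω ∪ Ω ×ˢ Ωᶜ) := by
    rintro ⟨x, y⟩ hp
    simp only [interaction, mem_compl_iff, mem_prod] at hp
    simp only [mem_union, mem_prod, mem_compl_iff]
    tauto
  exact (lintegral_mono_set h).trans ((lintegral_union_le _ _ _).trans
    (add_le_add_right (lintegral_union_le _ _ _) _))

/-- Bounded functions have finite energy as soon as their energy inside `Ω` is finite. -/
lemma energy_lt_top_of_inner (hfin : ∫⁻ x in Ωᶜ, psi s Ω x < ⊤) {u : Eu n → ℝ}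
    (hub : ∃ M : ℝ, ∀ᵐ x, |u x| ≤ M)
    (hin : ∫⁻ p in Ω ×ˢ Ω, ENNReal.ofReal ((u p.1 - u p.2) ^ 2 * ker s p.1 p.2) < ⊤) :
    ∫⁻ p in interaction Ω, ENNReal.ofReal ((u p.1 - u p.2) ^ 2 * ker s p.1 p.2) < ⊤ := by
  have hmk := (measurable_ker (n := n) s).ennreal_ofReal
  obtain ⟨M, hM⟩ := hub
  have h1 : ∫⁻ p in Ωᶜ ×ˢ Ω, ENNReal.ofReal (ker s p.1 p.2) < ⊤ := by
    rw [Measure.volume_eq_prod, ← Measure.prod_restrict, lintegral_prod _ hmk.aemeasurable]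
    exact hfin
  have h2 : ∫⁻ p in Ω ×ˢ Ωᶜ, ENNReal.ofReal (ker s p.1 p.2) < ⊤ := by
    rw [Measure.volume_eq_prod, ← Measure.prod_restrict, lintegral_prod_symm' _ hmk]
    refine lt_of_le_of_lt (le_of_eq ?_) hfin
    refine lintegral_congr fun x => lintegral_congr fun y => ?_
    simp only
    rw [ker_comm]
  -- On the cross regions the squared difference is at most `(2 M)²`, and the kernel has finite mass
  -- there.
  have hbd : ∀ S : Set (Eu n × Eu n), ∫⁻ p in S, ENNReal.ofReal (ker s p.1 p.2) < ⊤ →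
      ∫⁻ p in S, ENNReal.ofReal ((u p.1 - u p.2) ^ 2 * ker s p.1 p.2) < ⊤ := by
    intro S hS
    refine lt_of_le_of_lt (?_ : _ ≤ ∫⁻ p in S, ENNReal.ofReal ((2 * M) ^ 2) *
      ENNReal.ofReal (ker s p.1 p.2)) ?_
    · have a1 : ∀ᵐ p : Eu n × Eu n, |u p.1| ≤ M := Measure.quasiMeasurePreserving_fst.ae hM
      have a2 : ∀ᵐ p : Eu n × Eu n, |u p.2| ≤ M := Measure.quasiMeasurePreserving_snd.ae hM
      refine lintegral_mono_ae (ae_restrict_of_ae ?_)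
      filter_upwards [a1, a2] with p k1 k2
      rw [← ENNReal.ofReal_mul (sq_nonneg _)]
      refine ENNReal.ofReal_le_ofReal (mul_le_mul_of_nonneg_right ?_ (ker_nonneg _ _ _))
      rw [sq_le_sq, abs_of_nonneg (by linarith [(abs_nonneg _).trans k1] : 0 ≤ 2 * M)]
      exact (abs_sub _ _).trans (by linarith)
    · rw [lintegral_const_mul' _ _ ENNReal.ofReal_ne_top]
      exact ENNReal.mul_lt_top ENNReal.ofReal_lt_top hS
  exact lintegral_interaction_le_add.trans_lt
    (ENNReal.add_lt_top.2 ⟨hin, ENNReal.add_lt_top.2 ⟨hbd _ h1, hbd _ h2⟩⟩)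

/-- Replacing the exterior values by 0 does not change the energy inside `Ω`, and the cross energy
stays finite because the function is bounded. -/
lemma FiniteEnergy.formDomain_indicator (hΩm : MeasurableSet Ω) (hρ : Measurable ρ)
    (hρ1 : ∀ x, ρ x ∈ Icc (0 : ℝ) 1) (hfin : ∫⁻ x in Ωᶜ, psi s Ω x < ⊤) {u : Eu n → ℝ}
    (hu : FiniteEnergy s Ω u) : FormDomain volume (jumpMeasure s Ω ρ) Ω (Ω.indicator u) := by
  obtain ⟨M, hM⟩ := hu.bdd
  have hb : ∃ M : ℝ, ∀ᵐ x, |Ω.indicator u x| ≤ M := by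
    refine ⟨M, hM.mono fun x hx => ?_⟩
    by_cases hxΩ : x ∈ Ω
    · rwa [indicator_of_mem hxΩ]
    · rw [indicator_of_notMem hxΩ, abs_zero]
      exact (abs_nonneg _).trans hx
  have hz : ∀ x ∉ Ω, Ω.indicator u x = 0 := fun x hx => indicator_of_notMem hx _
  have hm := hu.meas.indicator hΩm
  refine ⟨hm, hb, hz, (jumpEnergy_le_energy hΩm hρ hρ1 hm hz).trans_lt
    (ENNReal.mul_lt_top (by simp) (energy_lt_top_of_inner hfin hb ?_))⟩
  refine lt_of_le_of_lt (le_trans (le_of_eq ?_) (lintegral_mono_set inner_subset_interaction))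
    hu.energy
  refine setLIntegral_congr_fun (hΩm.prod hΩm) fun p hp => ?_
  simp only [indicator_of_mem hp.1, indicator_of_mem hp.2]

/-- Together with `FiniteEnergy.formDomain_indicator` this identifies the test functions of the
Robin problem with those of the resolvent equation. -/
lemma FormDomain.finiteEnergy (hρ : Measurable ρ)
    (hfin : ∫⁻ x in Ωᶜ, psi s Ω x < ⊤) {u : Eu n → ℝ}
    (hu : FormDomain volume (jumpMeasure s Ω ρ) Ω u) : FiniteEnergy s Ω u :=
  ⟨hu.meas, hu.bdd, energy_lt_top_of_inner hfin hu.bdd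
    ((inner_energy_le_jumpEnergy hρ hu.meas).trans_lt (ENNReal.mul_lt_top (by simp) hu.energy))⟩

lemma FiniteEnergy.integrable_mul {u v : Eu n → ℝ} (hu : FiniteEnergy s Ω u)
    (hv : FiniteEnergy s Ω v) :
    IntegrableOn (fun p : Eu n × Eu n => (u p.1 - u p.2) * (v p.1 - v p.2) * ker s p.1 p.2)
      (interaction Ω) := by
  have hmk := (measurable_ker (n := n) s).aestronglyMeasurable
    (μ := (volume : Measure (Eu n × Eu n)))
  have hmu : ∀ {w : Eu n → ℝ}, AEStronglyMeasurable w volume →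
      AEStronglyMeasurable (fun p : Eu n × Eu n => w p.1 - w p.2) volume := fun hw =>
    hw.comp_fst.sub hw.comp_snd
  have hsq : ∀ {w : Eu n → ℝ}, FiniteEnergy s Ω w →
      IntegrableOn (fun p : Eu n × Eu n => (w p.1 - w p.2) ^ 2 * ker s p.1 p.2)
        (interaction Ω) := fun hw =>
    (lintegral_ofReal_ne_top_iff_integrable ((((hmu hw.meas).pow 2).mul hmk).restrict)
      (Eventually.of_forall fun p => mul_nonneg (sq_nonneg _) (ker_nonneg _ _ _))).1 hw.energy.ne
  refine Integrable.mono ((hsq hu).add (hsq hv)) (((hmu hu.meas).mul (hmu hv.meas)).mul hmk).restrict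
    (Eventually.of_forall fun p => ?_)
  have hk := ker_nonneg s p.1 p.2
  rw [Pi.add_apply, ← add_mul, norm_mul, norm_mul _ (ker s p.1 p.2)]
  refine mul_le_mul_of_nonneg_right ?_ (norm_nonneg _)
  rw [Real.norm_eq_abs, Real.norm_eq_abs, abs_mul, abs_of_nonneg (by positivity : 0 ≤
    (u p.1 - u p.2) ^ 2 + (v p.1 - v p.2) ^ 2)]
  nlinarith [two_mul_le_add_sq |u p.1 - u p.2| |v p.1 - v p.2|, sq_abs (u p.1 - u p.2),
    sq_abs (v p.1 - v p.2), abs_nonneg (u p.1 - u p.2), abs_nonneg (v p.1 - v p.2),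
    sq_nonneg (u p.1 - u p.2), sq_nonneg (v p.1 - v p.2)]

/-- The fractional form of a function satisfying the exterior condition, in terms of its
restriction to `Ω`. -/
theorem fracForm_eq_jumpForm (hΩm : MeasurableSet Ω) (hρ : Measurable ρ)
    (hρ1 : ∀ x, ρ x ∈ Icc (0 : ℝ) 1) (hfin : ∫⁻ x in Ωᶜ, psi s Ω x < ⊤) {φ v : Eu n → ℝ}
    (hφ : FiniteEnergy s Ω φ) (hv : FiniteEnergy s Ω v) (hv0 : ∀ x ∈ Ωᶜ, v x = 0)
    (hext : ∀ᵐ x ∂volume.restrict Ωᶜ, kerMass s Ω x ≠ 0 →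
      φ x = ρ x * (kerMass s Ω x)⁻¹ * ∫ y in Ω, ker s x y * φ y) :
    fracForm s Ω φ v = cns n s * jumpForm (jumpMeasure s Ω ρ) (Ω.indicator φ) v := by
  have hφd := hφ.formDomain_indicator hΩm hρ hρ1 hfin
  have hvd : FormDomain volume (jumpMeasure s Ω ρ) Ω v := by
    have h := hv.formDomain_indicator (ρ := ρ) hΩm hρ hρ1 hfin
    rwa [indicator_eq_self.2 fun x hx => by_contra fun hxΩ => hx (hv0 x hxΩ)] at h
  have hint := hφ.integrable_mul hv
  set f : Eu n × Eu n → ℝ := fun p => (φ p.1 - φ p.2) * (v p.1 - v p.2) * ker s p.1 p.2 with hf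
  have hset : interaction Ω = Ω ×ˢ Ω ∪ (Ωᶜ ×ˢ Ω ∪ Ω ×ˢ Ωᶜ) := by
    ext ⟨x, y⟩
    simp only [interaction, mem_compl_iff, mem_prod, mem_union]
    tauto
  have hm1 := hΩm.prod hΩm
  have hm2 := hΩm.compl.prod hΩm
  have hm3 := hΩm.prod hΩm.compl
  have i1 : IntegrableOn f (Ω ×ˢ Ω) := hint.mono_set inner_subset_interaction
  have i2 : IntegrableOn f (Ωᶜ ×ˢ Ω) := hint.mono_set cross_subset_interaction
  have i3 : IntegrableOn f (Ω ×ˢ Ωᶜ) := hint.mono_set cross_subset_interaction'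
  have hd1 : Disjoint (Ω ×ˢ Ω) (Ωᶜ ×ˢ Ω ∪ Ω ×ˢ Ωᶜ) := by
    rw [Set.disjoint_left]
    rintro ⟨x, y⟩ h1 h2
    simp only [mem_compl_iff, mem_prod, mem_union] at h1 h2
    tauto
  have hd2 : Disjoint (Ωᶜ ×ˢ Ω) (Ω ×ˢ Ωᶜ) := by
    rw [Set.disjoint_left]
    rintro ⟨x, y⟩ h1 h2
    exact h1.1 h2.1
  have hsymm : ∀ p : Eu n × Eu n, f p.swap = f p := fun p => by
    simp only [hf, Prod.fst_swap, Prod.snd_swap, ker_comm s p.2 p.1]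
    ring
  -- The integrand is symmetric, so the two cross regions agree; this doubling, like that in `e1`,
  -- absorbs the `1/2` in `fracForm`.
  have e3 : ∫ p in Ω ×ˢ Ωᶜ, f p = ∫ p in Ωᶜ ×ˢ Ω, f p := by
    rw [Measure.volume_eq_prod, ← Measure.prod_restrict, ← Measure.prod_restrict,
      ← integral_prod_swap]
    simp only [hsymm]
  have e2 : ∫ p in Ωᶜ ×ˢ Ω, f p = ∫ x in Ωᶜ, ((∫ y in Ω, ker s x y * (Ω.indicator φ y * v y)) -
        ρ x * (kerMass s Ω x)⁻¹ *
          ((∫ y in Ω, ker s x y * Ω.indicator φ y) * ∫ y in Ω, ker s x y * v y)) := by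
    rw [Measure.volume_eq_prod, ← Measure.prod_restrict, integral_prod _ (by
      rw [Measure.prod_restrict]; exact i2)]
    refine integral_congr_ae ?_
    have hae := ae_lt_top (measurable_psi s Ω) hfin.ne
    filter_upwards [hae, self_mem_ae_restrict hΩm.compl, hext] with x hx hxΩ hxe
    obtain ⟨M, hM⟩ := hφ.bdd
    obtain ⟨M', hM'⟩ := hv.bdd
    have hk := integrableOn_ker hx
    have j1 : Integrable (fun y => ker s x y * φ y) (volume.restrict Ω) :=
      hk.mul_bdd hφ.meas.restrict (ae_restrict_of_ae hM)
    have j2 : Integrable (fun y => ker s x y * v y) (volume.restrict Ω) :=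
      hk.mul_bdd hv.meas.restrict (ae_restrict_of_ae hM')
    have j3 : Integrable (fun y => ker s x y * (φ y * v y)) (volume.restrict Ω) :=
      (j1.mul_bdd hv.meas.restrict (ae_restrict_of_ae hM')).congr
        (Eventually.of_forall fun y => mul_assoc _ _ _)
    have c1 : ∫ y in Ω, ker s x y * (Ω.indicator φ y * v y) =
        ∫ y in Ω, ker s x y * (φ y * v y) :=
      setIntegral_congr_fun hΩm fun y hy => by simp only [indicator_of_mem hy]
    have c2 : ∫ y in Ω, ker s x y * Ω.indicator φ y = ∫ y in Ω, ker s x y * φ y :=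
      setIntegral_congr_fun hΩm fun y hy => by simp only [indicator_of_mem hy]
    -- Because `v x = 0`, the exterior value `φ x` enters linearly, and the Robin condition can be
    -- substituted for it.
    have c3 : ∫ y in Ω, f (x, y) = (∫ y in Ω, ker s x y * (φ y * v y)) -
        φ x * ∫ y in Ω, ker s x y * v y := by
      rw [← integral_const_mul, ← integral_sub j3 (j2.const_mul _)]
      refine integral_congr_ae (Eventually.of_forall fun y => ?_)
      simp only [hf, hv0 x hxΩ]
      ring
    rw [c1, c2, c3]
    rcases eq_or_ne (kerMass s Ω x) 0 with h0 | h0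
    · simp [integral_ker_mul_eq_zero hx h0]
    · rw [hxe h0]
      ring
  have e1 : ∫ p in Ω ×ˢ Ω, f p = 2 * ∫ p, ker s p.1 p.2 / 2 *
      ((Ω.indicator φ p.1 - Ω.indicator φ p.2) * (v p.1 - v p.2))
      ∂(volume.restrict Ω).prod (volume.restrict Ω) := by
    rw [← integral_const_mul, Measure.prod_restrict]
    refine setIntegral_congr_fun hm1 fun p hp => ?_
    simp only [hf, indicator_of_mem hp.1, indicator_of_mem hp.2]
    ring
  rw [fracForm, hset, setIntegral_union hd1 (hm2.union hm3) i1 (i2.union i3),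
    setIntegral_union hd2 hm3 i2 i3, e3, jumpForm_jumpMeasure hΩm hρ hρ1 hfin hφd hvd, e1, e2]
  ring

/-- The normalized normal derivative, written with the kernel mass. -/
lemma normalizedN_eq (hc : cns n s ≠ 0) {φ : Eu n → ℝ} (hφm : AEStronglyMeasurable φ volume)
    (hφb : ∃ M : ℝ, ∀ᵐ x, |φ x| ≤ M) {x : Eu n} (hx : psi s Ω x < ⊤) (h0 : kerMass s Ω x ≠ 0) :
    normalizedN s Ω φ x = φ x - (kerMass s Ω x)⁻¹ * ∫ y in Ω, ker s x y * φ y := by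
  obtain ⟨M, hM⟩ := hφb
  have hk := integrableOn_ker hx
  have j1 : Integrable (fun y => ker s x y * φ y) (volume.restrict Ω) :=
    hk.mul_bdd hφm.restrict (ae_restrict_of_ae hM)
  have e : ∫ y in Ω, (φ x - φ y) * ker s x y =
      φ x * kerMass s Ω x - ∫ y in Ω, ker s x y * φ y := by
    rw [kerMass, ← integral_const_mul, ← integral_sub (hk.const_mul _) j1]
    exact integral_congr_ae (Eventually.of_forall fun y => by simp only; ring)
  rw [normalizedN, nonlocalN, e]
  change 1 / (cns n s * kerMass s Ω x) * _ = _
  field_simp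

variable {α β : Eu n → ℝ} {ε : ℝ} {E : Set (Eu n)}

/-- Restrictions of Robin solutions are resolvents of the Robin form. -/
theorem IsRobinSolution.isResolvent (hc : cns n s ≠ 0) (hΩm : MeasurableSet Ω) (hρ : Measurable ρ)
    (hρ1 : ∀ x, ρ x ∈ Icc (0 : ℝ) 1) (hfin : ∫⁻ x in Ωᶜ, psi s Ω x < ⊤)
    (hαβ : ∀ x ∈ Ωᶜ, α x + β x ≠ 0) (hρb : ∀ x ∈ Ωᶜ, ρ x = β x / (α x + β x))
    {φ : Eu n → ℝ} (h : IsRobinSolution s Ω α β ε E φ) :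
    IsResolvent volume (jumpMeasure s Ω ρ) Ω (ε ^ s * cns n s) (chi E) (Ω.indicator φ) := by
  refine ⟨h.finiteEnergy.formDomain_indicator hΩm hρ hρ1 hfin, fun v hv => ?_⟩
  have hvf := hv.finiteEnergy hρ hfin
  have e := h.equation v hvf hv.zero
  rw [fracForm_eq_jumpForm hΩm hρ hρ1 hfin h.finiteEnergy hvf hv.zero ?_] at e
  · rw [← e, mul_assoc]
    congr 1
    exact setIntegral_congr_fun hΩm fun y hy => by simp only [indicator_of_mem hy]
  · have hae := ae_lt_top (measurable_psi s Ω) hfin.ne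
    filter_upwards [hae, self_mem_ae_restrict hΩm.compl, h.exterior] with x hx hxΩ hxe h0
    -- The exterior condition reads `(α + β) φ x = β` times the kernel average of `φ`, solvable
    -- since `α + β ≠ 0`.
    rw [normalizedN_eq hc h.finiteEnergy.meas h.finiteEnergy.bdd hx h0] at hxe
    rw [hρb x hxΩ]
    have := hαβ x hxΩ
    field_simp at hxe ⊢
    linarith

open Classical in
/-- The extension of a resolvent to the exterior is a Robin solution. -/
theorem exists_isRobinSolution (hc : cns n s ≠ 0) (hΩm : MeasurableSet Ω) (hρ : Measurable ρ)
    (hρ1 : ∀ x, ρ x ∈ Icc (0 : ℝ) 1) (hfin : ∫⁻ x in Ωᶜ, psi s Ω x < ⊤)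
    (hαβ : ∀ x ∈ Ωᶜ, α x + β x ≠ 0) (hρb : ∀ x ∈ Ωᶜ, ρ x = β x / (α x + β x))
    {u : Eu n → ℝ} (hu1 : UnitValued volume Ω u)
    (hu : IsResolvent volume (jumpMeasure s Ω ρ) Ω (ε ^ s * cns n s) (chi E) u) :
    ∃ φ, IsRobinSolution s Ω α β ε E φ := by
  -- The exterior value forced by the Robin condition. Being `ρ` times an average of `u`, or 0 by
  -- default, it is bounded by 1.
  set A : Eu n → ℝ := fun x => ρ x * (kerMass s Ω x)⁻¹ * ∫ y in Ω, ker s x y * u y with hA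
  set φ : Eu n → ℝ := fun x => if x ∈ Ω then u x else A x with hφ
  have hin : ∀ x ∈ Ω, φ x = u x := fun x hx => if_pos hx
  have hout : ∀ x ∉ Ω, φ x = A x := fun x hx => if_neg hx
  have hkint : ∀ x, ∫ y in Ω, ker s x y * φ y = ∫ y in Ω, ker s x y * u y := fun x =>
    setIntegral_congr_fun hΩm fun y hy => by simp only [hin y hy]
  have hind : Ω.indicator φ = u := by
    ext x
    by_cases hx : x ∈ Ω
    · rw [indicator_of_mem hx, hin x hx]
    · rw [indicator_of_notMem hx, hu1.zero x hx]
  have hAm : AEStronglyMeasurable A volume := by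
    refine ((hρ.mul (measurable_kerMass s Ω).inv).aestronglyMeasurable).mul ?_
    have hm : AEStronglyMeasurable (fun p : Eu n × Eu n => ker s p.1 p.2 * u p.2)
        (volume.prod (volume.restrict Ω)) :=
      (measurable_ker s).aestronglyMeasurable.mul hu1.meas.restrict.comp_snd
    exact hm.integral_prod_right'
  have hAb : ∀ x, |A x| ≤ 1 := by
    intro x
    have h1 : |∫ y in Ω, ker s x y * u y| ≤ kerMass s Ω x ∨ psi s Ω x = ⊤ := by
      rcases eq_or_ne (psi s Ω x) ⊤ with h | h
      · exact Or.inr h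
      · refine Or.inl ?_
        rw [← Real.norm_eq_abs]
        refine norm_integral_le_of_norm_le (integrableOn_ker h.lt_top)
          (Eventually.of_forall fun y => ?_)
        rw [norm_mul, Real.norm_eq_abs, abs_of_nonneg (ker_nonneg _ _ _)]
        exact mul_le_of_le_one_right (ker_nonneg _ _ _) (hu1.abs_le y)
    rcases h1 with h1 | h1
    · have h2 := kerMass_nonneg s Ω x
      simp only [hA]
      rw [mul_assoc, abs_mul, abs_mul, abs_of_nonneg (hρ1 x).1,
        abs_of_nonneg (inv_nonneg.2 h2)]
      refine mul_le_one₀ (hρ1 x).2 (by positivity) ?_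
      exact (mul_le_mul_of_nonneg_left h1 (inv_nonneg.2 h2)).trans inv_mul_le_one
    · simp [hA, kerMass_eq_zero_of_psi_eq_top h1]
  have hφb : ∃ M : ℝ, ∀ᵐ x, |φ x| ≤ M := ⟨1, Eventually.of_forall fun x => by
    by_cases hx : x ∈ Ω
    · rw [hin x hx]
      exact hu1.abs_le x
    · rw [hout x hx]
      exact hAb x⟩
  have hφm : AEStronglyMeasurable φ volume := by
    have : φ = Ω.indicator u + Ωᶜ.indicator A := by
      ext x
      by_cases hx : x ∈ Ω <;> simp [hφ, hx]
    rw [this]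
    exact (hu1.meas.indicator hΩm).add (hAm.indicator hΩm.compl)
  have hφe : FiniteEnergy s Ω φ := by
    refine ⟨hφm, hφb, energy_lt_top_of_inner hfin hφb ?_⟩
    refine lt_of_le_of_lt (le_of_eq ?_) ((inner_energy_le_jumpEnergy (s := s) (Ω := Ω) hρ
      hu1.meas).trans_lt (ENNReal.mul_lt_top (by simp) hu.domain.energy))
    refine setLIntegral_congr_fun (hΩm.prod hΩm) fun p hp => ?_
    simp only [hin _ hp.1, hin _ hp.2]
  refine ⟨φ, hφe, fun v hv hv0 => ?_, ?_⟩
  · have hvd : FormDomain volume (jumpMeasure s Ω ρ) Ω v := by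
      have h := hv.formDomain_indicator (ρ := ρ) hΩm hρ hρ1 hfin
      rwa [indicator_eq_self.2 fun x hx => by_contra fun hxΩ => hx (hv0 x hxΩ)] at h
    rw [fracForm_eq_jumpForm hΩm hρ hρ1 hfin hφe hv hv0 ?_, hind, ← hu.equation v hvd, mul_assoc]
    · congr 1
      exact setIntegral_congr_fun hΩm fun y hy => by simp only [hin y hy]
    · filter_upwards [self_mem_ae_restrict hΩm.compl] with x hxΩ _
      rw [hout x hxΩ, hkint]
  · have hae := ae_lt_top (measurable_psi s Ω) hfin.ne
    filter_upwards [hae, self_mem_ae_restrict hΩm.compl] with x hx hxΩ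
    rcases eq_or_ne (kerMass s Ω x) 0 with h0 | h0
    · have h1 : φ x = 0 := by
        rw [hout x hxΩ, hA]
        simp [h0]
      have h2 : normalizedN s Ω φ x = 0 := by
        rw [normalizedN]
        change 1 / (cns n s * kerMass s Ω x) * _ = _
        simp [h0]
      simp [h1, h2]
    · rw [normalizedN_eq hc hφm hφb hx h0, hkint, hout x hxΩ]
      simp only [hA]
      rw [hρb x hxΩ]
      have := hαβ x hxΩ
      field_simp
      ring

end RobinSolutions

/-! ### Quantitative estimates for the form and for `Jeps`. -/

section GammaConvergence

variable {s : ℝ} {Ω : Set (Eu n)} {ρ α β : Eu n → ℝ}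

/-- The exterior weight `ρ = β / (α + β)`, extended measurably. -/
structure IsRobinWeight (Ω : Set (Eu n)) (α β ρ : Eu n → ℝ) : Prop where
  meas : Measurable ρ
  mem : ∀ x, ρ x ∈ Icc (0 : ℝ) 1
  ne_zero : ∀ x ∈ Ωᶜ, α x + β x ≠ 0
  one_sub : ∀ x ∈ Ωᶜ, 1 - ρ x = α x / (α x + β x)
  eq : ∀ x ∈ Ωᶜ, ρ x = β x / (α x + β x)

open Classical in
-- Nothing is known of `α` and `β` inside `Ω`, so the quotient is used on the complement only and
-- extended by 0.
lemma exists_isRobinWeight (hΩo : IsOpen Ω) (hα0 : ∀ x ∈ Ωᶜ, 0 ≤ α x) (hβ0 : ∀ x ∈ Ωᶜ, 0 ≤ β x)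
    (hα : ContinuousOn α Ωᶜ) (hβ : ContinuousOn β Ωᶜ) (hpos : ∀ x ∈ Ωᶜ, 0 < α x + β x) :
    ∃ ρ, IsRobinWeight Ω α β ρ := by
  have hne : ∀ x ∈ Ωᶜ, α x + β x ≠ 0 := fun x hx => (hpos x hx).ne'
  refine ⟨Ωᶜ.piecewise (fun x => β x / (α x + β x)) 0,
    (hβ.div (hα.add hβ) hne).measurable_piecewise continuousOn_const hΩo.measurableSet.compl,
    fun x => ?_, hne, fun x hx => ?_, fun x hx => piecewise_eq_of_mem _ _ _ hx⟩
  · by_cases hx : x ∈ Ωᶜ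
    · rw [piecewise_eq_of_mem _ _ _ hx]
      exact ⟨div_nonneg (hβ0 x hx) (hpos x hx).le,
        (div_le_one (hpos x hx)).2 (by linarith [hα0 x hx])⟩
    · rw [piecewise_eq_of_notMem _ _ _ hx]
      exact ⟨le_rfl, zero_le_one⟩
  · rw [piecewise_eq_of_mem _ _ _ hx]
    have := hne x hx
    field_simp
    ring

lemma unitValued_chi {E : Set (Eu n)} (hE : Admissible Ω E) : UnitValued volume Ω (chi E) :=
  ⟨(measurable_chi hE.1).aestronglyMeasurable, chi_mem E, fun x hx => by
    have : x ∉ E := fun h => hx (hE.2 h)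
    simp [chi, this]⟩

/-- The fractional perimeter of a bounded set of finite perimeter is finite. -/
lemma lintegral_psi_compl_lt_top (hn : 1 ≤ n) (hs : s ∈ Ioo (0 : ℝ) 1) (hΩm : MeasurableSet Ω)
    (hΩb : Bornology.IsBounded Ω) (hP : perimeter Ω univ < ⊤) :
    ∫⁻ x in Ωᶜ, psi s Ω x < ⊤ := by
  obtain ⟨r, hr, hI⟩ := exists_lintegral_ker_mul_norm_ball_le (n := n) hn hs.2 one_ne_zero
  have hJ := lintegral_ker_compl_ball_lt_top (n := n) hs.1 hr
  -- Interpolation against the empty set; restricting the double integral to `Ωᶜ × Ω` leaves the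
  -- kernel itself.
  have h := lintegral_lintegral_abs_sub_ker_le s r hΩm hΩb hP.ne MeasurableSet.empty
    Bornology.isBounded_empty (by simp [perimeter_empty])
  refine lt_of_le_of_lt (le_trans ?_ h) ?_
  · refine le_trans (lintegral_mono_ae ?_) (setLIntegral_le_lintegral Ωᶜ _)
    filter_upwards [self_mem_ae_restrict hΩm.compl] with x hx
    refine le_trans (le_of_eq ?_) (setLIntegral_le_lintegral Ω _)
    refine setLIntegral_congr_fun hΩm fun y hy => ?_
    have hx' : x ∉ Ω := hx
    simp [chi, hx', hy]
  · have hv : ∫⁻ x, ENNReal.ofReal |chi Ω x - chi ∅ x| < ⊤ := by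
      refine lt_of_le_of_lt (le_of_eq ?_) (hΩb.measure_lt_top (μ := volume))
      rw [← lintegral_indicator_one hΩm]
      refine lintegral_congr fun x => ?_
      by_cases hx : x ∈ Ω <;> simp [chi, hx]
    rw [perimeter_empty, add_zero]
    exact ENNReal.add_lt_top.2 ⟨ENNReal.mul_lt_top (hI.trans_lt ENNReal.one_lt_top) hP,
      ENNReal.mul_lt_top hJ (ENNReal.mul_lt_top (by simp) hv)⟩

lemma lintegral_abs_chi_sub_ne_top (hΩb : Bornology.IsBounded Ω) (E F : Set (Eu n)) :
    ∫⁻ x in Ω, ENNReal.ofReal |chi E x - chi F x| ≠ ⊤ := by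
  refine ((lintegral_mono fun x => ?_ : _ ≤ ∫⁻ x in Ω, 1).trans_lt ?_).ne
  · refine ENNReal.ofReal_le_one.2 (abs_le.2 ⟨?_, ?_⟩) <;>
      linarith [(chi_mem E x).1, (chi_mem E x).2, (chi_mem F x).1, (chi_mem F x).2]
  · simpa using hΩb.measure_lt_top (μ := volume)

/-- The Robin form of a difference of characteristic functions is controlled by a small multiple
of the perimeters and a large multiple of the `L¹` distance. -/
theorem exists_jumpEnergy_chi_sub_le (hn : 1 ≤ n) (hs : s ∈ Ioo (0 : ℝ) 1) (hΩo : IsOpen Ω)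
    (hΩb : Bornology.IsBounded Ω)
    (hH : Measure.hausdorffMeasure ((n : ℝ) - 1) (frontier Ω) < ⊤) :
    ∃ D : ℝ, 0 ≤ D ∧ ∀ η : ℝ, 0 < η → ∃ C : ℝ, 0 ≤ C ∧ ∀ (ρ : Eu n → ℝ), Measurable ρ →
      (∀ x, ρ x ∈ Icc (0 : ℝ) 1) → ∀ E F : Set (Eu n), Admissible Ω E → Admissible Ω F →
      perimeter E Ω ≠ ⊤ → perimeter F Ω ≠ ⊤ →
      jumpEnergy (jumpMeasure s Ω ρ) (fun x => chi E x - chi F x) ≤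
        ENNReal.ofReal (η * ((perimeter E Ω).toReal + (perimeter F Ω).toReal + D) +
          C * (∫⁻ x in Ω, ENNReal.ofReal |chi E x - chi F x|).toReal) := by
  obtain ⟨C0, hC0, hper⟩ := exists_perimeter_univ_le hn hΩo hΩb hH
  refine ⟨2 * C0.toReal, by positivity, fun η hη => ?_⟩
  -- The factor 8 comes from the 4 in `jumpEnergy_le_energy` and the 2 lost in replacing squares by
  -- absolute values; the remaining 2 of the far part gives the 16 below.
  obtain ⟨r, hr, hI⟩ := exists_lintegral_ker_mul_norm_ball_le (n := n) hn hs.2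
    (δ := ENNReal.ofReal (η / 8)) (ENNReal.ofReal_pos.2 (by positivity)).ne'
  have hJ := lintegral_ker_compl_ball_lt_top (n := n) hs.1 hr
  set I1 := ∫⁻ h in Metric.ball (0 : Eu n) r, ENNReal.ofReal (ker s 0 h) * ENNReal.ofReal ‖h‖
  set I2 := ∫⁻ h in (Metric.ball (0 : Eu n) r)ᶜ, ENNReal.ofReal (ker s 0 h)
  refine ⟨16 * I2.toReal, by positivity, fun ρ hρ hρ1 E F hE hF hEP hFP => ?_⟩
  have hEP' : perimeter E univ ≠ ⊤ :=
    ((hper E hE.1 hE.2).trans_lt (ENNReal.add_lt_top.2 ⟨hEP.lt_top, hC0.lt_top⟩)).ne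
  have hFP' : perimeter F univ ≠ ⊤ :=
    ((hper F hF.1 hF.2).trans_lt (ENNReal.add_lt_top.2 ⟨hFP.lt_top, hC0.lt_top⟩)).ne
  have hinter := lintegral_lintegral_abs_sub_ker_le s r hE.1 (hΩb.subset hE.2) hEP' hF.1
    (hΩb.subset hF.2) hFP'
  have hmE := measurable_chi hE.1
  have hmF := measurable_chi hF.1
  have hmk := measurable_ker (n := n) s
  set N := ∫⁻ x in Ω, ENNReal.ofReal |chi E x - chi F x| with hN
  have hNtop : N ≠ ⊤ := lintegral_abs_chi_sub_ne_top hΩb E F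
  have hw0 : ∀ x ∉ Ω, chi E x - chi F x = 0 := fun x hx => by
    rw [(unitValued_chi hE).zero x hx, (unitValued_chi hF).zero x hx, sub_zero]
  have hL1 : ∫⁻ x, ENNReal.ofReal |chi E x - chi F x| = N := by
    rw [hN, ← lintegral_indicator hΩo.measurableSet]
    refine lintegral_congr fun x => ?_
    by_cases hx : x ∈ Ω
    · rw [indicator_of_mem hx]
    · simp [hw0 x hx, hx]
  -- Differences of `χ_E - χ_F` are at most 2 in absolute value, so their squares are at most twice
  -- their absolute values.
  have hen : ∫⁻ p in interaction Ω, ENNReal.ofReal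
      (((chi E p.1 - chi F p.1) - (chi E p.2 - chi F p.2)) ^ 2 * ker s p.1 p.2) ≤
      2 * ∫⁻ x, ∫⁻ y, ENNReal.ofReal
        (|(chi E x - chi F x) - (chi E y - chi F y)| * ker s x y) := by
    refine (setLIntegral_le_lintegral _ _).trans ?_
    rw [Measure.volume_eq_prod, lintegral_prod _ (by fun_prop), ← lintegral_const_mul' _ _ (by simp)]
    refine lintegral_mono fun x => ?_
    rw [← lintegral_const_mul' _ _ (by simp)]
    refine lintegral_mono fun y => ?_
    simp only
    rw [show (2 : ℝ≥0∞) = ENNReal.ofReal 2 by simp, ← ENNReal.ofReal_mul (by norm_num), ← mul_assoc]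
    refine ENNReal.ofReal_le_ofReal (mul_le_mul_of_nonneg_right ?_ (ker_nonneg _ _ _))
    rw [← sq_abs, sq]
    refine mul_le_mul_of_nonneg_right (abs_le.2 ⟨?_, ?_⟩) (abs_nonneg _) <;>
      linarith [(chi_mem E x).1, (chi_mem E x).2, (chi_mem F x).1, (chi_mem F x).2,
        (chi_mem E y).1, (chi_mem E y).2, (chi_mem F y).1, (chi_mem F y).2]
  have h1 := jumpEnergy_le_energy (s := s) hΩo.measurableSet hρ hρ1
    (hmE.sub hmF).aestronglyMeasurable hw0
  simp only [Pi.sub_apply] at h1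
  rw [hL1] at hinter
  calc jumpEnergy (jumpMeasure s Ω ρ) (fun x => chi E x - chi F x)
      ≤ 4 * (2 * (I1 * (perimeter E univ + perimeter F univ) + I2 * (2 * N))) :=
        h1.trans (mul_le_mul_right (hen.trans (mul_le_mul_right hinter 2)) 4)
    _ ≤ 4 * (2 * (ENNReal.ofReal (η / 8) * ((perimeter E Ω + C0) + (perimeter F Ω + C0)) +
          I2 * (2 * N))) := by
        gcongr
        · exact hper E hE.1 hE.2
        · exact hper F hF.1 hF.2
    _ = _ := by
        set a := (perimeter E Ω).toReal with ha
        set b := (perimeter F Ω).toReal with hb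
        have ha0 : 0 ≤ a := ENNReal.toReal_nonneg
        have hb0 : 0 ≤ b := ENNReal.toReal_nonneg
        have hc0 : 0 ≤ C0.toReal := ENNReal.toReal_nonneg
        have hi0 : 0 ≤ I2.toReal := ENNReal.toReal_nonneg
        have hn0 : 0 ≤ N.toReal := ENNReal.toReal_nonneg
        rw [← ENNReal.ofReal_toReal hEP, ← ENNReal.ofReal_toReal hFP, ← ENNReal.ofReal_toReal hC0,
          ← ENNReal.ofReal_toReal hJ.ne, ← ENNReal.ofReal_toReal hNtop,
          show (4 : ℝ≥0∞) = ENNReal.ofReal 4 by simp, show (2 : ℝ≥0∞) = ENNReal.ofReal 2 by simp,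
          ← ENNReal.ofReal_add ha0 hc0, ← ENNReal.ofReal_add hb0 hc0,
          ← ENNReal.ofReal_add (by positivity) (by positivity),
          ← ENNReal.ofReal_mul (by positivity), ← ENNReal.ofReal_mul (by positivity),
          ← ENNReal.ofReal_mul (by positivity), ← ENNReal.ofReal_add (by positivity) (by positivity),
          ← ENNReal.ofReal_mul (by positivity), ← ENNReal.ofReal_mul (by positivity),
          ENNReal.toReal_ofReal hc0, ENNReal.toReal_ofReal hi0, ENNReal.toReal_ofReal hn0]
        congr 1
        ring

/-- Weighted subadditivity of the form. -/
lemma jumpForm_le_of_sub {X : Type*} [MeasurableSpace X] {m : Measure X} {ν : Measure (X × X)}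
    {A : Set X} (hν : AbsContMarginals m ν) {u v w : X → ℝ} (hv : FormDomain m ν A v)
    (hw : FormDomain m ν A w) (huvw : ∀ x, u x = v x + w x) {τ : ℝ} (hτ : 0 < τ) :
    jumpForm ν u u ≤ (1 + τ) * jumpForm ν v v + (1 + τ⁻¹) * jumpForm ν w w := by
  have hu : u = fun x => v x + 1 * w x := by
    ext x
    rw [huvw, one_mul]
  -- Young's inequality for the cross term, from nonnegativity of the form at `w - τ v`.
  have h1 := jumpForm_self_nonneg ν (fun x => w x + (-τ) * v x)
  rw [jumpForm_add_mul_self hν hw hv] at h1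
  rw [hu, jumpForm_add_mul_self hν hv hw, jumpForm_comm ν v w]
  have h2 : 2 * jumpForm ν w v ≤ τ⁻¹ * jumpForm ν w w + τ * jumpForm ν v v := by
    have h3 := mul_nonneg (inv_pos.2 hτ).le h1
    have h4 : τ⁻¹ * (jumpForm ν w w + 2 * -τ * jumpForm ν w v + (-τ) ^ 2 * jumpForm ν v v) =
        τ⁻¹ * jumpForm ν w w - 2 * jumpForm ν w v + τ * jumpForm ν v v := by
      field_simp
      ring
    rw [h4] at h3
    linarith
  linarith

variable {t ε : ℝ} {E : Set (Eu n)}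

lemma Geps_eq_top (h : perimeter E Ω = ⊤) : Geps s t Ω α β ε E = ⊤ := by
  rw [Geps, h, EReal.coe_ennreal_top, EReal.top_sub_coe]

lemma coe_ennreal_eq_coe_toReal {a : ℝ≥0∞} (h : a ≠ ⊤) : (a : EReal) = ((a.toReal : ℝ) : EReal) := by
  conv_lhs => rw [← ENNReal.ofReal_toReal h]
  rw [EReal.coe_ennreal_ofReal, max_eq_left ENNReal.toReal_nonneg]

lemma Geps_eq_coe (h : perimeter E Ω ≠ ⊤) : Geps s t Ω α β ε E =
    (((perimeter E Ω).toReal - t * Jeps s Ω α β ε E : ℝ) : EReal) := by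
  rw [Geps, coe_ennreal_eq_coe_toReal h, EReal.coe_sub]

/-- `𝒥_ε` is the Yosida approximation of the Robin form. -/
lemma exists_isResolvent_Jeps_eq (hc : 0 < cns n s) (hΩm : MeasurableSet Ω)
    (hΩb : Bornology.IsBounded Ω) (hρ : IsRobinWeight Ω α β ρ)
    (hfin : ∫⁻ x in Ωᶜ, psi s Ω x < ⊤) (hε : 0 < ε) (hE : Admissible Ω E) :
    ∃ u, IsResolvent volume (jumpMeasure s Ω ρ) Ω (ε ^ s * cns n s) (chi E) u ∧
      Jeps s Ω α β ε E =
        cns n s * ((ε ^ s * cns n s)⁻¹ * ∫ x in Ω, chi E x * (chi E x - u x)) := by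
  have hv : volume Ω ≠ ⊤ := hΩb.measure_lt_top.ne
  have hεs : 0 < ε ^ s := Real.rpow_pos_of_pos hε s
  obtain ⟨u, hu1, hu⟩ := exists_isResolvent (absContMarginals_jumpMeasure s Ω ρ) hΩm hv
    (unitValued_chi hE) (mul_pos hεs hc)
  have hex := exists_isRobinSolution hc.ne' hΩm hρ.meas hρ.mem hfin hρ.ne_zero hρ.eq hu1 hu
  have hsol : IsRobinSolution s Ω α β ε E (potential s Ω α β ε E) := by
    rw [potential, dif_pos hex]
    exact hex.choose_spec
  refine ⟨_, hsol.isResolvent hc.ne' hΩm hρ.meas hρ.mem hfin hρ.ne_zero hρ.eq, ?_⟩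
  -- Where the prefactor `χ_E` does not vanish, `1 = χ_E`; this turns the functional into the defect
  -- of the resolvent.
  have e : ∫ x in Ω, chi E x * (1 - potential s Ω α β ε E x) =
      ∫ x in Ω, chi E x * (chi E x - Ω.indicator (potential s Ω α β ε E) x) := by
    refine setIntegral_congr_fun hΩm fun x hx => ?_
    simp only [indicator_of_mem hx]
    by_cases hxE : x ∈ E <;> simp [chi, hxE]
  rw [Jeps, e, Real.rpow_neg hε.le]
  field_simp

/-- Holds for every `ε`, not only in the limit, so it can be applied to sets varying with `ε`. -/
lemma Jeps_le (hc : 0 < cns n s) (hΩm : MeasurableSet Ω)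
    (hΩb : Bornology.IsBounded Ω) (hρ : IsRobinWeight Ω α β ρ)
    (hfin : ∫⁻ x in Ωᶜ, psi s Ω x < ⊤) (hε : 0 < ε) (hE : Admissible Ω E)
    (hQ : jumpEnergy (jumpMeasure s Ω ρ) (chi E) < ⊤) :
    Jeps s Ω α β ε E ≤ cns n s * (jumpEnergy (jumpMeasure s Ω ρ) (chi E)).toReal := by
  obtain ⟨u, hu, hJ⟩ := exists_isResolvent_Jeps_eq hc hΩm hΩb hρ hfin hε hE
  have hl : 0 < ε ^ s * cns n s := mul_pos (Real.rpow_pos_of_pos hε s) hc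
  have h := hu.defect_le (absContMarginals_jumpMeasure s Ω ρ) hΩb.measure_lt_top.ne hl.le
    (unitValued_chi hE) hQ
  rw [hJ]
  refine mul_le_mul_of_nonneg_left ?_ hc.le
  rwa [inv_mul_le_iff₀ hl]

lemma tendsto_rpow_mul_nhdsGT_zero (hs : 0 < s) {c : ℝ} (hc : 0 < c) :
    Tendsto (fun ε : ℝ => ε ^ s * c) (𝓝[>] 0) (𝓝[>] 0) := by
  refine tendsto_nhdsWithin_iff.2 ⟨?_, ?_⟩
  · have h : Tendsto (fun ε : ℝ => ε ^ s * c) (𝓝 0) (𝓝 ((0 : ℝ) ^ s * c)) :=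
      (Real.continuousAt_rpow_const _ _ (Or.inr hs.le)).tendsto.mul_const c
    rw [Real.zero_rpow hs.ne', zero_mul] at h
    exact h.mono_left nhdsWithin_le_nhds
  · filter_upwards [self_mem_nhdsWithin] with ε hε
    exact mul_pos (Real.rpow_pos_of_pos hε s) hc

/-- The matching asymptotic lower bound for a fixed set, used for the recovery family. -/
lemma eventually_lt_Jeps (hc : 0 < cns n s) (hs : 0 < s) (hΩm : MeasurableSet Ω)
    (hΩb : Bornology.IsBounded Ω) (hρ : IsRobinWeight Ω α β ρ)
    (hfin : ∫⁻ x in Ωᶜ, psi s Ω x < ⊤) (hE : Admissible Ω E)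
    (hQ : jumpEnergy (jumpMeasure s Ω ρ) (chi E) < ⊤) {d : ℝ}
    (hd : d < cns n s * (jumpEnergy (jumpMeasure s Ω ρ) (chi E)).toReal) :
    ∀ᶠ ε in 𝓝[>] (0 : ℝ), d < Jeps s Ω α β ε E := by
  have h := (tendsto_rpow_mul_nhdsGT_zero hs hc).eventually (eventually_lt_defect
    (absContMarginals_jumpMeasure s Ω ρ) hΩm hΩb.measure_lt_top.ne (unitValued_chi hE) hQ
    ((div_lt_iff₀' hc).2 hd))
  filter_upwards [h, self_mem_nhdsWithin] with ε h1 hε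
  obtain ⟨u, hu, hJ⟩ := exists_isResolvent_Jeps_eq hc hΩm hΩb hρ hfin hε hE
  rw [hJ]
  exact (div_lt_iff₀' hc).1 (h1 u hu)

end GammaConvergence

/-! ### The two Γ-convergence inequalities. -/

section GammaLimit

variable {s t : ℝ} {Ω : Set (Eu n)} {ρ α β : Eu n → ℝ} {E : Set (Eu n)}

/-- The form of the characteristic function of a set of finite perimeter in `Ω` is finite. -/
lemma jumpEnergy_chi_lt_top (hn : 1 ≤ n) (hs : s ∈ Ioo (0 : ℝ) 1) (hΩo : IsOpen Ω)
    (hΩb : Bornology.IsBounded Ω)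
    (hH : Measure.hausdorffMeasure ((n : ℝ) - 1) (frontier Ω) < ⊤) (hρ : IsRobinWeight Ω α β ρ)
    (hE : Admissible Ω E) (hP : perimeter E Ω ≠ ⊤) :
    jumpEnergy (jumpMeasure s Ω ρ) (chi E) < ⊤ := by
  obtain ⟨D, -, hD⟩ := exists_jumpEnergy_chi_sub_le hn hs hΩo hΩb hH
  obtain ⟨C, -, hC⟩ := hD 1 one_pos
  have h := hC ρ hρ.meas hρ.mem E ∅ hE ⟨MeasurableSet.empty, empty_subset _⟩ hP
    (by simp [perimeter_empty])
  have e : (fun x => chi E x - chi ∅ x) = chi E := by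
    ext x
    simp [chi]
  rw [e] at h
  exact h.trans_lt ENNReal.ofReal_lt_top

lemma Gzero_eq_coe (hc : 0 < cns n s) (ht : 0 < t) (hΩm : MeasurableSet Ω)
    (hρ : IsRobinWeight Ω α β ρ) (hfin : ∫⁻ x in Ωᶜ, psi s Ω x < ⊤) (hE : Admissible Ω E)
    (hP : perimeter E Ω ≠ ⊤) (hQ : jumpEnergy (jumpMeasure s Ω ρ) (chi E) < ⊤) :
    Gzero s t Ω α β E = (((perimeter E Ω).toReal -
      t * (cns n s * (jumpEnergy (jumpMeasure s Ω ρ) (chi E)).toReal) : ℝ) : EReal) := by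
  rw [Gzero, if_neg hP, ← jumpEnergy_chi hΩm hρ.meas hfin hρ.one_sub hρ.eq hρ.mem hE.1 hE.2,
    coe_ennreal_eq_coe_toReal hP,
    coe_ennreal_eq_coe_toReal (ENNReal.mul_lt_top ENNReal.ofReal_lt_top hQ).ne,
    ENNReal.toReal_mul, ENNReal.toReal_ofReal (mul_pos ht hc).le, EReal.coe_sub, mul_assoc]

/-- Constant families are recovery families. -/
theorem limsup_Geps_le (hn : 1 ≤ n) (hs : s ∈ Ioo (0 : ℝ) 1) (hΩo : IsOpen Ω)
    (hΩb : Bornology.IsBounded Ω)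
    (hH : Measure.hausdorffMeasure ((n : ℝ) - 1) (frontier Ω) < ⊤) (hρ : IsRobinWeight Ω α β ρ)
    (hfin : ∫⁻ x in Ωᶜ, psi s Ω x < ⊤) (ht : 0 < t) (hE : Admissible Ω E) :
    limsup (fun ε => Geps s t Ω α β ε E) (𝓝[>] 0) ≤ Gzero s t Ω α β E := by
  rcases eq_or_ne (perimeter E Ω) ⊤ with hP | hP
  · rw [Gzero, if_pos hP]
    exact le_top
  have hc := cns_pos hn hs
  have hQ := jumpEnergy_chi_lt_top hn hs hΩo hΩb hH hρ hE hP
  rw [Gzero_eq_coe hc ht hΩo.measurableSet hρ hfin hE hP hQ]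
  refine le_of_forall_gt fun c hcz => ?_
  obtain ⟨a, ha1, ha2⟩ := EReal.lt_iff_exists_real_btwn.1 hcz
  refine lt_of_le_of_lt (limsup_le_of_le (h := ?_)) ha2
  have ha := EReal.coe_lt_coe_iff.1 ha1
  have hd : ((perimeter E Ω).toReal - a) / t <
      cns n s * (jumpEnergy (jumpMeasure s Ω ρ) (chi E)).toReal := by
    rw [div_lt_iff₀' ht]
    linarith
  filter_upwards [eventually_lt_Jeps hc hs.1 hΩo.measurableSet hΩb hρ hfin hE hQ hd] with ε hε
  rw [Geps_eq_coe hP, EReal.coe_le_coe_iff]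
  rw [div_lt_iff₀' ht] at hε
  linarith

/-- A lower bound for the functionals by comparison with a fixed set. -/
lemma exists_le_sub_mul_Jeps (hn : 1 ≤ n) (hs : s ∈ Ioo (0 : ℝ) 1) (hΩo : IsOpen Ω)
    (hΩb : Bornology.IsBounded Ω)
    (hH : Measure.hausdorffMeasure ((n : ℝ) - 1) (frontier Ω) < ⊤) (hρ : IsRobinWeight Ω α β ρ)
    (hfin : ∫⁻ x in Ωᶜ, psi s Ω x < ⊤) (ht : 0 < t) (hE : Admissible Ω E)
    (hP : perimeter E Ω ≠ ⊤) {γ : ℝ} (hγ : 0 < γ) {κ₀ : ℝ} (hκ₀ : 0 < κ₀) :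
    ∃ C κ : ℝ, 0 ≤ C ∧ 0 < κ ∧ κ ≤ κ₀ ∧ ∀ ε : ℝ, 0 < ε → ∀ F, Admissible Ω F →
      perimeter F Ω ≠ ⊤ →
      (1 - κ) * (perimeter F Ω).toReal -
        t * (cns n s * (jumpEnergy (jumpMeasure s Ω ρ) (chi E)).toReal) - γ -
        C * (∫⁻ x in Ω, ENNReal.ofReal |chi F x - chi E x|).toReal ≤
      (perimeter F Ω).toReal - t * Jeps s Ω α β ε F := by
  obtain ⟨D, hD0, hD⟩ := exists_jumpEnergy_chi_sub_le hn hs hΩo hΩb hH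
  have hc := cns_pos hn hs
  have hQ := jumpEnergy_chi_lt_top hn hs hΩo hΩb hH hρ hE hP
  have hν := absContMarginals_jumpMeasure s Ω ρ
  set q := (jumpEnergy (jumpMeasure s Ω ρ) (chi E)).toReal with hq
  set p := (perimeter E Ω).toReal with hp
  have hq0 : 0 ≤ q := ENNReal.toReal_nonneg
  have hp0 : 0 ≤ p := ENNReal.toReal_nonneg
  have htc : 0 < t * cns n s := mul_pos ht hc
  -- Half of `γ` pays for the Young excess `t c q τ`; the other half, through `κ`, pays for `κ (p +
  -- D)`. The `+ 1` keeps denominators positive.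
  set τ := γ / (2 * (t * cns n s * q + 1)) with hτ
  have hτ0 : 0 < τ := by positivity
  have hτq : t * cns n s * q * τ ≤ γ / 2 := by
    rw [hτ, mul_div_assoc', div_le_div_iff₀ (by positivity) two_pos]
    nlinarith [mul_nonneg htc.le hq0]
  set κ := min κ₀ (γ / (2 * (p + D + 1))) with hκ
  have hκ0 : 0 < κ := lt_min hκ₀ (by positivity)
  have hκγ : κ * (p + D) ≤ γ / 2 := by
    have h1 : κ * (p + D) ≤ γ / (2 * (p + D + 1)) * (p + D) :=
      mul_le_mul_of_nonneg_right (min_le_right _ _) (by positivity)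
    refine h1.trans ?_
    rw [div_mul_eq_mul_div, div_le_div_iff₀ (by positivity) two_pos]
    nlinarith
  set A := t * cns n s * (1 + τ⁻¹) with hA
  have hA0 : 0 < A := by positivity
  -- Dividing by `A`, the coefficient of the form of `χ_F - χ_E`, leaves exactly `κ` in front of the
  -- perimeter of `F`.
  obtain ⟨C, hC0, hC⟩ := hD (κ / A) (by positivity)
  refine ⟨A * C, κ, by positivity, hκ0, min_le_left _ _, fun ε hε F hF hFP => ?_⟩
  have hQF := jumpEnergy_chi_lt_top hn hs hΩo hΩb hH hρ hF hFP
  have hJ := Jeps_le hc hΩo.measurableSet hΩb hρ hfin hε hF hQF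
  have hCF := hC ρ hρ.meas hρ.mem F E hF hE hFP hP
  set N := (∫⁻ x in Ω, ENNReal.ofReal |chi F x - chi E x|).toReal with hN
  set P := (perimeter F Ω).toReal with hPF
  have hN0 : 0 ≤ N := ENNReal.toReal_nonneg
  have hP0 : 0 ≤ P := ENNReal.toReal_nonneg
  have hFd := (unitValued_chi hF).formDomain hQF
  have hEd := (unitValued_chi hE).formDomain hQ
  have hwd : FormDomain volume (jumpMeasure s Ω ρ) Ω (fun x => chi F x - chi E x) := by
    have h := hFd.add_mul hν hEd (-1)
    simpa only [neg_one_mul, ← sub_eq_add_neg] using h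
  have hsub := jumpForm_le_of_sub hν hEd hwd (u := chi F) (fun x => by ring) hτ0
  rw [jumpForm_self hν hFd.meas, jumpForm_self hν hEd.meas, jumpForm_self hν hwd.meas, ← hq] at hsub
  have hw := ENNReal.toReal_le_of_le_ofReal (by positivity) hCF
  set W := (jumpEnergy (jumpMeasure s Ω ρ) (fun x => chi F x - chi E x)).toReal with hW
  have h1 : t * Jeps s Ω α β ε F ≤ t * (cns n s * ((1 + τ) * q + (1 + τ⁻¹) * W)) :=
    mul_le_mul_of_nonneg_left (hJ.trans (mul_le_mul_of_nonneg_left hsub hc.le)) ht.le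
  have h2 : A * W ≤ κ * (P + p + D) + A * C * N := by
    refine (mul_le_mul_of_nonneg_left hw hA0.le).trans (le_of_eq ?_)
    rw [← hp]
    field_simp
  have h3 : t * (cns n s * ((1 + τ) * q + (1 + τ⁻¹) * W)) =
      t * (cns n s * q) + t * cns n s * q * τ + A * W := by
    rw [hA]
    ring
  nlinarith

/-- The liminf inequality. -/
theorem le_liminf_Geps (hn : 1 ≤ n) (hs : s ∈ Ioo (0 : ℝ) 1) (hΩo : IsOpen Ω)
    (hΩb : Bornology.IsBounded Ω)
    (hH : Measure.hausdorffMeasure ((n : ℝ) - 1) (frontier Ω) < ⊤) (hρ : IsRobinWeight Ω α β ρ)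
    (hfin : ∫⁻ x in Ωᶜ, psi s Ω x < ⊤) (ht : 0 < t) (hE : Admissible Ω E)
    {Es : ℝ → Set (Eu n)} (hEs : ∀ ε, Admissible Ω (Es ε)) (hlim : ConvergesL1 Ω Es E) :
    Gzero s t Ω α β E ≤ liminf (fun ε => Geps s t Ω α β ε (Es ε)) (𝓝[>] 0) := by
  have hc := cns_pos hn hs
  have hlsc : ∀ b : ℝ≥0∞, b < perimeter E Ω → ∀ᶠ ε in 𝓝[>] (0 : ℝ), b < perimeter (Es ε) Ω :=
    fun b hb => eventually_lt_perimeter (fun ε => (hEs ε).1) hE.1 hlim hb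
  refine le_of_forall_lt fun c hcz => ?_
  obtain ⟨a, ha1, ha2⟩ := EReal.lt_iff_exists_real_btwn.1 hcz
  refine lt_of_lt_of_le ha1 (le_liminf_of_le (h := ?_))
  rcases eq_or_ne (perimeter E Ω) ⊤ with hP | hP
  -- When `P(E, Ω) = ∞` the comparison set is empty. With `κ ≤ 1/2` at least half the perimeter
  -- survives, and it exceeds any bound by lower semicontinuity while the other terms stay bounded.
  · have hempty : Admissible Ω ∅ := ⟨MeasurableSet.empty, empty_subset _⟩
    obtain ⟨C, κ, hC0, -, hκ, hle⟩ := exists_le_sub_mul_Jeps hn hs hΩo hΩb hH hρ hfin ht hempty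
      (by simp [perimeter_empty]) one_pos (half_pos one_pos)
    set q := t * (cns n s * (jumpEnergy (jumpMeasure s Ω ρ) (chi ∅)).toReal)
    set V := (volume Ω).toReal
    have hV : ∀ ε, (∫⁻ x in Ω, ENNReal.ofReal |chi (Es ε) x - chi ∅ x|).toReal ≤ V := by
      intro ε
      refine ENNReal.toReal_mono hΩb.measure_lt_top.ne ?_
      refine (lintegral_mono fun x => ?_ : _ ≤ ∫⁻ x in Ω, 1).trans (by simp)
      refine ENNReal.ofReal_le_one.2 ?_
      simpa [chi] using abs_chi_le (Es ε) x
    filter_upwards [hlsc (ENNReal.ofReal (2 * (|a| + q + 1 + C * V)))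
      (by rw [hP]; exact ENNReal.ofReal_lt_top), self_mem_nhdsWithin] with ε h1 hε
    rcases eq_or_ne (perimeter (Es ε) Ω) ⊤ with hPε | hPε
    · rw [Geps_eq_top hPε]
      exact le_top
    rw [Geps_eq_coe hPε, EReal.coe_le_coe_iff]
    refine le_trans ?_ (hle ε hε (Es ε) (hEs ε) hPε)
    have hq0 : 0 ≤ q := by positivity
    have h3 : 2 * (|a| + q + 1 + C * V) < (perimeter (Es ε) Ω).toReal :=
      (ENNReal.ofReal_lt_iff_lt_toReal (by positivity) hPε).1 h1
    have h4 := mul_le_mul_of_nonneg_left (hV ε) hC0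
    have h5 : (1 / 2 : ℝ) * (perimeter (Es ε) Ω).toReal ≤
        (1 - κ) * (perimeter (Es ε) Ω).toReal :=
      mul_le_mul_of_nonneg_right (by linarith) ENNReal.toReal_nonneg
    have h6 := le_abs_self a
    linarith
  · have hQ := jumpEnergy_chi_lt_top hn hs hΩo hΩb hH hρ hE hP
    rw [Gzero_eq_coe hc ht hΩo.measurableSet hρ hfin hE hP hQ, EReal.coe_lt_coe_iff] at ha2
    set q := t * (cns n s * (jumpEnergy (jumpMeasure s Ω ρ) (chi E)).toReal) with hq
    set p := (perimeter E Ω).toReal with hp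
    have hp0 : 0 ≤ p := ENNReal.toReal_nonneg
    -- Four losses of size at most `γ`: lower semicontinuity of the perimeter, the absorbed fraction
    -- `κ p`, the comparison error, and the `L¹` term.
    set γ := (p - q - a) / 4 with hγ
    have hγ0 : 0 < γ := by
      rw [hγ]
      linarith
    obtain ⟨C, κ, hC0, hκ0, hκ, hle⟩ := exists_le_sub_mul_Jeps hn hs hΩo hΩb hH hρ hfin ht hE hP
      hγ0 (κ₀ := min 1 (γ / (p + 1))) (lt_min one_pos (by positivity))
    have hκ1 : κ ≤ 1 := hκ.trans (min_le_left _ _)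
    have hκp : κ * p ≤ γ := by
      have h1 : κ * (p + 1) ≤ γ := by
        rw [← le_div_iff₀ (by positivity)]
        exact hκ.trans (min_le_right _ _)
      nlinarith
    have hP1 : ∀ᶠ ε in 𝓝[>] (0 : ℝ), perimeter (Es ε) Ω ≠ ⊤ →
        p - γ ≤ (perimeter (Es ε) Ω).toReal := by
      rcases lt_or_ge (p - γ) 0 with hneg | hnonneg
      · exact Eventually.of_forall fun ε _ => hneg.le.trans ENNReal.toReal_nonneg
      · have hlt : ENNReal.ofReal (p - γ) < perimeter E Ω :=
          (ENNReal.ofReal_lt_iff_lt_toReal hnonneg hP).2 (by linarith)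
        filter_upwards [hlsc _ hlt] with ε h1 h2
        exact ((ENNReal.ofReal_lt_iff_lt_toReal hnonneg h2).1 h1).le
    have hN : ∀ᶠ ε in 𝓝[>] (0 : ℝ),
        C * (∫⁻ x in Ω, ENNReal.ofReal |chi (Es ε) x - chi E x|).toReal < γ := by
      have h1 : Tendsto (fun ε => C *
          (∫⁻ x in Ω, ENNReal.ofReal |chi (Es ε) x - chi E x|).toReal) (𝓝[>] 0) (𝓝 (C * 0)) :=
        ((ENNReal.tendsto_toReal ENNReal.zero_ne_top).comp hlim).const_mul C
      rw [mul_zero] at h1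
      exact h1.eventually (gt_mem_nhds hγ0)
    filter_upwards [hP1, hN, self_mem_nhdsWithin] with ε h1 h2 hε
    rcases eq_or_ne (perimeter (Es ε) Ω) ⊤ with hPε | hPε
    · rw [Geps_eq_top hPε]
      exact le_top
    rw [Geps_eq_coe hPε, EReal.coe_le_coe_iff]
    refine le_trans ?_ (hle ε hε (Es ε) (hEs ε) hPε)
    have h3 : (1 - κ) * (p - γ) ≤ (1 - κ) * (perimeter (Es ε) Ω).toReal :=
      mul_le_mul_of_nonneg_left (h1 hPε) (by linarith)
    have h4 := mul_pos hκ0 hγ0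
    have h5 : p - q - a = 4 * γ := by
      rw [hγ]
      ring
    nlinarith

end GammaLimit
end RobinGamma

theorem mainTheorem7 (n : ℕ) (hn : 1 ≤ n) (s : ℝ) (hs : s ∈ Set.Ioo (0 : ℝ) 1)
    (Ω : Set (RobinGamma.Eu n)) (hΩo : IsOpen Ω) (hΩb : Bornology.IsBounded Ω)
    (hΩP : RobinGamma.perimeter Ω Set.univ < ⊤)
    (hΩH : MeasureTheory.Measure.hausdorffMeasure ((n : ℝ) - 1) (frontier Ω) < ⊤)
    (α β : RobinGamma.Eu n → ℝ)
    (hα0 : ∀ x ∈ Ωᶜ, 0 ≤ α x) (hβ0 : ∀ x ∈ Ωᶜ, 0 ≤ β x)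
    (hαb : ∃ M : ℝ, ∀ x ∈ Ωᶜ, α x ≤ M) (hβb : ∃ M : ℝ, ∀ x ∈ Ωᶜ, β x ≤ M)
    (hαL : ∃ L : ℝ≥0, LipschitzOnWith L α Ωᶜ) (hβL : ∃ L : ℝ≥0, LipschitzOnWith L β Ωᶜ)
    (hαβ : ∃ σ : ℝ, 0 < σ ∧ ∀ x ∈ Ωᶜ, σ ≤ α x + β x) :
    (∀ ε : ℝ, 0 < ε → ∀ E, RobinGamma.Admissible Ω E →
      (∃ φ, RobinGamma.IsRobinSolution s Ω α β ε E φ) ∧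
      (∀ φ φ', RobinGamma.IsRobinSolution s Ω α β ε E φ →
        RobinGamma.IsRobinSolution s Ω α β ε E φ' →
        ∀ᵐ x ∂(MeasureTheory.volume.restrict Ω), φ x = φ' x)) ∧
    ∀ t : ℝ, 0 < t →
      RobinGamma.GammaConverges Ω (RobinGamma.Geps s t Ω α β) (RobinGamma.Gzero s t Ω α β) := by
  obtain ⟨Lα, hLα⟩ := hαL
  obtain ⟨Lβ, hLβ⟩ := hβL
  obtain ⟨σ, hσ, hσαβ⟩ := hαβ
  obtain ⟨ρ, hρ⟩ := RobinGamma.exists_isRobinWeight hΩo hα0 hβ0 hLα.continuousOn hLβ.continuousOn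
    fun x hx => hσ.trans_le (hσαβ x hx)
  have hΩm := hΩo.measurableSet
  have hfin := RobinGamma.lintegral_psi_compl_lt_top hn hs hΩm hΩb hΩP
  have hc := RobinGamma.cns_pos hn hs
  have hν := RobinGamma.absContMarginals_jumpMeasure s Ω ρ
  have hv : volume Ω ≠ ⊤ := hΩb.measure_lt_top.ne
  -- The recovery family is constantly `E`.
  refine ⟨fun ε hε E hE => ⟨?_, fun φ φ' hφ hφ' => ?_⟩, fun t ht =>
    ⟨fun E hE Es hEs hlim => ?_, fun E hE => ⟨fun _ => E, fun _ => hE, ?_, ?_⟩⟩⟩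
  · obtain ⟨u, hu1, hu⟩ := RobinGamma.exists_isResolvent hν hΩm hv (RobinGamma.unitValued_chi hE)
      (mul_pos (Real.rpow_pos_of_pos hε s) hc)
    exact RobinGamma.exists_isRobinSolution hc.ne' hΩm hρ.meas hρ.mem hfin hρ.ne_zero hρ.eq hu1 hu
  · have h1 := hφ.isResolvent hc.ne' hΩm hρ.meas hρ.mem hfin hρ.ne_zero hρ.eq
    have h2 := hφ'.isResolvent hc.ne' hΩm hρ.meas hρ.mem hfin hρ.ne_zero hρ.eq
    filter_upwards [h1.ae_eq hν hv (mul_pos (Real.rpow_pos_of_pos hε s) hc).le h2,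
      self_mem_ae_restrict hΩm] with x hx hxΩ
    rwa [indicator_of_mem hxΩ, indicator_of_mem hxΩ] at hx
  · exact RobinGamma.le_liminf_Geps hn hs hΩo hΩb hΩH hρ hfin ht hE hEs hlim
  · simp [RobinGamma.ConvergesL1]
  · exact RobinGamma.limsup_Geps_le hn hs hΩo hΩb hΩH hρ hfin ht hE
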